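/- A polygon is a simple closed polygon in the Euclidean plane, regarded as a geometric graph (a straight-line drawing, without crossings, of a cycle), and its vertices are assumed to be in general position, i.e. no three of them are collinear. A compatible matching of a polygon $P$ is a set $M$ of line segments, each joining two vertices of $P$, such that every vertex of $P$ is an endpoint of at most one segment of $M$, no segment of $M$ is an edge of $P$, and the drawing $P+M$ is noncrossing (the segments may lie inside or outside $P$; two distinct edges of $P+M$ meet at most in a common endpoint). It is maximal if it is not properly contained in another compatible matching of $P$. Let $\mathrm{mm}(P)$ be the minimum number of edges of a maximal compatible matching of $P$, let $P_n$ be the family of all $n$-vertex polygons, and let $\mathrm{mm}(P_n)=\min\{\mathrm{mm}(P) : P\in P_n\}$. Theorem. Let $n\ge 4$. Every maximal compatible matching of an $n$-vertex polygon has at least $n/7$ edges; that is, $\mathrm{mm}(P_n)\ge \frac{n}{7}$. The bound is tight for infinitely many $n$: there are infinitely many $n \geq 4$ for which some $n$-vertex polygon has a maximal compatible matching with exactly $n/7$ edges, so that $\mathrm{mm}(P_n)=\frac{n}{7}$. -/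

import Mathlib

/-- The Euclidean plane. -/
abbrev Plane : Type := EuclideanSpace ℝ (Fin 2)

/-- The straight-line drawing of the graph `G` with vertex positions `pos` is noncrossing: no vertex
lies on an edge it is not an endpoint of, and two distinct edges meet at most in a common
endpoint. -/
def IsNoncrossing {V : Type*} (pos : V → Plane) (G : SimpleGraph V) : Prop :=
  (∀ a b v : V, G.Adj a b → pos v ∈ segment ℝ (pos a) (pos b) → v = a ∨ v = b) ∧
  ∀ a b c d : V, G.Adj a b → G.Adj c d → s(a, b) ≠ s(c, d) →
    segment ℝ (pos a) (pos b) ∩ segment ℝ (pos c) (pos d) ⊆ pos '' ({a, b} ∩ {c, d})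

/-- A (noncrossing) geometric graph: a graph drawn in the plane with distinct vertices and
noncrossing straight-line edges. -/
structure GeometricGraph (V : Type*) where
  pos : V → Plane
  graph : SimpleGraph V
  pos_injective : Function.Injective pos
  noncrossing : IsNoncrossing pos graph

namespace GeometricGraph

variable {V : Type*}

/-- No three vertices are collinear. -/
def InGeneralPosition (G : GeometricGraph V) : Prop :=
  ∀ a b c : V, a ≠ b → b ≠ c → a ≠ c → ¬ Collinear ℝ {G.pos a, G.pos b, G.pos c}

/-- `M` (given by its edges, as a graph on the vertices of `G`) is a matching that is compatible
with `G`: every vertex is in at most one edge of `M`, no edge of `M` is an edge of `G`, and the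
drawing of `G + M` is noncrossing. -/
structure IsCompatibleMatching (G : GeometricGraph V) (M : SimpleGraph V) : Prop where
  matching : ∀ u v w : V, M.Adj u v → M.Adj u w → v = w
  disjoint : Disjoint G.graph M
  noncrossing : IsNoncrossing G.pos (G.graph ⊔ M)

/-- A compatible matching that is not properly contained in another compatible matching. -/
def IsMaximalCompatibleMatching (G : GeometricGraph V) (M : SimpleGraph V) : Prop :=
  Maximal G.IsCompatibleMatching M

/-- The minimum number of edges of a maximal compatible matching of `G`. -/
noncomputable def mm (G : GeometricGraph V) : ℕ :=
  sInf {k : ℕ | ∃ M : SimpleGraph V, G.IsMaximalCompatibleMatching M ∧ M.edgeSet.ncard = k}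

/-- The minimum of `mm G` over all members `G` of a family of geometric graphs. -/
noncomputable def mmFamily (F : Set (GeometricGraph V)) : ℕ :=
  sInf (mm '' F)

/-- The family of all `n`-vertex simple polygons with vertices in general position, the vertices
being labelled in cyclic order along the polygon. (For `3 ≤ n`, `cycleGraph n` is the cycle on
`n` vertices.) -/
def polygons (n : ℕ) : Set (GeometricGraph (Fin n)) :=
  {P | P.graph = SimpleGraph.cycleGraph n ∧ P.InGeneralPosition}

end GeometricGraph

/-! ### Orientations of planar point configurations -/

section Orientation

variable {V : Type*} (X Y : V → ℝ)

/-- Twice the signed area of the triangle `abc`, the points having coordinates `X` and `Y`. -/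
def orient (a b c : V) : ℝ := (X b - X a) * (Y c - Y a) - (Y b - Y a) * (X c - X a)

/-- The segments `ab` and `cd` cross in a point interior to both. -/
def Crosses (a b c d : V) : Prop :=
  orient X Y a b c * orient X Y a b d < 0 ∧ orient X Y c d a * orient X Y c d b < 0

/-- No three distinct points are collinear. -/
def GenPos : Prop := ∀ a b c : V, a ≠ b → b ≠ c → a ≠ c → orient X Y a b c ≠ 0

variable {X Y}

lemma orient_swap (a b c : V) : orient X Y a c b = -orient X Y a b c := by
  simp only [orient]; ring

lemma orient_swap' (a b c : V) : orient X Y b a c = -orient X Y a b c := by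
  simp only [orient]; ring

lemma orient_rot (a b c : V) : orient X Y b c a = orient X Y a b c := by
  simp only [orient]; ring

lemma orient_rot' (a b c : V) : orient X Y c a b = orient X Y a b c := by
  simp only [orient]; ring

lemma orient_rev (a b c : V) : orient X Y c b a = -orient X Y a b c := by
  simp only [orient]; ring

@[simp] lemma orient_self_left (a b : V) : orient X Y a a b = 0 := by simp [orient]

@[simp] lemma orient_self_right (a b : V) : orient X Y a b b = 0 := by simp only [orient]; ring

@[simp] lemma orient_self_mid (a b : V) : orient X Y a b a = 0 := by simp [orient]

lemma orient_sum (a b c d : V) :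
    orient X Y b c d + orient X Y c a d + orient X Y a b d = orient X Y a b c := by
  simp only [orient]; ring

/-- Barycentric coordinates of `p` satisfy every linear relation through `p`. -/
lemma orient_bary (a b c p q : V) :
    orient X Y b c p * orient X Y p q a + orient X Y c a p * orient X Y p q b
      + orient X Y a b p * orient X Y p q c = 0 := by
  simp only [orient]; ring

lemma orient_bary' (a b c p q : V) :
    orient X Y b c q * orient X Y p q a + orient X Y c a q * orient X Y p q b
      + orient X Y a b q * orient X Y p q c = 0 := by
  simp only [orient]; ring

/-- The linear dependency of three vectors at `z`. -/
lemma orient_dep (z a x b e : V) :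
    orient X Y z x b * orient X Y z e a + orient X Y z b a * orient X Y z e x
      + orient X Y z a x * orient X Y z e b = 0 := by
  simp only [orient]; ring

lemma Crosses.symm {a b c d : V} (h : Crosses X Y a b c d) : Crosses X Y c d a b := ⟨h.2, h.1⟩

lemma Crosses.swap_left {a b c d : V} (h : Crosses X Y a b c d) : Crosses X Y b a c d := by
  obtain ⟨h1, h2⟩ := h
  refine ⟨?_, by rwa [mul_comm]⟩
  rw [orient_swap' a b c, orient_swap' a b d]; linarith

lemma Crosses.swap_right {a b c d : V} (h : Crosses X Y a b c d) : Crosses X Y a b d c :=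
  h.symm.swap_left.symm

lemma Crosses.ne {a b c d : V} (h : Crosses X Y a b c d) :
    a ≠ b ∧ c ≠ d ∧ a ≠ c ∧ a ≠ d ∧ b ≠ c ∧ b ≠ d := by
  obtain ⟨h1, h2⟩ := h
  refine ⟨?_, ?_, ?_, ?_, ?_, ?_⟩ <;> rintro rfl <;> simp at h1 h2

/-- The common point of two crossing segments, evaluated by all affine functions `orient r s`. -/
lemma Crosses.exists_param {a b c d : V} (h : Crosses X Y a b c d) :
    ∃ t s : ℝ, 0 < t ∧ t < 1 ∧ 0 < s ∧ s < 1 ∧ ∀ r r' : V,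
      (1 - t) * orient X Y r r' a + t * orient X Y r r' b
        = (1 - s) * orient X Y r r' c + s * orient X Y r r' d := by
  obtain ⟨h1, h2⟩ := h
  have key : ∀ u v : ℝ, u * v < 0 → u - v ≠ 0 ∧ 0 < u / (u - v) ∧ u / (u - v) < 1 := by
    intro u v huv
    rcases mul_neg_iff.1 huv with ⟨hu, hv⟩ | ⟨hu, hv⟩
    · refine ⟨by linarith, div_pos hu (by linarith), ?_⟩
      rw [div_lt_one (by linarith)]; linarith
    · refine ⟨by linarith, div_pos_of_neg_of_neg hu (by linarith), ?_⟩
      rw [div_lt_one_of_neg (by linarith)]; linarith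
  obtain ⟨n1, p1, q1⟩ := key _ _ h1
  obtain ⟨n2, p2, q2⟩ := key _ _ h2
  refine ⟨_, _, p2, q2, p1, q1, fun r r' => ?_⟩
  have e : orient X Y a b c - orient X Y a b d = -(orient X Y c d a - orient X Y c d b) := by
    simp only [orient]; ring
  rw [e] at n1 ⊢
  field_simp
  simp only [orient]; ring

variable (X Y) in
/-- `d` lies strictly inside the counterclockwise triangle `abc`. -/
def Inside (a b c d : V) : Prop :=
  0 < orient X Y b c d ∧ 0 < orient X Y c a d ∧ 0 < orient X Y a b d

lemma Inside.rot {a b c d : V} (h : Inside X Y a b c d) : Inside X Y b c a d := ⟨h.2.1, h.2.2, h.1⟩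

end Orientation

/-! ### Maximal noncrossing graphs -/

section Triangulation

variable {V : Type*} {X Y : V → ℝ} {T : SimpleGraph V}

variable (X Y T) in
/-- `T` is a maximal noncrossing straight-line graph on points in general position. -/
structure IsTriangulation : Prop where
  genPos : GenPos X Y
  noncrossing : ∀ a b c d, T.Adj a b → T.Adj c d → ¬ Crosses X Y a b c d
  maximal : ∀ a b, a ≠ b → (∀ c d, T.Adj c d → ¬ Crosses X Y a b c d) → T.Adj a b

variable (X Y T) in
/-- `abc` is a counterclockwise triangle of `T` without vertices in its interior. -/
structure IsFace (a b c : V) : Prop where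
  adj_ab : T.Adj a b
  adj_bc : T.Adj b c
  adj_ca : T.Adj c a
  pos : 0 < orient X Y a b c
  empty : ∀ d, ¬ Inside X Y a b c d

lemma IsFace.rot {a b c : V} (h : IsFace X Y T a b c) : IsFace X Y T b c a :=
  ⟨h.adj_bc, h.adj_ca, h.adj_ab, by rw [orient_rot]; exact h.pos,
    fun d hd => h.empty d hd.rot.rot⟩

/-- Signs of the barycentric coordinates `p`, `q` of the ends of a segment which meets the interior
of a triangle, and of the position `L` of the triangle's vertices relative to the segment: if the
first end is outside, then the segment crosses a side. -/
lemma exists_side_crossed {p1 p2 p3 q1 q2 q3 L1 L2 L3 t : ℝ} (ht0 : 0 < t) (ht1 : t < 1)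
    (y1 : 0 < (1 - t) * p1 + t * q1) (y2 : 0 < (1 - t) * p2 + t * q2)
    (y3 : 0 < (1 - t) * p3 + t * q3)
    (hp : p1 * L1 + p2 * L2 + p3 * L3 = 0) (hq : q1 * L1 + q2 * L2 + q3 * L3 = 0)
    (hp1 : p1 < 0) (hL2 : L2 = 0 → q1 = 0) (hL3 : L3 = 0 → q1 = 0)
    (c1 : p1 < 0 → 0 < q1 → ¬ L2 * L3 < 0) (c2 : p2 < 0 → 0 < q2 → ¬ L3 * L1 < 0)
    (c3 : p3 < 0 → 0 < q3 → ¬ L1 * L2 < 0) : False := by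
  have hs : 0 < 1 - t := by linarith
  have hq_pos : ∀ p q : ℝ, 0 < (1 - t) * p + t * q → p < 0 → 0 < q := by
    intro p q h hp
    by_contra hq
    have := mul_neg_of_pos_of_neg hs hp
    have := mul_nonpos_of_nonneg_of_nonpos ht0.le (not_lt.1 hq)
    linarith
  have hq1 := hq_pos _ _ y1 hp1
  have hy : ((1 - t) * p1 + t * q1) * L1 + ((1 - t) * p2 + t * q2) * L2
      + ((1 - t) * p3 + t * q3) * L3 = 0 := by linear_combination (1 - t) * hp + t * hq
  have h23 : 0 < L2 * L3 := lt_of_le_of_ne (not_lt.1 (c1 hp1 hq1))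
    (mul_ne_zero (fun h => hq1.ne' (hL2 h)) (fun h => hq1.ne' (hL3 h))).symm
  rcases pos_and_pos_or_neg_and_neg_of_mul_pos h23 with ⟨h2, h3⟩ | ⟨h2, h3⟩
  · have h1 : L1 < 0 := by
      by_contra h
      have := mul_nonneg y1.le (not_lt.1 h)
      have := mul_pos y2 h2
      have := mul_pos y3 h3
      linarith
    have := mul_pos_of_neg_of_neg hp1 h1
    by_cases hp2 : p2 < 0
    · exact c2 hp2 (hq_pos _ _ y2 hp2) (mul_neg_of_pos_of_neg h3 h1)
    by_cases hp3 : p3 < 0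
    · exact c3 hp3 (hq_pos _ _ y3 hp3) (mul_neg_of_neg_of_pos h1 h2)
    have := mul_nonneg (not_lt.1 hp2) h2.le
    have := mul_nonneg (not_lt.1 hp3) h3.le
    linarith
  · have h1 : 0 < L1 := by
      by_contra h
      have := mul_nonpos_of_nonneg_of_nonpos y1.le (not_lt.1 h)
      have := mul_neg_of_pos_of_neg y2 h2
      have := mul_neg_of_pos_of_neg y3 h3
      linarith
    have := mul_neg_of_neg_of_pos hp1 h1
    by_cases hp2 : p2 < 0
    · exact c2 hp2 (hq_pos _ _ y2 hp2) (mul_neg_of_neg_of_pos h3 h1)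
    by_cases hp3 : p3 < 0
    · exact c3 hp3 (hq_pos _ _ y3 hp3) (mul_neg_of_pos_of_neg h1 h2)
    have := mul_nonpos_of_nonneg_of_nonpos (not_lt.1 hp2) h2.le
    have := mul_nonpos_of_nonneg_of_nonpos (not_lt.1 hp3) h3.le
    linarith

/-- A segment, with an end outside the triangle `abc`, which meets the interior of the triangle,
crosses one of its sides. -/
lemma not_meets_of_outside (hg : GenPos X Y) {a b c p q : V} (hpq : p ≠ q)
    (hpb : p ≠ b) (hpc : p ≠ c) {t : ℝ} (ht0 : 0 < t) (ht1 : t < 1)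
    (y1 : 0 < (1 - t) * orient X Y b c p + t * orient X Y b c q)
    (y2 : 0 < (1 - t) * orient X Y c a p + t * orient X Y c a q)
    (y3 : 0 < (1 - t) * orient X Y a b p + t * orient X Y a b q)
    (hp1 : orient X Y b c p < 0) (nbc : ¬ Crosses X Y b c p q)
    (nca : orient X Y c a p < 0 → ¬ Crosses X Y c a p q)
    (nab : orient X Y a b p < 0 → ¬ Crosses X Y a b p q) : False := by
  refine exists_side_crossed ht0 ht1 y1 y2 y3 (orient_bary a b c p q) (orient_bary' a b c p q) hp1
    ?_ ?_ (fun h1 h2 h3 => nbc ⟨mul_neg_of_neg_of_pos h1 h2, h3⟩)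
    (fun h1 h2 h3 => nca h1 ⟨mul_neg_of_neg_of_pos h1 h2, h3⟩)
    (fun h1 h2 h3 => nab h1 ⟨mul_neg_of_neg_of_pos h1 h2, h3⟩)
  · intro h
    by_cases hqb : q = b
    · simp [hqb]
    · exact absurd h (hg _ _ _ hpq hqb hpb)
  · intro h
    by_cases hqc : q = c
    · simp [hqc]
    · exact absurd h (hg _ _ _ hpq hqc hpc)

/-- An edge does not meet the interior of a face. -/
lemma IsTriangulation.not_meets_face (hT : IsTriangulation X Y T) {a b c p q : V}
    (hf : IsFace X Y T a b c) (hpq : T.Adj p q) {t : ℝ} (ht0 : 0 < t) (ht1 : t < 1)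
    (y1 : 0 < (1 - t) * orient X Y b c p + t * orient X Y b c q)
    (y2 : 0 < (1 - t) * orient X Y c a p + t * orient X Y c a q)
    (y3 : 0 < (1 - t) * orient X Y a b p + t * orient X Y a b q) : False := by
  have main : ∀ p q : V, ∀ t : ℝ, T.Adj p q → 0 < t → t < 1 →
      0 < (1 - t) * orient X Y b c p + t * orient X Y b c q →
      0 < (1 - t) * orient X Y c a p + t * orient X Y c a q →
      0 < (1 - t) * orient X Y a b p + t * orient X Y a b q →
      p ≠ a → p ≠ b → p ≠ c → False := by
    intro p q t hpq ht0 ht1 y1 y2 y3 ha hb hc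
    have hg := hT.genPos
    have nc : ∀ u v, T.Adj u v → ¬ Crosses X Y u v p q := fun u v huv =>
      hT.noncrossing u v p q huv hpq
    by_cases h1 : orient X Y b c p < 0
    · exact not_meets_of_outside hg hpq.ne hb hc ht0 ht1 y1 y2 y3 h1 (nc _ _ hf.adj_bc)
        (fun _ => nc _ _ hf.adj_ca) (fun _ => nc _ _ hf.adj_ab)
    by_cases h2 : orient X Y c a p < 0
    · exact not_meets_of_outside hg hpq.ne hc ha ht0 ht1 y2 y3 y1 h2 (nc _ _ hf.adj_ca)
        (fun _ => nc _ _ hf.adj_ab) (fun _ => nc _ _ hf.adj_bc)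
    by_cases h3 : orient X Y a b p < 0
    · exact not_meets_of_outside hg hpq.ne ha hb ht0 ht1 y3 y1 y2 h3 (nc _ _ hf.adj_ab)
        (fun _ => nc _ _ hf.adj_bc) (fun _ => nc _ _ hf.adj_ca)
    refine hf.empty p ⟨?_, ?_, ?_⟩
    · exact lt_of_le_of_ne (not_lt.1 h1) (hg _ _ _ hf.adj_bc.ne hc.symm hb.symm).symm
    · exact lt_of_le_of_ne (not_lt.1 h2) (hg _ _ _ hf.adj_ca.ne ha.symm hc.symm).symm
    · exact lt_of_le_of_ne (not_lt.1 h3) (hg _ _ _ hf.adj_ab.ne hb.symm ha.symm).symm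
  by_cases hp : p = a ∨ p = b ∨ p = c
  · by_cases hq : q = a ∨ q = b ∨ q = c
    · have := hpq.ne
      rcases hp with rfl | rfl | rfl <;> rcases hq with rfl | rfl | rfl <;>
        simp_all
    · push Not at hq
      refine main q p (1 - t) hpq.symm (by linarith) (by linarith) ?_ ?_ ?_ hq.1 hq.2.1 hq.2.2 <;>
        linarith
  · push Not at hp
    exact main p q t hpq ht0 ht1 y1 y2 y3 hp.1 hp.2.1 hp.2.2

/-- No edge at a vertex of a face enters the face. -/
lemma IsTriangulation.not_adj_in_wedge (hT : IsTriangulation X Y T) {v a b e : V}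
    (hf : IsFace X Y T v a b) (he : T.Adj v e) (h1 : 0 < orient X Y v a e)
    (h2 : 0 < orient X Y v e b) : False := by
  have hpos := hf.pos
  have e0 : orient X Y a b v = orient X Y v a b := by simp only [orient]; ring
  have h2' : 0 < orient X Y b v e := by
    have : orient X Y b v e = orient X Y v e b := by simp only [orient]; ring
    linarith
  obtain ⟨t, ht0, ht1, ht⟩ : ∃ t : ℝ, 0 < t ∧ t < 1 ∧
      0 < (1 - t) * orient X Y a b v + t * orient X Y a b e := by
    rw [e0]
    set D := orient X Y v a b
    set E := orient X Y a b e
    refine ⟨D / (2 * (D + |E|)), by positivity, ?_, ?_⟩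
    · rw [div_lt_one (by positivity)]; have := abs_nonneg E; linarith
    · have hne : D + |E| ≠ 0 := by positivity
      have : (1 - D / (2 * (D + |E|))) * D + D / (2 * (D + |E|)) * E
          = D * (D + |E| + |E| + E) / (2 * (D + |E|)) := by field_simp; ring
      rw [this]
      have h3 := neg_abs_le E
      have h4 := abs_nonneg E
      exact div_pos (mul_pos hpos (by linarith)) (by positivity)
  refine hT.not_meets_face hf he ht0 ht1 ht ?_ ?_
  · simpa using mul_pos ht0 h2'
  · simpa using mul_pos ht0 h1

/-- The face to the left of a directed edge is unique. -/
lemma IsTriangulation.face_unique (hT : IsTriangulation X Y T) {a b c c' : V}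
    (hf : IsFace X Y T a b c) (hf' : IsFace X Y T a b c') : c = c' := by
  by_contra hne
  have hg := hT.genPos
  have n1 : orient X Y b c c' ≠ 0 := hg _ _ _ hf.adj_bc.ne hne hf'.adj_bc.ne
  have n2 : orient X Y c a c' ≠ 0 := hg _ _ _ hf.adj_ca.ne hf'.adj_ca.ne.symm hne
  have p := hf.pos
  have p' := hf'.pos
  have h1 : orient X Y b c c' < 0 := by
    by_contra h
    have h := lt_of_le_of_ne (not_lt.1 h) n1.symm
    refine hT.not_adj_in_wedge hf.rot hf'.adj_bc h ?_
    rw [orient_rot]; exact p'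
  have h2 : orient X Y c a c' < 0 := by
    by_contra h
    have h := lt_of_le_of_ne (not_lt.1 h) n2.symm
    refine hT.not_adj_in_wedge hf hf'.adj_ca.symm p' ?_
    rw [← orient_rot']; exact h
  refine hf'.empty c ⟨?_, ?_, p⟩
  · rw [orient_swap]; linarith
  · rw [orient_rev]; linarith

end Triangulation

section Visibility

variable {V : Type*} {X Y : V → ℝ} {T : SimpleGraph V}

/-- A vertex inside the wedge of two edges `va`, `vb` that is nearest to `v` in the direction
orthogonal to `ab` is visible from `v`. -/
lemma IsTriangulation.adj_of_nearest (hT : IsTriangulation X Y T) {v a b c : V} (ha : T.Adj v a)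
    (hb : T.Adj v b) (hc : Inside X Y v a b c)
    (hmax : ∀ d, Inside X Y v a b d → orient X Y a b d ≤ orient X Y a b c) : T.Adj v c := by
  have hg := hT.genPos
  obtain ⟨c1, c2, c3⟩ := hc
  have hsum := orient_sum (X := X) (Y := Y) v a b c
  have hvc : v ≠ c := by rintro rfl; simp at c2
  refine hT.maximal v c hvc fun p q hpq hcr => ?_
  obtain ⟨t, s, ht0, ht1, hs0, hs1, hy⟩ := hcr.exists_param
  have hne := hcr.ne
  have key : ∀ p q : V, ∀ s : ℝ, T.Adj p q → 0 < s → s < 1 → v ≠ p → v ≠ q →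
      (∀ r r' : V, (1 - t) * orient X Y r r' v + t * orient X Y r r' c
        = (1 - s) * orient X Y r r' p + s * orient X Y r r' q) →
      orient X Y a b c < orient X Y a b p → False := by
    intro p q s hpq hs0 hs1 hvp hvq hy hfp
    have hap : a ≠ p := by rintro rfl; simp at hfp; linarith
    have hbp : b ≠ p := by rintro rfl; simp at hfp; linarith
    have y1 : 0 < (1 - s) * orient X Y a b p + s * orient X Y a b q := by
      rw [← hy, ← orient_rot a b v, ← orient_rot b v a]
      have : orient X Y v a b = orient X Y a b c + orient X Y b v c + orient X Y v a c := by linarith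
      have h1 : 0 < orient X Y v a b := by linarith
      exact add_pos (mul_pos (by linarith) h1) (mul_pos ht0 c1)
    have y2 : 0 < (1 - s) * orient X Y b v p + s * orient X Y b v q := by
      rw [← hy]; simpa using mul_pos ht0 c2
    have y3 : 0 < (1 - s) * orient X Y v a p + s * orient X Y v a q := by
      rw [← hy]; simpa using mul_pos ht0 c3
    have nva := hT.noncrossing v a p q ha hpq
    have nbv := hT.noncrossing b v p q hb.symm hpq
    by_cases h2 : orient X Y b v p < 0
    · exact not_meets_of_outside hg hpq.ne hbp.symm hvp.symm hs0 hs1 y2 y3 y1 h2 nbv (fun _ => nva)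
        (fun h => by linarith)
    by_cases h3 : orient X Y v a p < 0
    · exact not_meets_of_outside hg hpq.ne hvp.symm hap.symm hs0 hs1 y3 y1 y2 h3 nva
        (fun h => by linarith) (fun _ => nbv)
    have := hmax p ⟨by linarith,
      lt_of_le_of_ne (not_lt.1 h2) (hg _ _ _ hb.symm.ne hvp hbp).symm,
      lt_of_le_of_ne (not_lt.1 h3) (hg _ _ _ ha.ne hap hvp).symm⟩
    linarith
  have hyf := hy a b
  have hfv : orient X Y a b v = orient X Y v a b := orient_rot _ _ _
  have hlt : orient X Y a b c < (1 - t) * orient X Y a b v + t * orient X Y a b c := by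
    have : 0 < (1 - t) * (orient X Y a b v - orient X Y a b c) :=
      mul_pos (by linarith) (by linarith)
    linarith
  by_cases hp : orient X Y a b c < orient X Y a b p
  · exact key p q s hpq hs0 hs1 hne.2.2.1 hne.2.2.2.1 hy hp
  by_cases hq : orient X Y a b c < orient X Y a b q
  · exact key q p (1 - s) hpq.symm (by linarith) (by linarith) hne.2.2.2.1 hne.2.2.1
      (fun r r' => by rw [hy r r']; ring) hq
  have h1 := mul_le_mul_of_nonneg_left (not_lt.1 hp) (by linarith : 0 ≤ 1 - s)
  have h2 := mul_le_mul_of_nonneg_left (not_lt.1 hq) hs0.le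
  linarith

/-- If the segment `pq` crosses `ab` and `p` lies on the side of `v`, outside the triangle
`vab`, then `pq` crosses `va` or `vb`. -/
lemma crosses_of_crosses_base (hg : GenPos X Y) {v a b p q : V} (hv : 0 < orient X Y v a b)
    (hcr : Crosses X Y a b p q) (hp : 0 < orient X Y a b p) (hpv : p ≠ v) (hqv : q ≠ v)
    (hin : ¬ Inside X Y v a b p) : Crosses X Y v a p q ∨ Crosses X Y b v p q := by
  have hne := hcr.ne
  obtain ⟨h1, h2⟩ := hcr
  have hq : orient X Y a b q < 0 := by
    by_contra h
    have := mul_nonneg hp.le (not_lt.1 h)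
    linarith
  have eP := orient_bary (X := X) (Y := Y) v a b p q
  have eQ := orient_bary' (X := X) (Y := Y) v a b p q
  have sQ := orient_sum (X := X) (Y := Y) v a b q
  have va : v ≠ a := by rintro rfl; simp at hv
  have vb : v ≠ b := by rintro rfl; simp at hv
  have nA : orient X Y b v p ≠ 0 := hg _ _ _ vb.symm hpv.symm hne.2.2.2.2.1
  have nB : orient X Y v a p ≠ 0 := hg _ _ _ va hne.2.2.1 hpv.symm
  have nL : orient X Y p q v ≠ 0 := hg _ _ _ hne.2.1 hqv hpv
  have hL : orient X Y a b p - orient X Y a b q = -(orient X Y p q a - orient X Y p q b) := by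
    simp only [orient]; ring
  have hAB : orient X Y b v p < 0 ∨ orient X Y v a p < 0 := by
    by_contra h
    push Not at h
    exact hin ⟨hp, lt_of_le_of_ne h.1 nA.symm, lt_of_le_of_ne h.2 nB.symm⟩
  simp only [Crosses]
  generalize orient X Y a b p = f at *
  generalize orient X Y a b q = f' at *
  generalize hA : orient X Y b v p = A at *
  generalize orient X Y b v q = A' at *
  generalize hB : orient X Y v a p = B at *
  generalize orient X Y v a q = B' at *
  generalize orient X Y p q v = L at *
  generalize orient X Y p q a = La at *
  generalize orient X Y p q b = Lb at *
  obtain ⟨ha, hb⟩ : La < 0 ∧ 0 < Lb := by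
    rcases mul_neg_iff.1 h2 with h | h
    · linarith
    · exact h
  rcases lt_or_gt_of_ne nL with hl | hl
  · right
    have e1 := mul_neg_of_pos_of_neg hp hl
    have e2 := mul_pos_of_neg_of_neg hq hl
    have hA : A < 0 := by
      by_contra h
      have hB := hAB.resolve_left h
      have := mul_nonpos_of_nonneg_of_nonpos (not_lt.1 h) ha.le
      have := mul_neg_of_neg_of_pos hB hb
      linarith
    have hA' : 0 < A' := by
      by_contra h
      have h3 := mul_nonneg_of_nonpos_of_nonpos (not_lt.1 h) ha.le
      have : B' < 0 := by
        by_contra h'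
        have := mul_nonneg (not_lt.1 h') hb.le
        linarith
      linarith
    exact ⟨mul_neg_of_neg_of_pos hA hA', mul_neg_of_pos_of_neg hb hl⟩
  · left
    have e1 := mul_pos hp hl
    have e2 := mul_neg_of_neg_of_pos hq hl
    have hB : B < 0 := by
      by_contra h
      have hA := hAB.resolve_right h
      have := mul_nonneg (not_lt.1 h) hb.le
      have := mul_pos_of_neg_of_neg hA ha
      linarith
    have hB' : 0 < B' := by
      by_contra h
      have h3 := mul_nonpos_of_nonpos_of_nonneg (not_lt.1 h) hb.le
      have : A' < 0 := by
        by_contra h'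
        have := mul_nonpos_of_nonneg_of_nonpos (not_lt.1 h') ha.le
        linarith
      linarith
    exact ⟨mul_neg_of_neg_of_pos hB hB', mul_neg_of_pos_of_neg hl ha⟩

/-- Two consecutive edges at `v` with an angle less than `π` span a face. -/
lemma IsTriangulation.isFace_of_consecutive [Finite V] (hT : IsTriangulation X Y T) {v a b : V}
    (ha : T.Adj v a) (hb : T.Adj v b) (hab : 0 < orient X Y v a b)
    (hw : ∀ e, T.Adj v e → 0 < orient X Y v a e → 0 < orient X Y v e b → False) :
    IsFace X Y T v a b := by
  have hg := hT.genPos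
  have hempty : ∀ d, ¬ Inside X Y v a b d := by
    intro d hd
    obtain ⟨c, hc, hmax⟩ := (Set.toFinite {d | Inside X Y v a b d}).exists_maximalFor
      (fun d => orient X Y a b d) _ ⟨d, hd⟩
    have hadj := hT.adj_of_nearest ha hb hc fun e he => by
      by_contra h
      exact h (hmax he (not_le.1 h).le)
    refine hw c hadj hc.2.2 ?_
    rw [← orient_rot']; exact hc.2.1
  have hne : a ≠ b := by rintro rfl; simp at hab
  refine ⟨ha, ?_, hb.symm, hab, hempty⟩
  refine hT.maximal a b hne fun p q hpq hcr => ?_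
  have main : ∀ p q, T.Adj p q → Crosses X Y a b p q → 0 < orient X Y a b p → False := by
    intro p q hpq hcr hp
    by_cases hpv : p = v
    · subst hpv
      have hL : orient X Y a b p - orient X Y a b q = -(orient X Y p q a - orient X Y p q b) := by
        simp only [orient]; ring
      obtain ⟨h1, h2⟩ := hcr
      have hq := neg_of_mul_neg_right h1 hp.le
      rcases mul_neg_iff.1 h2 with h | h
      · linarith
      · refine hw q hpq ?_ h.2
        rw [orient_swap]; linarith
    by_cases hqv : q = v
    · subst hqv
      have hq := neg_of_mul_neg_right hcr.1 hp.le
      have : orient X Y a b q = orient X Y q a b := by simp only [orient]; ring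
      linarith
    rcases crosses_of_crosses_base hg hab hcr hp hpv hqv (hempty p) with h | h
    · exact hT.noncrossing _ _ _ _ ha hpq h
    · exact hT.noncrossing _ _ _ _ hb.symm hpq h
  rcases mul_neg_iff.1 hcr.1 with h | h
  · exact main p q hpq hcr h.1
  · exact main q p hpq.symm hcr.swap_right h.2

/-- Among the points to the left (`σ = 1`) or to the right (`σ = -1`) of `vc` with a given property,
there is a first one in the angular order around `v`. -/
lemma exists_first [Finite V] {v c : V} (σ : ℝ) (p : V → Prop)
    (h : ∃ d, p d ∧ 0 < σ * orient X Y v c d) :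
    ∃ d, p d ∧ 0 < σ * orient X Y v c d ∧
      ∀ e, p e → 0 < σ * orient X Y v c e → ¬ 0 < σ * orient X Y v e d := by
  obtain ⟨d, hd⟩ := h
  obtain ⟨d, ⟨hd1, hd2⟩, hmax⟩ := (Set.toFinite {d | p d ∧ 0 < σ * orient X Y v c d}).exists_maximalFor
    (fun d => ((X c - X v) * (X d - X v) + (Y c - Y v) * (Y d - Y v)) / (σ * orient X Y v c d))
    _ ⟨d, hd⟩
  refine ⟨d, hd1, hd2, fun e he1 he2 hlt => ?_⟩
  have hc : 0 < (X c - X v) ^ 2 + (Y c - Y v) ^ 2 := by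
    by_contra hc
    have h1 : X c - X v = 0 := by nlinarith [sq_nonneg (X c - X v), sq_nonneg (Y c - Y v)]
    have h2 : Y c - Y v = 0 := by nlinarith [sq_nonneg (X c - X v), sq_nonneg (Y c - Y v)]
    simp [orient, h1, h2] at hd2
  have key : ((X c - X v) * (X d - X v) + (Y c - Y v) * (Y d - Y v)) / (σ * orient X Y v c d)
      < ((X c - X v) * (X e - X v) + (Y c - Y v) * (Y e - Y v)) / (σ * orient X Y v c e) := by
    rw [div_lt_div_iff₀ hd2 he2]
    have := mul_pos hc hlt
    simp only [orient] at this ⊢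
    linarith
  exact absurd (hmax (j := e) ⟨he1, he2⟩ key.le) (not_le.2 key)

/-- A directed edge with a further edge on its left at its tail has a face on its left. -/
lemma IsTriangulation.exists_face [Finite V] (hT : IsTriangulation X Y T) {v c d : V}
    (hc : T.Adj v c) (hd : T.Adj v d) (h : 0 < orient X Y v c d) :
    ∃ e, IsFace X Y T v c e ∧ (e = d ∨ 0 < orient X Y v e d) := by
  obtain ⟨e, he, h1, h2⟩ := exists_first (X := X) (Y := Y) (v := v) (c := c) 1 (T.Adj v)
    ⟨d, hd, by simpa using h⟩
  simp only [one_mul] at h1 h2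
  refine ⟨e, hT.isFace_of_consecutive hc he h1 fun x hx h3 h4 => h2 x hx h3 h4, ?_⟩
  by_contra hcon
  push Not at hcon
  refine h2 d hd h ?_
  rw [orient_swap]
  have := hT.genPos v e d he.ne hcon.1 hd.ne
  have := lt_of_le_of_ne hcon.2 this
  linarith

/-- A directed edge with a further edge on its right at its tail has a face on its right. -/
lemma IsTriangulation.exists_face_right [Finite V] (hT : IsTriangulation X Y T) {v c d : V}
    (hc : T.Adj v c) (hd : T.Adj v d) (h : orient X Y v c d < 0) :
    ∃ e, IsFace X Y T v e c ∧ (e = d ∨ 0 < orient X Y v d e) := by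
  obtain ⟨e, he, h1, h2⟩ := exists_first (X := X) (Y := Y) (v := v) (c := c) (-1) (T.Adj v)
    ⟨d, hd, by linarith⟩
  simp only [neg_mul, one_mul] at h1 h2
  have h1' : 0 < orient X Y v e c := by rw [orient_swap]; exact h1
  refine ⟨e, hT.isFace_of_consecutive he hc h1' fun x hx h3 h4 => h2 x hx ?_ ?_, ?_⟩
  · rw [← orient_swap]; exact h4
  · rw [← orient_swap]; exact h3
  by_contra hcon
  push Not at hcon
  refine h2 d hd (by linarith) ?_
  have := hT.genPos v d e hd.ne (Ne.symm hcon.1) he.ne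
  have := lt_of_le_of_ne hcon.2 this
  linarith

end Visibility

section Darts

variable {V : Type*} {X Y : V → ℝ} {T : SimpleGraph V}

variable (X Y T) in
/-- The directed edge `zc` has all other edges at `z` on its right. -/
def Bare (z c : V) : Prop := T.Adj z c ∧ ∀ d, T.Adj z d → d ≠ c → orient X Y z c d < 0

lemma Bare.unique {z c c' : V} (h : Bare X Y T z c) (h' : Bare X Y T z c') : c = c' := by
  by_contra hne
  have h1 := h.2 c' h'.1 (Ne.symm hne)
  have h2 := h'.2 c h.1 hne
  rw [orient_swap] at h2
  linarith

lemma IsTriangulation.exists_face_of_not_bare [Finite V] (hT : IsTriangulation X Y T) {z c : V}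
    (hc : T.Adj z c) (h : ¬ Bare X Y T z c) : ∃ e, IsFace X Y T z c e := by
  simp only [Bare, hc, true_and] at h
  push Not at h
  obtain ⟨d, hd, hne, h⟩ := h
  have h := lt_of_le_of_ne h (hT.genPos _ _ _ hc.ne hne.symm hd.ne).symm
  obtain ⟨e, he, -⟩ := hT.exists_face hc hd h
  exact ⟨e, he⟩

lemma IsFace.not_bare {a b c : V} (h : IsFace X Y T a b c) : ¬ Bare X Y T a b := fun hb => by
  have := hb.2 c h.adj_ca.symm h.adj_bc.ne.symm
  linarith [h.pos]

lemma Bare.orient_pos [Finite V] (hT : IsTriangulation X Y T) {z c e : V} (h : Bare X Y T z c)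
    (he : T.Adj c e) (hne : e ≠ z) : 0 < orient X Y c z e := by
  by_contra hcon
  have hlt := lt_of_le_of_ne (not_lt.1 hcon) (hT.genPos _ _ _ h.1.symm.ne hne.symm he.ne)
  obtain ⟨d, hd, -⟩ := hT.exists_face_right h.1.symm he hlt
  exact hd.rot.rot.not_bare h

/-- Among the points to the left of `vc` with a given property, there is a last one in the angular
order around `v`. -/
lemma exists_last [Finite V] {v c : V} (p : V → Prop) (h : ∃ d, p d ∧ 0 < orient X Y v c d) :
    ∃ d, p d ∧ 0 < orient X Y v c d ∧
      ∀ e, p e → 0 < orient X Y v c e → ¬ 0 < orient X Y v d e := by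
  obtain ⟨d, hd⟩ := h
  obtain ⟨d, ⟨hd1, hd2⟩, hmin⟩ := (Set.toFinite {d | p d ∧ 0 < orient X Y v c d}).exists_minimalFor
    (fun d => ((X c - X v) * (X d - X v) + (Y c - Y v) * (Y d - Y v)) / orient X Y v c d)
    _ ⟨d, hd⟩
  refine ⟨d, hd1, hd2, fun e he1 he2 hlt => ?_⟩
  have hc : 0 < (X c - X v) ^ 2 + (Y c - Y v) ^ 2 := by
    by_contra hc
    have h1 : X c - X v = 0 := by nlinarith [sq_nonneg (X c - X v), sq_nonneg (Y c - Y v)]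
    have h2 : Y c - Y v = 0 := by nlinarith [sq_nonneg (X c - X v), sq_nonneg (Y c - Y v)]
    simp [orient, h1, h2] at hd2
  have key : ((X c - X v) * (X e - X v) + (Y c - Y v) * (Y e - Y v)) / orient X Y v c e
      < ((X c - X v) * (X d - X v) + (Y c - Y v) * (Y d - Y v)) / orient X Y v c d := by
    rw [div_lt_div_iff₀ he2 hd2]
    have := mul_pos hc hlt
    simp only [orient] at this ⊢
    linarith
  exact absurd (hmin (j := e) ⟨he1, he2⟩ key.le) (not_le.2 key)

/-- The head of a bare directed edge is the tail of a bare directed edge. -/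
lemma Bare.exists_next [Finite V] (hT : IsTriangulation X Y T) {z c e : V} (h : Bare X Y T z c)
    (he : T.Adj c e) (hne : e ≠ z) : ∃ c', Bare X Y T c c' ∧ c' ≠ z := by
  obtain ⟨d, ⟨hd, hdz⟩, h1, h2⟩ := exists_last (X := X) (Y := Y) (v := c) (c := z)
    (fun d => T.Adj c d ∧ d ≠ z) ⟨e, ⟨he, hne⟩, h.orient_pos hT he hne⟩
  refine ⟨d, ⟨hd, fun x hx hxd => ?_⟩, hdz⟩
  by_cases hxz : x = z
  · subst hxz
    rw [orient_swap]; linarith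
  · exact lt_of_le_of_ne (not_lt.1 (h2 x ⟨hx, hxz⟩ (h.orient_pos hT hx hxz)))
      (hT.genPos _ _ _ hd.ne hxd.symm hx.ne)

lemma Bare.head_injective [Finite V] (hT : IsTriangulation X Y T) {z z' c : V}
    (h : Bare X Y T z c) (h' : Bare X Y T z' c) : z = z' := by
  by_contra hne
  have h1 := h.orient_pos hT h'.1.symm (Ne.symm hne)
  have h2 := h'.orient_pos hT h.1.symm hne
  rw [orient_swap] at h2
  linarith

variable (X Y T) in
/-- The edge `zx` has faces on both sides, and `z` lies inside the triangle spanned by `x` and the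
apexes of these faces. -/
def Blocked (z x : V) : Prop :=
  ∃ a b, IsFace X Y T z a x ∧ IsFace X Y T z x b ∧ 0 < orient X Y z b a

lemma Blocked.not_bare {z x c : V} (h : Blocked X Y T z x) : ¬ Bare X Y T z c := by
  obtain ⟨a, b, h1, h2, h3⟩ := h
  intro hc
  have dep := orient_dep (X := X) (Y := Y) z a x b c
  have key : ∀ e, T.Adj z e → e ≠ c → orient X Y z c e < 0 := hc.2
  have key' : ∀ e, T.Adj z e → orient X Y z c e ≤ 0 := fun e he => by
    by_cases hec : e = c
    · simp [hec]
    · exact (key e he hec).le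
  have p1 := mul_nonpos_of_nonneg_of_nonpos h2.pos.le (key' a h1.adj_ab)
  have p2 := mul_nonpos_of_nonneg_of_nonpos h3.le (key' x h2.adj_ab)
  have p3 := mul_nonpos_of_nonneg_of_nonpos h1.pos.le (key' b h2.adj_ca.symm)
  by_cases hac : a = c
  · have := mul_neg_of_pos_of_neg h3 (key x h2.adj_ab (hac ▸ h1.adj_bc.ne.symm))
    linarith
  · have := mul_neg_of_pos_of_neg h2.pos (key a h1.adj_ab hac)
    linarith

/-- All other edges at a blocked vertex lie between the two apexes. -/
lemma IsTriangulation.wedge_of_blocked (hT : IsTriangulation X Y T) {z x a b e : V}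
    (h1 : IsFace X Y T z a x) (h2 : IsFace X Y T z x b) (h3 : 0 < orient X Y z b a)
    (he : T.Adj z e) (hea : e ≠ a) (hex : e ≠ x) (heb : e ≠ b) :
    0 < orient X Y z b e ∧ 0 < orient X Y z e a := by
  have hg := hT.genPos
  have dep := orient_dep (X := X) (Y := Y) z a x b e
  have nb := hg z b e h2.adj_ca.symm.ne heb.symm he.ne
  have na := hg z e a he.ne hea h1.adj_ab.ne
  have nx := hg z e x he.ne hex h2.adj_ab.ne
  have w1 : 0 < orient X Y z e x → orient X Y z e a < 0 → False := fun p q =>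
    hT.not_adj_in_wedge h1 he (by rw [orient_swap]; linarith) p
  have w2 : orient X Y z e x < 0 → 0 < orient X Y z e b → False := fun p q =>
    hT.not_adj_in_wedge h2 he (by rw [orient_swap]; linarith) q
  have hbe : 0 < orient X Y z b e := by
    by_contra hcon
    have hlt := lt_of_le_of_ne (not_lt.1 hcon) nb
    rw [orient_swap] at hlt
    rcases lt_or_gt_of_ne nx with hx | hx
    · exact w2 hx (by linarith)
    · have e1 := mul_pos h3 hx
      have e2 := mul_pos h1.pos (show 0 < orient X Y z e b by linarith)
      refine w1 hx (neg_of_mul_neg_right (a := orient X Y z x b) (by linarith) h2.pos.le)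
  refine ⟨hbe, ?_⟩
  by_contra hcon
  have hlt := lt_of_le_of_ne (not_lt.1 hcon) na
  have hbe' : orient X Y z e b < 0 := by rw [orient_swap]; linarith
  rcases lt_or_gt_of_ne nx with hx | hx
  · have e1 := mul_neg_of_pos_of_neg h3 hx
    have e2 := mul_neg_of_pos_of_neg h1.pos hbe'
    have e3 := mul_neg_of_pos_of_neg h2.pos hlt
    linarith
  · exact w1 hx hlt

/-- Two edges blocked at the same vertex are consecutive. -/
lemma IsTriangulation.blocked_consecutive (hT : IsTriangulation X Y T) {z x a b x' : V}
    (h1 : IsFace X Y T z a x) (h2 : IsFace X Y T z x b) (h3 : 0 < orient X Y z b a)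
    (hx' : Blocked X Y T z x') (hne : x' ≠ x) : x' = a ∨ x' = b := by
  by_contra hcon
  push Not at hcon
  obtain ⟨a', b', h1', h2', h3'⟩ := hx'
  have hxa' : a' ≠ x := fun h => by
    subst h
    exact hcon.2 (hT.face_unique h1' h2)
  have hxb' : b' ≠ x := fun h => by
    subst h
    exact hcon.1 (hT.face_unique h2'.rot.rot h1.rot.rot)
  have key : ∀ e, T.Adj z e → e ≠ x → 0 ≤ orient X Y z b e := by
    intro e he hex
    by_cases hea : e = a
    · subst hea; exact h3.le
    by_cases heb : e = b
    · simp [heb]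
    exact (hT.wedge_of_blocked h1 h2 h3 he hea hex heb).1.le
  have dep := orient_dep (X := X) (Y := Y) z a' x' b' b
  have p1 := mul_nonneg h2'.pos.le (key a' h1'.adj_ab hxa')
  have p2 := mul_pos h3' (hT.wedge_of_blocked h1 h2 h3 h2'.adj_ab hcon.1 hne hcon.2).1
  have p3 := mul_nonneg h1'.pos.le (key b' h2'.adj_ca.symm hxb')
  linarith

/-- A vertex with three blocked edges has no other edges. -/
lemma IsTriangulation.eq_of_three_blocked (hT : IsTriangulation X Y T) {z x₁ x₂ x₃ e : V}
    (h₁ : Blocked X Y T z x₁) (h₂ : Blocked X Y T z x₂) (h₃ : Blocked X Y T z x₃)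
    (h12 : x₁ ≠ x₂) (h13 : x₁ ≠ x₃) (h23 : x₂ ≠ x₃) (he : T.Adj z e) :
    e = x₁ ∨ e = x₂ ∨ e = x₃ := by
  by_contra hcon
  push Not at hcon
  have main : ∀ x₂ x₃ : V, Blocked X Y T z x₂ → Blocked X Y T z x₃ → x₁ ≠ x₂ → x₁ ≠ x₃ → x₂ ≠ x₃ →
      e ≠ x₂ → e ≠ x₃ → (∃ f1 : IsFace X Y T z x₂ x₁, ∃ f2 : IsFace X Y T z x₁ x₃,
        0 < orient X Y z x₃ x₂) → False := by
    rintro x₂ x₃ h₂ h₃ h12 h13 h23 e2 e3 ⟨f1, f2, hpos⟩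
    obtain ⟨w1, w2⟩ := hT.wedge_of_blocked f1 f2 hpos he e2 hcon.1 e3
    obtain ⟨a', b', f1', f2', h3'⟩ := h₂
    have hb' : b' = x₁ := (hT.face_unique f1 f2').symm
    rcases hT.blocked_consecutive f1' f2' h3' h₃ h23.symm with h | h
    · rw [← h] at f1'
      exact hT.not_adj_in_wedge f1' he w1 w2
    · exact h13 (hb' ▸ h.symm)
  obtain ⟨a, b, f1, f2, hpos⟩ := h₁
  rcases hT.blocked_consecutive f1 f2 hpos h₂ h12.symm with r | r <;>
    rcases hT.blocked_consecutive f1 f2 hpos h₃ h13.symm with r' | r' <;> subst r <;> subst r'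
  · exact h23 rfl
  · exact main x₂ x₃ h₂ h₃ h12 h13 h23 hcon.2.1 hcon.2.2 ⟨f1, f2, hpos⟩
  · exact main x₃ x₂ h₃ h₂ h13 h12 h23.symm hcon.2.2 hcon.2.1 ⟨f1, f2, hpos⟩
  · exact h23 rfl

end Darts

section CommonPoint

variable {V : Type*} {X Y : V → ℝ} {T : SimpleGraph V}

/-- The coordinates of the common point of two crossing segments. -/
lemma Crosses.exists_coord {a b c d : V} (h : Crosses X Y a b c d) :
    ∃ t s : ℝ, 0 < t ∧ t < 1 ∧ 0 < s ∧ s < 1 ∧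
      (1 - t) * X a + t * X b = (1 - s) * X c + s * X d ∧
      (1 - t) * Y a + t * Y b = (1 - s) * Y c + s * Y d := by
  obtain ⟨t, s, ht0, ht1, hs0, hs1, hy⟩ := h.exists_param
  have h1 := hy a b
  have h2 := hy c d
  have hK : orient X Y a b d - orient X Y a b c ≠ 0 := by
    rcases mul_neg_iff.1 h.1 with h | h <;> intro h' <;> linarith [h.1, h.2]
  refine ⟨t, s, ht0, ht1, hs0, hs1, mul_left_cancel₀ hK ?_, mul_left_cancel₀ hK ?_⟩
  · simp only [orient] at h1 h2 ⊢
    linear_combination (X d - X c) * h1 - (X b - X a) * h2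
  · simp only [orient] at h1 h2 ⊢
    linear_combination (Y d - Y c) * h1 - (Y b - Y a) * h2

/-- Two segments that do not cross but have a common interior point coincide. -/
lemma GenPos.eq_of_common_point (hg : GenPos X Y) {p q r s : V} (hpq : p ≠ q) (hrs : r ≠ s)
    (hcr : ¬ Crosses X Y p q r s) {t u : ℝ} (ht0 : 0 < t) (ht1 : t < 1) (hu0 : 0 < u)
    (hu1 : u < 1) (hX : (1 - t) * X p + t * X q = (1 - u) * X r + u * X s)
    (hY : (1 - t) * Y p + t * Y q = (1 - u) * Y r + u * Y s) : s(p, q) = s(r, s) := by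
  have key : ∀ α β t : ℝ, 0 < t → t < 1 → (1 - t) * α + t * β = 0 → α ≠ 0 → α * β < 0 := by
    intro α β t h0 h1 h hα
    have h2 : 0 < (1 - t) * α ^ 2 := by have := sub_pos.2 h1; positivity
    have h3 : t * (α * β) = -((1 - t) * α ^ 2) := by linear_combination α * h
    by_contra hc
    have := mul_nonneg h0.le (not_lt.1 hc)
    linarith
  have e1 : (1 - t) * orient X Y r s p + t * orient X Y r s q = 0 := by
    simp only [orient]; linear_combination (X s - X r) * hY - (Y s - Y r) * hX
  have e2 : (1 - u) * orient X Y p q r + u * orient X Y p q s = 0 := by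
    simp only [orient]; linear_combination -(X q - X p) * hY + (Y q - Y p) * hX
  by_cases h1 : orient X Y r s p = 0
  · have hp : p = r ∨ p = s := by
      by_contra h
      push Not at h
      exact hg r s p hrs h.2.symm h.1.symm h1
    have h2 : orient X Y r s q = 0 := by
      rw [h1] at e1
      rcases mul_eq_zero.1 (show t * orient X Y r s q = 0 by linarith) with h | h
      · linarith
      · exact h
    have hq : q = r ∨ q = s := by
      by_contra h
      push Not at h
      exact hg r s q hrs h.2.symm h.1.symm h2
    have := hpq
    rcases hp with rfl | rfl <;> rcases hq with rfl | rfl <;> simp_all [Sym2.eq_swap]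
  by_cases h2 : orient X Y p q r = 0
  · have hr : r = p ∨ r = q := by
      by_contra h
      push Not at h
      exact hg p q r hpq h.2.symm h.1.symm h2
    have h3 : orient X Y p q s = 0 := by
      rw [h2] at e2
      rcases mul_eq_zero.1 (show u * orient X Y p q s = 0 by linarith) with h | h
      · linarith
      · exact h
    have hs : s = p ∨ s = q := by
      by_contra h
      push Not at h
      exact hg p q s hpq h.2.symm h.1.symm h3
    have := hrs
    rcases hr with rfl | rfl <;> rcases hs with rfl | rfl <;> simp_all
  · exact absurd ⟨key _ _ u hu0 hu1 e2 h2, key _ _ t ht0 ht1 e1 h1⟩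
      hcr

/-- Two edges with a common interior point coincide. -/
lemma IsTriangulation.eq_of_common_point (hT : IsTriangulation X Y T) {p q r s : V}
    (hpq : T.Adj p q) (hrs : T.Adj r s) {t u : ℝ} (ht0 : 0 < t) (ht1 : t < 1) (hu0 : 0 < u)
    (hu1 : u < 1) (hX : (1 - t) * X p + t * X q = (1 - u) * X r + u * X s)
    (hY : (1 - t) * Y p + t * Y q = (1 - u) * Y r + u * Y s) : s(p, q) = s(r, s) :=
  hT.genPos.eq_of_common_point hpq.ne hrs.ne (hT.noncrossing p q r s hpq hrs) ht0 ht1 hu0 hu1 hX hY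

/-- The diagonals of the quadrilateral formed by the two faces at an edge `zz'` cross, and no other
edge crosses the new diagonal, provided the quadrilateral is convex. -/
lemma IsTriangulation.flip (hT : IsTriangulation X Y T) {z z' a b : V}
    (hb : IsFace X Y T z z' b) (ha : IsFace X Y T z' z a) (h1 : 0 < orient X Y z a b)
    (h2 : 0 < orient X Y z' b a) : Crosses X Y a b z z' ∧
      ∀ p q, T.Adj p q → Crosses X Y a b p q → s(p, q) = s(z, z') := by
  have pa := ha.pos
  have pb := hb.pos
  have hcr : Crosses X Y a b z z' := by
    refine ⟨mul_neg_of_pos_of_neg ?_ ?_, mul_neg_of_neg_of_pos ?_ pb⟩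
    · rwa [orient_rot]
    · rw [orient_rot, orient_swap]; linarith
    · rw [orient_swap']; linarith
  refine ⟨hcr, fun p q hpq hpq' => ?_⟩
  obtain ⟨t, s, ht0, ht1, hs0, hs1, hX, hY⟩ := hpq'.exists_coord
  obtain ⟨t', s', ht0', ht1', hs0', hs1', hX', hY'⟩ := hcr.exists_coord
  have hy : ∀ r r', (1 - s) * orient X Y r r' p + s * orient X Y r r' q =
      (1 - t) * orient X Y r r' a + t * orient X Y r r' b := fun r r' => by
    simp only [orient]; linear_combination (Y r' - Y r) * hX - (X r' - X r) * hY
  have hd : (1 - t') * orient X Y z z' a + t' * orient X Y z z' b = 0 := by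
    simp only [orient]; linear_combination (X z' - X z) * hY' - (Y z' - Y z) * hX'
  have za : orient X Y z z' a = - orient X Y z' z a := by rw [orient_swap']
  rcases lt_trichotomy t t' with h | h | h
  · refine (hT.not_meets_face ha hpq hs0 hs1 ?_ ?_ ?_).elim
    · rw [hy]; simpa using mul_pos ht0 h1
    · rw [hy]; simp only [mul_zero, zero_add, orient_self_mid]
      refine mul_pos ht0 ?_
      rw [orient_rot, orient_rot]; exact h2
    · rw [hy, orient_swap' z z' a, orient_swap' z z' b]
      have e : (1 - t) * -orient X Y z z' a + t * -orient X Y z z' b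
        = (t' - t) * (orient X Y z z' b - orient X Y z z' a) := by linear_combination - hd
      rw [e]
      exact mul_pos (by linarith) (by linarith)
  · subst h
    have hne := hcr.ne
    have hzz : T.Adj z z' := hb.adj_ab
    exact hT.eq_of_common_point hpq hzz hs0 hs1 hs0' hs1' (by linarith) (by linarith)
  · refine (hT.not_meets_face hb hpq hs0 hs1 ?_ ?_ ?_).elim
    · rw [hy]; simpa using mul_pos (sub_pos.2 ht1) h2
    · rw [hy]; simp only [mul_zero, add_zero, orient_self_mid]
      refine mul_pos (sub_pos.2 ht1) ?_
      rw [orient_rot, orient_rot]; exact h1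
    · rw [hy]
      have e : (1 - t) * orient X Y z z' a + t * orient X Y z z' b
        = (t - t') * (orient X Y z z' b - orient X Y z z' a) := by linear_combination hd
      rw [e]
      exact mul_pos (by linarith) (by linarith)

/-- If `ab` crosses `zz'` and is not wider, then `a` or `b` lies in the vertical strip spanned
by `zz'`. -/
lemma Crosses.exists_between (hX : Function.Injective X) {a b z z' : V} (h : Crosses X Y a b z z')
    (hle : |X a - X b| ≤ |X z - X z'|) :
    (X z < X a ∧ X a < X z' ∨ X z' < X a ∧ X a < X z) ∨
    (X z < X b ∧ X b < X z' ∨ X z' < X b ∧ X b < X z) := by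
  have hne := h.ne
  obtain ⟨t, s, ht0, ht1, hs0, hs1, hXX, -⟩ := h.exists_coord
  have ne : ∀ {x y}, x ≠ y → X x ≠ X y := fun h h' => h (hX h')
  have key : ∀ a b z z' : V, ∀ t s : ℝ, 0 < t → t < 1 → 0 < s → s < 1 → a ≠ z → a ≠ z' → b ≠ z →
      b ≠ z' → X a < X b → X z < X z' → |X a - X b| ≤ |X z - X z'| →
      (1 - t) * X a + t * X b = (1 - s) * X z + s * X z' →
      (X z < X a ∧ X a < X z') ∨ (X z < X b ∧ X b < X z') := by
    intro a b z z' t s ht0 ht1 hs0 hs1 h1 h2 h3 h4 hab hzz hle hXX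
    rw [abs_of_neg (by linarith), abs_of_neg (by linarith)] at hle
    by_contra hcon
    push Not at hcon
    have n1 := ne h1
    have n2 := ne h2
    have n3 := ne h3
    have n4 := ne h4
    have b1 : 0 < t * (X b - X a) := mul_pos ht0 (by linarith)
    have b2 : 0 < (1 - t) * (X b - X a) := mul_pos (by linarith) (by linarith)
    have b3 : 0 < s * (X z' - X z) := mul_pos hs0 (by linarith)
    have b4 : 0 < (1 - s) * (X z' - X z) := mul_pos (by linarith) (by linarith)
    rcases lt_or_gt_of_ne n1 with h | h
    · rcases lt_or_gt_of_ne n3 with h' | h'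
      · linarith
      · have := lt_of_le_of_ne (hcon.2 h') n4.symm; linarith
    · have := lt_of_le_of_ne (hcon.1 h) n2.symm
      linarith
  obtain ⟨n1, n2, n3, n4, n5, n6⟩ := hne
  rcases lt_or_gt_of_ne (ne n1) with h1 | h1 <;> rcases lt_or_gt_of_ne (ne n2) with h2 | h2
  · have := key a b z z' t s ht0 ht1 hs0 hs1 n3 n4 n5 n6 h1 h2 hle hXX
    tauto
  · have := key a b z' z t (1 - s) ht0 ht1 (by linarith) (by linarith) n4 n3 n6 n5 h1 h2
      (by rwa [abs_sub_comm (X z')]) (by linarith)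
    tauto
  · have := key b a z z' (1 - t) s (by linarith) (by linarith) hs0 hs1 n5 n6 n3 n4 h1 h2
      (by rwa [abs_sub_comm (X b)]) (by linarith)
    tauto
  · have := key b a z' z (1 - t) (1 - s) (by linarith) (by linarith) (by linarith) (by linarith)
      n6 n5 n4 n3 h1 h2 (by rwa [abs_sub_comm (X b), abs_sub_comm (X z')]) (by linarith)
    tauto

/-- Every vertex other than the leftmost one has a neighbour to its left. -/
lemma IsTriangulation.exists_adj_left [Finite V] (hT : IsTriangulation X Y T)
    (hX : Function.Injective X) {v c : V} (hc : X c < X v) : ∃ d, T.Adj v d ∧ X d < X v := by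
  classical
  -- among the vertices on the left that see `v` below all edges passing over `v`, take the topmost
  obtain ⟨C, hCne, hCX, hC⟩ : ∃ C : Set V, C.Nonempty ∧ (∀ d ∈ C, X d < X v) ∧
      ∀ c ∈ C, (∀ d ∈ C, 0 ≤ orient X Y v c d) →
      ∀ r s : V, ∀ t u : ℝ, T.Adj r s → 0 < t → t < 1 → 0 < u → u < 1 → orient X Y v c r < 0 →
      (1 - t) * X v + t * X c = (1 - u) * X r + u * X s →
      (1 - t) * Y v + t * Y c = (1 - u) * Y r + u * Y s → False := by
    have pass : ∀ c : V, X c < X v → ∀ r s : V, ∀ t u : ℝ, 0 < t → t < 1 → 0 < u → u < 1 →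
      orient X Y v c r < 0 → (1 - t) * X v + t * X c = (1 - u) * X r + u * X s →
      (1 - t) * Y v + t * Y c = (1 - u) * Y r + u * Y s → X v < X r →
      X s < X v ∧ 0 < orient X Y v r s := by
      intro c hc r s t u ht0 ht1 hu0 hu1 hr h1 h2 hvr
      have a1 : t * (X c - X v) < 0 := mul_neg_of_pos_of_neg ht0 (by linarith)
      have a2 : 0 < (1 - u) * (X r - X v) := mul_pos (by linarith) (by linarith)
      have a3 : u * (X s - X v) < 0 := by linarith
      refine ⟨by have := neg_of_mul_neg_right a3 hu0.le; linarith, ?_⟩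
      have a4 : u * orient X Y v r s = - (t * orient X Y v c r) := by
        simp only [orient]; linear_combination (Y r - Y v) * h1 - (X r - X v) * h2
      have a5 := mul_neg_of_pos_of_neg ht0 hr
      exact pos_of_mul_pos_right (show 0 < u * _ by linarith) hu0.le
    by_cases hE : ∃ pq : V × V, T.Adj pq.1 pq.2 ∧ X v < X pq.1 ∧ X pq.2 < X v ∧
        0 < orient X Y v pq.1 pq.2
    · obtain ⟨⟨p, q⟩, ⟨hpq, hp, hq, hpos⟩, hmin⟩ := (Set.toFinite {pq : V × V | T.Adj pq.1 pq.2 ∧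
        X v < X pq.1 ∧ X pq.2 < X v ∧ 0 < orient X Y v pq.1 pq.2}).exists_minimalFor
        (fun pq => orient X Y v pq.1 pq.2 / (X pq.1 - X pq.2)) _ hE
      simp only at hpq hp hq hpos
      refine ⟨{d | X d < X v ∧ (d = q ∨ 0 < orient X Y p q d)}, ⟨q, hq, Or.inl rfl⟩,
        fun d hd => hd.1, ?_⟩
      rintro c ⟨hcv, hc⟩ htop r s t u hrs ht0 ht1 hu0 hu1 hr h1 h2
      have hc0 : 0 ≤ orient X Y p q c := by
        rcases hc with rfl | hc
        · simp
        · exact hc.le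
      have hv0 : orient X Y p q v = orient X Y v p q := orient_rot _ _ _
      have hy0 : 0 < (1 - u) * orient X Y p q r + u * orient X Y p q s := by
        have : (1 - u) * orient X Y p q r + u * orient X Y p q s
          = (1 - t) * orient X Y p q v + t * orient X Y p q c := by
          simp only [orient]; linear_combination (Y q - Y p) * h1 - (X q - X p) * h2
        rw [this]
        have := mul_pos (sub_pos.2 ht1) hpos
        have := mul_nonneg ht0.le hc0
        rw [hv0]; linarith
      have hcq : 0 ≤ orient X Y v c q := htop q ⟨hq, Or.inl rfl⟩
      have hcs : (1 - u) * orient X Y v c r + u * orient X Y v c s = 0 := by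
        simp only [orient]; linear_combination (Y c - Y v) * h1 - (X c - X v) * h2
      -- a point of `rs` above `vc`, left of `v`, above `pq`
      have fin : ∀ w : ℝ, 0 ≤ w → w < u → (1 - w) * X r + w * X s ≤ X v →
          (1 - w) * orient X Y p q r + w * orient X Y p q s ≤ 0 →
          (w = 0 → orient X Y p q r < 0) → False := by
        intro w hw0 hwu hwX hwo hw0'
        set f0 := orient X Y p q r
        set f1 := orient X Y p q s
        have hf : 0 < f1 - f0 := by
          have : 0 < (u - w) * (f1 - f0) := by linarith
          exact pos_of_mul_pos_right this (by linarith)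
        -- the parameter at which `rs` meets the line `pq`
        obtain ⟨x, hx⟩ : ∃ x, x = -f0 / (f1 - f0) := ⟨_, rfl⟩
        have hx0 : (1 - x) * f0 + x * f1 = 0 := by rw [hx]; field_simp; ring
        have hxu : x < u := by
          by_contra h
          have := mul_nonneg (sub_nonneg.2 (not_lt.1 h)) hf.le
          linarith
        have hwx : w ≤ x := by
          by_contra h
          have := mul_pos (sub_pos.2 (not_le.1 h)) hf
          linarith
        have hxpos : 0 < x := by
          rcases hw0.lt_or_eq with h | h
          · linarith
          · refine lt_of_le_of_ne (by linarith) fun hx' => ?_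
            have := hw0' h.symm
            rw [← hx'] at hx0
            linarith
        -- abscissa of that point
        have hXx : (1 - x) * X r + x * X s ≤ X v := by
          have hXu : (1 - u) * X r + u * X s < X v := by
            have := mul_neg_of_pos_of_neg ht0 (sub_neg.2 hcv)
            linarith
          rcases le_total (X r) (X s) with h | h
          · have := mul_nonneg (sub_nonneg.2 hxu.le) (sub_nonneg.2 h)
            linarith
          · have := mul_nonneg (sub_nonneg.2 hwx) (sub_nonneg.2 h)
            linarith
        have hAx : (1 - x) * orient X Y v c r + x * orient X Y v c s < 0 := by
          have : u * ((1 - x) * orient X Y v c r + x * orient X Y v c s)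
            = (u - x) * orient X Y v c r := by linear_combination x * hcs
          have h3 := mul_neg_of_pos_of_neg (sub_pos.2 hxu) hr
          rw [← this] at h3
          exact neg_of_mul_neg_right h3 hu0.le
        -- its parameter on `pq`
        have hqp : X q - X p < 0 := by linarith
        obtain ⟨y, hy⟩ : ∃ y, y = ((1 - x) * X r + x * X s - X p) / (X q - X p) := ⟨_, rfl⟩
        have hyX : (1 - y) * X p + y * X q = (1 - x) * X r + x * X s := by
          have : y * (X q - X p) = (1 - x) * X r + x * X s - X p := by
            rw [hy, div_mul_cancel₀ _ hqp.ne]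
          linear_combination this
        have hyY : (1 - y) * Y p + y * Y q = (1 - x) * Y r + x * Y s := by
          refine mul_left_cancel₀ hqp.ne ?_
          simp only [f0, f1, orient] at hx0
          linear_combination (Y q - Y p) * hyX - hx0
        have hy0 : 0 < y := by
          by_contra h
          have := mul_nonneg_of_nonpos_of_nonpos (not_lt.1 h) hqp.le
          linarith
        have hy1 : y < 1 := by
          by_contra h
          -- otherwise `q` separates the point from `p`, but both lie above `vc`
          have hyA : (1 - y) * orient X Y v c p + y * orient X Y v c q
            = (1 - x) * orient X Y v c r + x * orient X Y v c s := by
            simp only [orient]; linear_combination (X c - X v) * hyY - (Y c - Y v) * hyX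
          have hneg : orient X Y v c p < 0 := by
            have e : (X q - X v) * orient X Y v c p = (X p - X v) * orient X Y v c q
              - (X c - X v) * orient X Y v p q := by simp only [orient]; ring
            have e1 := mul_nonneg (sub_nonneg.2 hp.le) hcq
            have e2 := mul_neg_of_neg_of_pos (sub_neg.2 hcv) hpos
            by_contra hh
            have := mul_nonpos_of_nonpos_of_nonneg (sub_neg.2 hq).le (not_lt.1 hh)
            linarith
          have e1 := mul_nonneg_of_nonpos_of_nonpos (show 1 - y ≤ 0 by linarith) hneg.le
          have e2 := mul_nonneg hy0.le hcq
          linarith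
        have heq := hT.eq_of_common_point hpq hrs hy0 hy1 hxpos (by linarith) hyX hyY
        rw [Sym2.eq_iff] at heq
        rcases heq with ⟨rfl, rfl⟩ | ⟨rfl, rfl⟩ <;> simp [f0, f1] at hf
      rcases lt_trichotomy (X r) (X v) with hrv | hrv | hrv
      · have hrq : r ≠ q := by
          rintro rfl; linarith
        have hrp : r ≠ p := by rintro rfl; linarith
        have hro : orient X Y p q r < 0 := by
          by_contra h
          have := hT.genPos p q r hpq.ne hrq.symm hrp.symm
          have := htop r ⟨hrv, Or.inr (lt_of_le_of_ne (not_lt.1 h) this.symm)⟩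
          linarith
        exact fin 0 le_rfl hu0 (by linarith) (by linarith) fun _ => hro
      · rw [hX hrv] at hr; simp at hr
      · obtain ⟨hs, hrs'⟩ := pass c hcv r s t u ht0 ht1 hu0 hu1 hr h1 h2 hrv
        have hmin' : orient X Y v p q / (X p - X q) ≤ orient X Y v r s / (X r - X s) := by
          by_contra h
          exact h (hmin (j := (r, s)) ⟨hrs, hrv, hs, hrs'⟩ (not_le.1 h).le)
        rw [div_le_div_iff₀ (by linarith) (by linarith)] at hmin'
        have hden : 0 < X r - X s := by linarith
        obtain ⟨w, hw⟩ : ∃ w, w = (X r - X v) / (X r - X s) := ⟨_, rfl⟩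
        have hw0 : 0 < w := by rw [hw]; exact div_pos (by linarith) hden
        have hwX : (1 - w) * X r + w * X s = X v := by rw [hw]; field_simp; ring
        refine fin w hw0.le ?_ hwX.le ?_ (fun h => by linarith)
        · by_contra h
          have := mul_nonneg (sub_nonneg.2 (not_lt.1 h)) hden.le
          have := mul_neg_of_pos_of_neg ht0 (sub_neg.2 hcv)
          linarith
        · have e : (X r - X s) * ((1 - w) * orient X Y p q r + w * orient X Y p q s)
              = orient X Y v p q * (X r - X s) - orient X Y v r s * (X p - X q) := by
            have hw' : w * (X r - X s) = X r - X v := by rw [hw]; field_simp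
            simp only [orient]
            linear_combination ((X q - X p) * (Y s - Y r) - (Y q - Y p) * (X s - X r)) * hw'
          by_contra h
          have := mul_pos hden (not_le.1 h)
          linarith
    · push Not at hE
      refine ⟨{d | X d < X v}, ⟨c, hc⟩, fun d hd => hd, ?_⟩
      rintro c hcv htop r s t u hrs ht0 ht1 hu0 hu1 hr h1 h2
      rcases lt_trichotomy (X r) (X v) with hrv | hrv | hrv
      · have := htop r hrv; linarith
      · rw [hX hrv] at hr; simp at hr
      · obtain ⟨hs, hrs'⟩ := pass c hcv r s t u ht0 ht1 hu0 hu1 hr h1 h2 hrv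
        have := hE (r, s) hrs hrv hs
        linarith
  obtain ⟨d, hd, hmin⟩ := (Set.toFinite C).exists_minimalFor
    (fun d => (Y d - Y v) / (X d - X v)) _ hCne
  have hdv := hCX d hd
  have htop : ∀ e ∈ C, 0 ≤ orient X Y v d e := by
    intro e he
    have hev := hCX e he
    have h : (Y d - Y v) / (X d - X v) ≤ (Y e - Y v) / (X e - X v) := by
      by_contra h
      exact h (hmin he (not_le.1 h).le)
    rw [← sub_nonneg, div_sub_div _ _ (by linarith) (by linarith)] at h
    have h3 := mul_pos_of_neg_of_neg (sub_neg.2 hev) (sub_neg.2 hdv)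
    have h2 := mul_nonneg h h3.le
    rw [div_mul_cancel₀ _ h3.ne'] at h2
    simp only [orient]
    linarith
  refine ⟨d, hT.maximal v d (by rintro rfl; linarith) fun r s hrs hcr => ?_, hdv⟩
  rcases mul_neg_iff.1 hcr.1 with h | h
  · obtain ⟨t, u, ht0, ht1, hu0, hu1, h1, h2⟩ := hcr.swap_right.exists_coord
    exact hC d hd htop s r t u hrs.symm ht0 ht1 hu0 hu1 h.2 h1 h2
  · obtain ⟨t, u, ht0, ht1, hu0, hu1, h1, h2⟩ := hcr.exists_coord
    exact hC d hd htop r s t u hrs ht0 ht1 hu0 hu1 h.1 h1 h2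

end CommonPoint

section Existence

variable {V : Type*} {X Y : V → ℝ}

lemma noncrossing_insert [DecidableEq V] {E : Finset (Sym2 V)}
    (hE : ∀ a b c d, s(a, b) ∈ E → s(c, d) ∈ E → ¬ Crosses X Y a b c d) {a b : V}
    (hab : ∀ c d, s(c, d) ∈ E → ¬ Crosses X Y a b c d) (c d c' d' : V)
    (h : s(c, d) ∈ insert s(a, b) E) (h' : s(c', d') ∈ insert s(a, b) E) :
    ¬ Crosses X Y c d c' d' := by
  have key : ∀ c d c' d', s(c, d) = s(a, b) → s(c', d') ∈ insert s(a, b) E →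
      ¬ Crosses X Y c d c' d' := by
    intro p q r s hpq hrs hcr
    have hne := hcr.ne
    rcases Finset.mem_insert.1 hrs with hrs' | hrs'
    · rw [← hpq, Sym2.eq_iff] at hrs'
      rcases hrs' with ⟨rfl, rfl⟩ | ⟨rfl, rfl⟩ <;> simp at hne
    · rcases Sym2.eq_iff.1 hpq with ⟨rfl, rfl⟩ | ⟨rfl, rfl⟩
      · exact hab _ _ hrs' hcr
      · exact hab _ _ hrs' hcr.swap_left
  rcases Finset.mem_insert.1 h with h1 | h1
  · exact key _ _ _ _ h1 h'
  rcases Finset.mem_insert.1 h' with h2 | h2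
  · exact fun hcr => key _ _ _ _ h2 h hcr.symm
  · exact hE _ _ _ _ h1 h2

/-- A noncrossing graph extends to a maximal one of maximum weight; then flipping an edge does not
increase the weight. -/
lemma exists_max_triangulation [Finite V] (hg : GenPos X Y) {G : SimpleGraph V}
    (hG : ∀ a b c d, G.Adj a b → G.Adj c d → ¬ Crosses X Y a b c d) (w : Sym2 V → ℝ)
    (hw : ∀ e, 0 < w e) : ∃ T : SimpleGraph V, G ≤ T ∧ IsTriangulation X Y T ∧
      ∀ z z' a b, T.Adj z z' → ¬ G.Adj z z' → Crosses X Y a b z z' →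
        (∀ p q, T.Adj p q → Crosses X Y a b p q → s(p, q) = s(z, z')) →
        w s(a, b) ≤ w s(z, z') := by
  classical
  have := Fintype.ofFinite V
  obtain ⟨E, ⟨hGE, hE⟩, hmax⟩ := (Set.toFinite {E : Finset (Sym2 V) | (∀ e ∈ G.edgeSet, e ∈ E) ∧
    ∀ a b c d, s(a, b) ∈ E → s(c, d) ∈ E → ¬ Crosses X Y a b c d}).exists_maximalFor
    (fun E => ∑ e ∈ E, w e) _ ⟨Finset.univ.filter (· ∈ G.edgeSet), by simp, fun a b c d h h' => by
      simp only [Finset.mem_filter, Finset.mem_univ, true_and, SimpleGraph.mem_edgeSet] at h h'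
      exact hG a b c d h h'⟩
  have hmax' : ∀ F : Finset (Sym2 V), (∀ e ∈ G.edgeSet, e ∈ F) →
      (∀ a b c d, s(a, b) ∈ F → s(c, d) ∈ F → ¬ Crosses X Y a b c d) →
      ∑ e ∈ F, w e ≤ ∑ e ∈ E, w e := by
    intro F h1 h2
    by_contra h
    exact h (hmax ⟨h1, h2⟩ (not_le.1 h).le)
  have hadj : ∀ {a b}, (SimpleGraph.fromEdgeSet (E : Set (Sym2 V))).Adj a b ↔ s(a, b) ∈ E ∧ a ≠ b :=
    by simp
  refine ⟨SimpleGraph.fromEdgeSet (E : Set (Sym2 V)), fun a b h => hadj.2 ⟨hGE _ h, h.ne⟩,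
    ⟨hg, fun a b c d h h' => hE a b c d (hadj.1 h).1 (hadj.1 h').1, ?_⟩, ?_⟩
  · intro a b hne hcr
    by_contra hab
    have hab : s(a, b) ∉ E := fun h => hab (hadj.2 ⟨h, hne⟩)
    have h := hmax' (insert s(a, b) E) (fun e he => Finset.mem_insert_of_mem (hGE e he))
      (noncrossing_insert hE fun c d h h' => hcr c d (hadj.2 ⟨h, h'.ne.2.1⟩) h')
    rw [Finset.sum_insert hab] at h
    linarith [hw s(a, b)]
  · intro z z' a b hzz hG' hcr honly
    have hzE := (hadj.1 hzz).1
    have hab : s(a, b) ∉ E := fun h => hE _ _ _ _ h hzE hcr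
    have h := hmax' (insert s(a, b) (E.erase s(z, z')))
      (fun e he => Finset.mem_insert_of_mem (Finset.mem_erase.2 ⟨fun h => hG' (by
        rw [h] at he; exact he), hGE e he⟩))
      (noncrossing_insert (fun p q r s h h' => hE p q r s (Finset.mem_of_mem_erase h)
        (Finset.mem_of_mem_erase h')) fun c d h h' => by
        rw [Finset.mem_erase] at h
        exact h.1 (honly c d (hadj.2 ⟨h.2, h'.ne.2.1⟩) h'))
    rw [Finset.sum_insert (fun h => hab (Finset.mem_of_mem_erase h))] at h
    have := Finset.sum_erase_add E w hzE
    linarith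

variable (X Y) in
/-- A polygon `P`, given by the coordinates of its vertices, with a maximal compatible
matching `M`. -/
structure PolygonMatching (P M : SimpleGraph V) : Prop where
  injective : Function.Injective X
  genPos : GenPos X Y
  noncrossing : ∀ a b c d, (P ⊔ M).Adj a b → (P ⊔ M).Adj c d → ¬ Crosses X Y a b c d
  matching : ∀ u v w, M.Adj u v → M.Adj u w → v = w
  disjoint : ∀ a b, P.Adj a b → ¬ M.Adj a b
  two_neighbors : ∀ v, ∃ a b, a ≠ b ∧ ∀ c, P.Adj v c ↔ c = a ∨ c = b
  connected : ∀ S : Set V, S.Nonempty → (∀ v ∈ S, ∀ w, P.Adj v w → w ∈ S) → S = Set.univ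
  triangle_free : ∀ u a b, P.Adj u a → P.Adj u b → ¬ P.Adj a b
  maximal : ∀ u v, u ≠ v → (∀ w, ¬ M.Adj u w) → (∀ w, ¬ M.Adj v w) → ¬ P.Adj u v →
    ∃ c d, (P ⊔ M).Adj c d ∧ Crosses X Y u v c d

/-- The vertices covered by the matching. -/
def Matched (M : SimpleGraph V) (v : V) : Prop := ∃ w, M.Adj v w

variable {P M T : SimpleGraph V}

variable (X Y) in
/-- A triangulation `T` of the vertices of `P` that contains `P` and `M` and is optimal with respect
to flips of edges between matched vertices. -/
structure OptTriangulation (P M T : SimpleGraph V) : Prop extends IsTriangulation X Y T where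
  le : P ⊔ M ≤ T
  flip_opt : ∀ z z' a b, Matched M z → Matched M z' → T.Adj z z' → ¬ P.Adj z z' → ¬ M.Adj z z' →
    Crosses X Y a b z z' → (∀ p q, T.Adj p q → Crosses X Y a b p q → s(p, q) = s(z, z')) →
    Matched M a ∧ Matched M b ∧ |X a - X b| ≤ |X z - X z'|

lemma PolygonMatching.exists_optTriangulation [Finite V] (h : PolygonMatching X Y P M) :
    ∃ T, OptTriangulation X Y P M T := by
  classical
  have := Fintype.ofFinite V
  obtain ⟨B, hB0, hB⟩ : ∃ B : ℝ, 0 < B ∧ ∀ a b, |X a - X b| / B < 1 := by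
    refine ⟨1 + ∑ a, ∑ b, |X a - X b|, by positivity, fun a b => ?_⟩
    rw [div_lt_one (by positivity)]
    have h1 : |X a - X b| ≤ ∑ b, |X a - X b| :=
      Finset.single_le_sum (f := fun b => |X a - X b|) (fun _ _ => abs_nonneg _) (Finset.mem_univ b)
    have h2 : ∑ b, |X a - X b| ≤ ∑ a, ∑ b, |X a - X b| :=
      Finset.single_le_sum (f := fun a => ∑ b, |X a - X b|)
        (fun _ _ => Finset.sum_nonneg fun _ _ => abs_nonneg _) (Finset.mem_univ a)
    linarith
  obtain ⟨w, hw⟩ : ∃ w : Sym2 V → ℝ, ∀ a b, w s(a, b) =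
      2 - (if Matched M a ∧ Matched M b then 1 else 0) + |X a - X b| / B :=
    ⟨Sym2.lift ⟨fun a b => 2 - (if Matched M a ∧ Matched M b then 1 else 0) + |X a - X b| / B,
      fun a b => by simp only [abs_sub_comm (X a), and_comm]⟩, fun a b => rfl⟩
  have hdiv : ∀ a b, 0 ≤ |X a - X b| / B := fun a b => div_nonneg (abs_nonneg _) hB0.le
  obtain ⟨T, hle, hT, hflip⟩ := exists_max_triangulation h.genPos h.noncrossing w (fun e => by
    induction e using Sym2.ind with
    | _ a b =>
      rw [hw]
      have := hdiv a b
      split_ifs <;> linarith)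
  refine ⟨T, hT, hle, fun z z' a b hz hz' hzz hP hM hcr honly => ?_⟩
  have key := hflip z z' a b hzz (by simp [hP, hM]) hcr honly
  rw [hw a b, hw z z', if_pos (show Matched M z ∧ Matched M z' from ⟨hz, hz'⟩)] at key
  have h1 := hB z z'
  have h2 := hdiv a b
  split_ifs at key with hab
  · refine ⟨hab.1, hab.2, ?_⟩
    exact (div_le_div_iff_of_pos_right hB0).1 (by linarith)
  · linarith

lemma OptTriangulation.adj_of_unmatched (hP : PolygonMatching X Y P M)
    (hT : OptTriangulation X Y P M T) {u v : V} (h : T.Adj u v) (hu : ¬ Matched M u)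
    (hv : ¬ Matched M v) : P.Adj u v := by
  by_contra hadj
  obtain ⟨c, d, hcd, hcr⟩ := hP.maximal u v h.ne (not_exists.1 hu) (not_exists.1 hv) hadj
  exact hT.noncrossing _ _ _ _ h (hT.le hcd) hcr

/-- An unmatched vertex with unmatched polygon neighbours is the head of a blocked edge. -/
lemma OptTriangulation.exists_blocked [Finite V] (hP : PolygonMatching X Y P M)
    (hT : OptTriangulation X Y P M T) {u : V} (hu : ¬ Matched M u)
    (hN : ∀ a, P.Adj u a → ¬ Matched M a) : ∃ z, Matched M z ∧ Blocked X Y T z u := by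
  have hg := hP.genPos
  obtain ⟨a, b, hab, ha, hb, hNu, hpos⟩ : ∃ a b, a ≠ b ∧ P.Adj u a ∧ P.Adj u b ∧
      (∀ c, P.Adj u c → c = a ∨ c = b) ∧ 0 < orient X Y u a b := by
    obtain ⟨a, b, hab, h⟩ := hP.two_neighbors u
    have ha := (h a).2 (Or.inl rfl)
    have hb := (h b).2 (Or.inr rfl)
    rcases lt_or_gt_of_ne (hg u a b ha.ne hab hb.ne) with h' | h'
    · exact ⟨b, a, hab.symm, hb, ha, fun c hc => ((h c).1 hc).symm, by rw [orient_swap]; linarith⟩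
    · exact ⟨a, b, hab, ha, hb, fun c hc => (h c).1 hc, h'⟩
  have hTa : T.Adj u a := hT.le (Or.inl ha)
  have hTb : T.Adj u b := hT.le (Or.inl hb)
  have hNPM : ∀ c, (P ⊔ M).Adj u c → c = a ∨ c = b := fun c hc => by
    rcases hc with hc | hc
    · exact hNu c hc
    · exact absurd ⟨c, hc⟩ hu
  by_cases hin : ∃ d, Inside X Y u a b d
  · obtain ⟨z, hz, hmax⟩ := (Set.toFinite {d | Inside X Y u a b d}).exists_maximalFor
      (fun d => orient X Y a b d) _ hin
    have hmax : ∀ e, Inside X Y u a b e → orient X Y a b e ≤ orient X Y a b z := fun e he => by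
      by_contra h
      exact h (hmax he (not_le.1 h).le)
    have hz1 : 0 < orient X Y a b z := hz.1
    have hz2 : 0 < orient X Y b u z := hz.2.1
    have hz3 : 0 < orient X Y u a z := hz.2.2
    have hadj := hT.adj_of_nearest hTa hTb hz hmax
    have hzW : Matched M z := by
      by_contra hzU
      rcases hNu z (hT.adj_of_unmatched hP hadj hu hzU) with rfl | rfl
      · simp at hz1
      · simp at hz1
    refine ⟨z, hzW, ?_⟩
    have hsum := orient_sum (X := X) (Y := Y) u a b z
    have hle : ∀ e, T.Adj u e → (e = a ∨ 0 < orient X Y u a e) → (e = b ∨ 0 < orient X Y u e b) →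
        orient X Y a b e ≤ orient X Y a b z := by
      intro e he h1 h2
      rcases h1 with rfl | h1
      · simpa using hz1.le
      rcases h2 with rfl | h2
      · simpa using hz1.le
      by_cases h3 : 0 < orient X Y a b e
      · exact hmax e ⟨h3, by rwa [← orient_rot' u e b] at h2, h1⟩
      · linarith
    have huz : orient X Y a b z < orient X Y a b u := by
      rw [orient_rot u a b]; linarith
    have hzb : 0 < orient X Y u z b := by rwa [← orient_rot' u z b]
    obtain ⟨q, hq, hq'⟩ := hT.exists_face hadj hTb hzb
    obtain ⟨p, hp, hp'⟩ := hT.exists_face_right hadj hTa (by rw [orient_swap]; linarith)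
    have hp' : p = a ∨ 0 < orient X Y u a p := hp'
    have hqa : 0 < orient X Y u a q := by
      -- `q` follows `z`, which follows `a`, and precedes `b`
      rcases hq' with rfl | hq'
      · exact hpos
      · have dep := orient_dep (X := X) (Y := Y) u a z b q
        have e1 : 0 < orient X Y u z q := hq.pos
        rw [orient_swap u q z] at e1
        have e2 : orient X Y u b a < 0 := by rw [orient_swap]; linarith
        have := mul_pos_of_neg_of_neg e2 (show orient X Y u q z < 0 by linarith)
        have h3 := mul_pos hz3 hq'
        have : orient X Y u q a < 0 :=
          neg_of_mul_neg_right (a := orient X Y u z b) (by linarith) hzb.le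
        rw [orient_swap]; linarith
    have hpb : 0 < orient X Y u p b := by
      rcases hp' with rfl | hp'
      · exact hpos
      · have dep := orient_dep (X := X) (Y := Y) u a z b p
        have e1 : 0 < orient X Y u p z := hp.pos
        have e2 : orient X Y u b a < 0 := by rw [orient_swap]; linarith
        have e3 := mul_neg_of_neg_of_pos e2 e1
        have e4 : orient X Y u p a < 0 := by rw [orient_swap]; linarith
        have e5 := mul_neg_of_pos_of_neg hzb e4
        exact pos_of_mul_pos_right (a := orient X Y u a z) (by linarith) hz3.le
    have hgq := hle q hq.adj_ca.symm (Or.inr hqa) hq'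
    have hgp := hle p hp.adj_ab hp' (Or.inr hpb)
    have e1 : 0 < orient X Y u z q := hq.pos
    have e2 : 0 < orient X Y u p z := hp.pos
    have hqp : q ≠ p := by
      rintro rfl; rw [orient_swap] at e1; linarith
    have hzp : z ≠ p := hp.adj_bc.ne.symm
    have hzq : z ≠ q := hq.adj_bc.ne
    have hnot : 0 < orient X Y z p q := by
      have hne : orient X Y z p q ≠ 0 := hg z p q hzp hqp.symm hzq
      by_contra hcon
      have hneg := lt_of_le_of_ne (not_lt.1 hcon) hne
      have id : orient X Y u z q * orient X Y a b p + orient X Y u p z * orient X Y a b q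
        + orient X Y z p q * orient X Y a b u
        = orient X Y a b z * (orient X Y u z q + orient X Y u p z + orient X Y z p q) := by
        simp only [orient]; ring
      have i1 := mul_nonneg e1.le (sub_nonneg.2 hgp)
      have i2 := mul_nonneg e2.le (sub_nonneg.2 hgq)
      have i3 := mul_neg_of_neg_of_pos hneg (sub_pos.2 huz)
      linarith
    exact ⟨q, p, hq.rot, hp.rot.rot, hnot⟩
  · exfalso
    obtain ⟨c, d, hcd, hcr⟩ := hP.maximal a b hab (not_exists.1 (hN a ha)) (not_exists.1 (hN b hb))
      (hP.triangle_free u a b ha hb)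
    have main : ∀ c d, (P ⊔ M).Adj c d → Crosses X Y a b c d → 0 < orient X Y a b c → False := by
      intro c d hcd hcr hc
      have hne := hcr.ne
      have hcu : c ≠ u := by
        rintro rfl
        rcases hNPM d hcd with rfl | rfl
        · exact hne.2.2.2.1 rfl
        · exact hne.2.2.2.2.2 rfl
      have hdu : d ≠ u := by
        rintro rfl
        rcases hNPM c hcd.symm with rfl | rfl
        · exact hne.2.2.1 rfl
        · exact hne.2.2.2.2.1 rfl
      rcases crosses_of_crosses_base hg hpos hcr hc hcu hdu (fun h => hin ⟨c, h⟩) with h | h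
      · exact hP.noncrossing _ _ _ _ (Or.inl ha) hcd h
      · exact hP.noncrossing _ _ _ _ (Or.inl hb.symm) hcd h
    rcases mul_neg_iff.1 hcr.1 with h | h
    · exact main c d hcd hcr h.1
    · exact main d c hcd.symm hcr.swap_right h.2

end Existence

section Middle

variable {V : Type*} {X Y : V → ℝ} {T : SimpleGraph V}

lemma orient_neg : orient (fun v => -X v) (fun v => -Y v) = orient X Y := by
  funext a b c
  simp only [orient]; ring

lemma IsTriangulation.neg (hT : IsTriangulation X Y T) :
    IsTriangulation (fun v => -X v) (fun v => -Y v) T := by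
  obtain ⟨h1, h2, h3⟩ := hT
  refine ⟨?_, ?_, ?_⟩ <;> simp only [GenPos, Crosses, orient_neg] at * <;> assumption

lemma isFace_neg {a b c : V} :
    IsFace (fun v => -X v) (fun v => -Y v) T a b c ↔ IsFace X Y T a b c := by
  constructor <;> rintro ⟨h1, h2, h3, h4, h5⟩ <;> refine ⟨h1, h2, h3, ?_, ?_⟩ <;>
    simp only [Inside, orient_neg] at * <;> assumption

lemma bare_neg {a b : V} : Bare (fun v => -X v) (fun v => -Y v) T a b ↔ Bare X Y T a b := by
  simp only [Bare, orient_neg]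

/-- The steepest edge going to the right from `v` has a face on its left, unless it is bare. -/
lemma IsTriangulation.right_cases [Finite V] (hT : IsTriangulation X Y T)
    (hX : Function.Injective X) (v : V) :
    (∃ b c, IsFace X Y T v b c ∧ X v < X b ∧ X c < X v) ∨ (∃ r, Bare X Y T v r ∧ X v < X r) ∨
      ∀ d, X d ≤ X v := by
  by_cases hmax : ∀ d, X d ≤ X v
  · exact Or.inr (Or.inr hmax)
  push Not at hmax
  obtain ⟨c, hc⟩ := hmax
  obtain ⟨d, hd⟩ := hT.neg.exists_adj_left (fun a b h => hX (neg_injective h)) (v := v) (c := c)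
    (by simpa using hc)
  simp only [neg_lt_neg_iff] at hd
  obtain ⟨r, ⟨hr, hvr⟩, hmax⟩ := (Set.toFinite {d | T.Adj v d ∧ X v < X d}).exists_maximalFor
    (fun d => (Y d - Y v) / (X d - X v)) _ ⟨d, hd⟩
  by_cases hb : Bare X Y T v r
  · exact Or.inr (Or.inl ⟨r, hb, hvr⟩)
  obtain ⟨e, he⟩ := hT.exists_face_of_not_bare hr hb
  refine Or.inl ⟨r, e, he, hvr, ?_⟩
  by_contra hcon
  have hev : X v < X e := lt_of_le_of_ne (not_lt.1 hcon) fun h => he.adj_ca.ne (hX h).symm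
  have hle : (Y e - Y v) / (X e - X v) ≤ (Y r - Y v) / (X r - X v) := by
    by_contra h
    exact h (hmax ⟨he.adj_ca.symm, hev⟩ (not_le.1 h).le)
  rw [div_le_div_iff₀ (by linarith) (by linarith)] at hle
  have := he.pos
  simp only [orient] at this
  linarith

lemma IsTriangulation.left_cases [Finite V] (hT : IsTriangulation X Y T)
    (hX : Function.Injective X) (v : V) :
    (∃ b c, IsFace X Y T v b c ∧ X b < X v ∧ X v < X c) ∨ (∃ r, Bare X Y T v r ∧ X r < X v) ∨
      ∀ d, X v ≤ X d := by
  have := hT.neg.right_cases (fun a b h => hX (neg_injective h)) v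
  simpa only [isFace_neg, bare_neg, neg_lt_neg_iff, neg_le_neg_iff] using this

variable (X) in
/-- The vertex `a` lies strictly between the vertical lines through `b` and `c`. -/
def Between (a b c : V) : Prop := X b < X a ∧ X a < X c ∨ X c < X a ∧ X a < X b

end Middle

section Counting

open Classical Finset

variable {V : Type*} [Fintype V] {X Y : V → ℝ} {P M T : SimpleGraph V}

/-- The ordered pairs in the relation `r`. -/
noncomputable def pairs (r : V → V → Prop) : Finset (V × V) := univ.filter fun p => r p.1 p.2

@[simp] lemma mem_pairs {r : V → V → Prop} {p : V × V} : p ∈ pairs r ↔ r p.1 p.2 := by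
  simp [pairs]

lemma card_pairs_le {r r' : V → V → Prop} (h : ∀ a b, r a b → r' a b) :
    #(pairs r) ≤ #(pairs r') :=
  card_le_card fun p hp => by simp only [mem_pairs] at hp ⊢; exact h _ _ hp

lemma card_pairs_or_le (r r' : V → V → Prop) :
    #(pairs fun a b => r a b ∨ r' a b) ≤ #(pairs r) + #(pairs r') := by
  refine (card_le_card fun p hp => ?_).trans (card_union_le _ _)
  simpa using hp

lemma card_pairs_swap (r : V → V → Prop) : #(pairs fun a b => r b a) = #(pairs r) :=
  card_bij (fun p _ => p.swap) (fun p hp => by simpa using hp)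
    (fun p _ q _ h => Prod.swap_injective h) fun p hp => ⟨p.swap, by simpa using hp, by simp⟩

lemma card_pairs_split (r p : V → V → Prop) :
    #(pairs r) = #(pairs fun a b => r a b ∧ p a b) + #(pairs fun a b => r a b ∧ ¬ p a b) := by
  rw [← card_filter_add_card_filter_not (s := pairs r) fun q => p q.1 q.2]
  congr 2 <;> ext q <;> simp

/-- Relations whose second component is determined by the first. -/
lemma card_pairs_le_of_unique {r : V → V → Prop} {p : V → Prop} [DecidablePred p]
    (h : ∀ a b, r a b → p a)
    (hu : ∀ a b b', r a b → r a b' → b = b') : #(pairs r) ≤ #(univ.filter p) :=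
  card_le_card_of_injOn Prod.fst (fun q hq => by
    have hq : r q.1 q.2 := by simpa using hq
    simpa using h _ _ hq) fun q hq q' hq' heq => by
    have hq : r q.1 q.2 := by simpa using hq
    have hq' : r q'.1 q'.2 := by simpa using hq'
    rw [← heq] at hq'
    exact Prod.ext heq (hu _ _ _ hq hq')

lemma card_pairs_ge_of_exists {r : V → V → Prop} {p : V → Prop} [DecidablePred p]
    (h : ∀ a, p a → ∃ b, r a b) :
    #(univ.filter p) ≤ #(pairs r) := by
  refine card_le_card_of_forall_subsingleton (fun a (q : V × V) => q.1 = a) (fun a ha => ?_) ?_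
  · obtain ⟨b, hb⟩ := h a (by simpa using ha)
    exact ⟨(a, b), by simpa using hb, rfl⟩
  · rintro b - x ⟨-, hx⟩ y ⟨-, hy⟩
    exact hx.symm.trans hy

/-- The faces whose first vertex is the middle one in the horizontal order. -/
noncomputable def midFaces (X Y : V → ℝ) (T : SimpleGraph V) : Finset (V × V × V) :=
  univ.filter fun f => IsFace X Y T f.1 f.2.1 f.2.2 ∧ Between X f.1 f.2.1 f.2.2

lemma mem_midFaces {f : V × V × V} : f ∈ midFaces X Y T ↔
    IsFace X Y T f.1 f.2.1 f.2.2 ∧ Between X f.1 f.2.1 f.2.2 := by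
  simp only [midFaces, mem_filter, mem_univ, true_and]

/-- Every vertex is the middle of a face above it and of a face below it, with few exceptions. -/
lemma IsTriangulation.card_midFaces_ge (hT : IsTriangulation X Y T) (hX : Function.Injective X) :
    2 * Fintype.card V ≤ #(midFaces X Y T) + #(pairs (Bare X Y T)) + 2 := by
  have key : #(univ : Finset (V × Bool)) ≤
      #((midFaces X Y T).disjSum ((pairs (Bare X Y T)).disjSum (univ : Finset Bool))) := by
    refine card_le_card_of_forall_subsingleton (fun (p : V × Bool) x =>
      (∃ b c, x = Sum.inl (p.1, b, c) ∧ (p.2 = true ↔ X p.1 < X b)) ∨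
      (∃ c, x = Sum.inr (Sum.inl (p.1, c)) ∧ (p.2 = true ↔ X p.1 < X c)) ∨
      (x = Sum.inr (Sum.inr p.2) ∧ (p.2 = true → ∀ d, X d ≤ X p.1) ∧
        (p.2 = false → ∀ d, X p.1 ≤ X d))) ?_ ?_
    · rintro ⟨v, σ⟩ -
      cases σ with
      | true =>
        rcases hT.right_cases hX v with ⟨b, c, h, h1, h2⟩ | ⟨r, h, h1⟩ | h
        · exact ⟨Sum.inl (v, b, c), inl_mem_disjSum.2 (mem_midFaces.2 ⟨h, Or.inr ⟨h2, h1⟩⟩),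
            Or.inl ⟨b, c, rfl, by simpa using h1⟩⟩
        · exact ⟨Sum.inr (Sum.inl (v, r)), by simpa using h,
            Or.inr (Or.inl ⟨r, rfl, by simpa using h1⟩)⟩
        · exact ⟨Sum.inr (Sum.inr true), by simp, Or.inr (Or.inr (by simpa using h))⟩
      | false =>
        rcases hT.left_cases hX v with ⟨b, c, h, h1, h2⟩ | ⟨r, h, h1⟩ | h
        · exact ⟨Sum.inl (v, b, c), inl_mem_disjSum.2 (mem_midFaces.2 ⟨h, Or.inl ⟨h1, h2⟩⟩),
            Or.inl ⟨b, c, rfl, by simpa using h1.le⟩⟩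
        · exact ⟨Sum.inr (Sum.inl (v, r)), by simpa using h,
            Or.inr (Or.inl ⟨r, rfl, by simpa using h1.le⟩)⟩
        · exact ⟨Sum.inr (Sum.inr false), by simp, Or.inr (Or.inr (by simpa using h))⟩
    · rintro x - ⟨v, σ⟩ ⟨-, h⟩ ⟨v', σ'⟩ ⟨-, h'⟩
      rcases h with ⟨b, c, rfl, h⟩ | ⟨c, rfl, h⟩ | ⟨rfl, h1, h2⟩ <;>
        rcases h' with ⟨b', c', e, h'⟩ | ⟨c', e, h'⟩ | ⟨e, h1', h2'⟩ <;> simp at e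
      · obtain ⟨rfl, rfl, rfl⟩ := e
        exact Prod.ext rfl (Bool.eq_iff_iff.2 (h.trans h'.symm))
      · obtain ⟨rfl, rfl⟩ := e
        exact Prod.ext rfl (Bool.eq_iff_iff.2 (h.trans h'.symm))
      · simp only at e h1 h2 h1' h2'
        subst e
        refine Prod.ext (hX ?_) rfl
        cases σ with
        | true => exact le_antisymm (h1' rfl v) (h1 rfl v')
        | false => exact le_antisymm (h2 rfl v') (h2' rfl v)
  simp only [card_disjSum, card_univ, Fintype.card_prod, Fintype.card_bool] at key
  omega

/-- Every face has an edge whose ends have the same colour, and a face with all vertices of the same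
colour has three. -/
lemma IsTriangulation.card_midFaces_le (hT : IsTriangulation X Y T) (W : V → Prop) :
    #(midFaces X Y T) + 2 * #((midFaces X Y T).filter fun f => W f.1 ∧ W f.2.1 ∧ W f.2.2) ≤
      #(pairs fun a b => (T.Adj a b ∧ ¬ Bare X Y T a b) ∧ (W a ↔ W b)) := by
  have h1 : #(midFaces X Y T) + 2 * #((midFaces X Y T).filter fun f => W f.1 ∧ W f.2.1 ∧ W f.2.2) ≤
      #(((midFaces X Y T).filter fun f => (W f.1 ↔ W f.2.1)).disjSum
        (((midFaces X Y T).filter fun f => (W f.2.1 ↔ W f.2.2)).disjSum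
          ((midFaces X Y T).filter fun f => (W f.2.2 ↔ W f.1)))) := by
    simp only [card_disjSum, card_filter, card_eq_sum_ones (midFaces X Y T), mul_sum,
      ← sum_add_distrib]
    refine sum_le_sum fun f _ => ?_
    by_cases ha : W f.1 <;> by_cases hb : W f.2.1 <;> by_cases hc : W f.2.2 <;> simp [ha, hb, hc]
  refine h1.trans ?_
  refine card_le_card_of_forall_subsingleton (fun x (d : V × V) =>
      x.elim (fun f => d = (f.1, f.2.1)) fun y =>
        y.elim (fun f => d = (f.2.1, f.2.2)) (fun f => d = (f.2.2, f.1))) ?_ ?_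
  · rintro (⟨a, b, c⟩ | ⟨a, b, c⟩ | ⟨a, b, c⟩) h <;>
      simp only [mem_midFaces, inl_mem_disjSum, inr_mem_disjSum, mem_filter] at h
    · exact ⟨(a, b), by simpa using ⟨⟨h.1.1.adj_ab, h.1.1.not_bare⟩, h.2⟩, rfl⟩
    · exact ⟨(b, c), by simpa using ⟨⟨h.1.1.adj_bc, h.1.1.rot.not_bare⟩, h.2⟩, rfl⟩
    · exact ⟨(c, a), by simpa using ⟨⟨h.1.1.adj_ca, h.1.1.rot.rot.not_bare⟩, h.2⟩, rfl⟩
  · rintro ⟨x, y⟩ - (⟨a, b, c⟩ | ⟨a, b, c⟩ | ⟨a, b, c⟩) ⟨h, e⟩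
      (⟨a', b', c'⟩ | ⟨a', b', c'⟩ | ⟨a', b', c'⟩) ⟨h', e'⟩ <;>
      simp only [mem_midFaces, inl_mem_disjSum, inr_mem_disjSum, mem_filter,
        Sum.elim_inl, Sum.elim_inr, Prod.mk.injEq] at h h' e e' <;>
      obtain ⟨rfl, rfl⟩ := e <;> obtain ⟨rfl, rfl⟩ := e' <;>
      obtain ⟨⟨f, m⟩, -⟩ := h <;> obtain ⟨⟨f', m'⟩, -⟩ := h' <;> simp only [Between] at m m'
    · obtain rfl := hT.face_unique f f'
      rfl
    · obtain rfl := hT.face_unique f f'.rot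
      rcases m with m | m <;> rcases m' with m' | m' <;> linarith [m.1, m.2, m'.1, m'.2]
    · obtain rfl := hT.face_unique f f'.rot.rot
      rcases m with m | m <;> rcases m' with m' | m' <;> linarith [m.1, m.2, m'.1, m'.2]
    · obtain rfl := hT.face_unique f.rot f'
      rcases m with m | m <;> rcases m' with m' | m' <;> linarith [m.1, m.2, m'.1, m'.2]
    · obtain rfl := hT.face_unique f.rot f'.rot
      rfl
    · obtain rfl := hT.face_unique f.rot f'.rot.rot
      rcases m with m | m <;> rcases m' with m' | m' <;> linarith [m.1, m.2, m'.1, m'.2]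
    · obtain rfl := hT.face_unique f.rot.rot f'
      rcases m with m | m <;> rcases m' with m' | m' <;> linarith [m.1, m.2, m'.1, m'.2]
    · obtain rfl := hT.face_unique f.rot.rot f'.rot
      rcases m with m | m <;> rcases m' with m' | m' <;> linarith [m.1, m.2, m'.1, m'.2]
    · obtain rfl := hT.face_unique f.rot.rot f'.rot.rot
      rfl

end Counting

section LowerBound

open Classical Finset

variable {V : Type*} [Fintype V] {X Y : V → ℝ} {P M T : SimpleGraph V}

/-- Each vertex in `S` is the tail of two directed edges of the polygon. -/
lemma PolygonMatching.card_pairs_tail (hP : PolygonMatching X Y P M) (S : V → Prop)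
    [DecidablePred S] : #(pairs fun a b => P.Adj a b ∧ S a) = 2 * #(univ.filter S) := by
  rw [card_eq_sum_card_fiberwise (f := Prod.fst) (t := univ.filter S) (fun p hp => by
    have hp : P.Adj p.1 p.2 ∧ S p.1 := by simpa using hp
    simpa using hp.2)]
  rw [mul_comm, ← smul_eq_mul, ← sum_const]
  refine sum_congr rfl fun v hv => ?_
  obtain ⟨a, b, hab, h⟩ := hP.two_neighbors v
  have hv : S v := by simpa using hv
  have : ((pairs fun a b => P.Adj a b ∧ S a).filter fun p => p.1 = v) = {(v, a), (v, b)} := by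
    ext ⟨x, y⟩
    simp only [mem_filter, mem_pairs, mem_insert, mem_singleton, Prod.mk.injEq]
    constructor
    · rintro ⟨⟨h1, -⟩, rfl⟩
      exact ((h y).1 h1).imp (fun h => ⟨rfl, h⟩) fun h => ⟨rfl, h⟩
    · rintro (⟨rfl, rfl⟩ | ⟨rfl, rfl⟩)
      · exact ⟨⟨(h _).2 (Or.inl rfl), hv⟩, rfl⟩
      · exact ⟨⟨(h _).2 (Or.inr rfl), hv⟩, rfl⟩
  rw [this, card_pair]
  simpa using hab

/-- The ends of a bare edge determine the next bare edge, and conversely. -/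
lemma OptTriangulation.card_bare_head_le (hP : PolygonMatching X Y P M)
    (hT : OptTriangulation X Y P M T) (W : V → Prop) :
    #(pairs fun a b => Bare X Y T a b ∧ W b) ≤ #(pairs fun a b => Bare X Y T a b ∧ W a) := by
  refine card_le_card_of_forall_subsingleton (fun p q => p.2 = q.1) ?_ ?_
  · rintro ⟨z, c⟩ h
    simp only [mem_pairs] at h
    obtain ⟨a, b, hab, hN⟩ := hP.two_neighbors c
    obtain ⟨e, he, hez⟩ : ∃ e, P.Adj c e ∧ e ≠ z := by
      by_cases haz : a = z
      · exact ⟨b, (hN b).2 (Or.inr rfl), fun h => hab (haz.trans h.symm)⟩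
      · exact ⟨a, (hN a).2 (Or.inl rfl), haz⟩
    obtain ⟨c', hc', -⟩ := h.1.exists_next hT.toIsTriangulation (hT.le (Or.inl he)) hez
    exact ⟨(c, c'), by simpa using ⟨hc', h.2⟩, rfl⟩
  · rintro ⟨x, y⟩ - ⟨z, c⟩ ⟨h, e⟩ ⟨z', c'⟩ ⟨h', e'⟩
    simp only [mem_pairs] at h h' e e'
    obtain rfl : c = c' := e.trans e'.symm
    exact Prod.ext (h.1.head_injective hT.toIsTriangulation h'.1) rfl

/-- Some matched vertex lies on the convex hull. -/
lemma OptTriangulation.exists_bare_matched (hP : PolygonMatching X Y P M)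
    (hT : OptTriangulation X Y P M T) {w : V} (hw : Matched M w) :
    ∃ z c, Matched M z ∧ Bare X Y T z c := by
  by_contra hcon
  push Not at hcon
  have hTT := hT.toIsTriangulation
  have hU : ∀ {z c}, Bare X Y T z c → ¬ Matched M z := fun h hz => hcon _ _ hz h
  have next : ∀ {z c}, Bare X Y T z c → ∃ c', Bare X Y T c c' ∧ c' ≠ z := by
    intro z c h
    obtain ⟨a, b, hab, hN⟩ := hP.two_neighbors c
    by_cases haz : a = z
    · exact h.exists_next hTT (hT.le (Or.inl ((hN b).2 (Or.inr rfl))))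
        fun h => hab (haz.trans h.symm)
    · exact h.exists_next hTT (hT.le (Or.inl ((hN a).2 (Or.inl rfl)))) haz
  have adj : ∀ {z c}, Bare X Y T z c → P.Adj z c := by
    intro z c h
    obtain ⟨c', hc', -⟩ := next h
    exact hT.adj_of_unmatched hP h.1 (hU h) (hU hc')
  let S := {v | ∃ c, Bare X Y T v c}
  have hne : S.Nonempty := by
    have : Nonempty V := ⟨w⟩
    obtain ⟨v, hv⟩ := Finite.exists_min X
    rcases hTT.right_cases hP.injective v with ⟨b, c, -, -, h⟩ | ⟨r, h, -⟩ | h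
    · exact absurd (hv c) (not_le.2 h)
    · exact ⟨v, r, h⟩
    · obtain ⟨a, b, hab, hN⟩ := hP.two_neighbors v
      have ha : a = v := hP.injective (le_antisymm (h a) (hv a))
      exact absurd ((hN a).2 (Or.inl rfl)) (by rw [ha]; exact P.irrefl)
  choose f hf using fun v : S => v.2
  let g : S → S := fun v => ⟨f v, (next (hf v)).imp fun _ h => h.1⟩
  have hg : Function.Injective g := by
    intro v v' h
    have h : f v = f v' := congrArg Subtype.val h
    have h2 := hf v'
    rw [← h] at h2
    exact Subtype.ext ((hf v).head_injective hTT h2)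
  have huniv := hP.connected S hne fun v hv x hx => by
    obtain ⟨⟨u, hu⟩, hgu⟩ := Finite.surjective_of_injective hg ⟨v, hv⟩
    have hgu : f ⟨u, hu⟩ = v := congrArg Subtype.val hgu
    have huv : Bare X Y T u v := hgu ▸ hf ⟨u, hu⟩
    obtain ⟨c, hc, hcu⟩ := next huv
    obtain ⟨a, b, hab, hN⟩ := hP.two_neighbors v
    have h1 := (hN u).1 (adj huv).symm
    have h2 := (hN c).1 (adj hc)
    have hcS : c ∈ S := (next hc).imp fun _ h => h.1
    rcases (hN x).1 hx with rfl | rfl <;> rcases h1 with rfl | rfl <;> rcases h2 with rfl | rfl <;>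
      first | exact hu | exact hcS | exact absurd rfl hcu
  have : w ∈ S := huniv ▸ Set.mem_univ w
  obtain ⟨c, hc⟩ := this
  exact hU hc hw

/-- Matched vertices have at most two blocked edges, and none if they are on the convex hull. -/
lemma OptTriangulation.card_blocked_le (hP : PolygonMatching X Y P M)
    (hT : OptTriangulation X Y P M T) :
    #(pairs fun z x => Matched M z ∧ Blocked X Y T z x ∧ ¬ P.Adj z x ∧ ¬ M.Adj z x) ≤
      2 * #(univ.filter fun z => Matched M z ∧ ¬ ∃ c, Bare X Y T z c) := by
  refine card_le_mul_card_image_of_maps_to (f := Prod.fst) (fun p hp => ?_) 2 fun z hz => ?_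
  · simp only [mem_pairs] at hp
    simp only [mem_filter, mem_univ, true_and]
    exact ⟨hp.1, fun ⟨c, hc⟩ => hp.2.1.not_bare hc⟩
  · by_contra hcard
    obtain ⟨⟨z1, x1⟩, h1, ⟨z2, x2⟩, h2, ⟨z3, x3⟩, h3, h12, h13, h23⟩ := two_lt_card.1 (not_le.1 hcard)
    simp only [mem_filter, mem_pairs] at h1 h2 h3
    obtain ⟨h1, rfl⟩ := h1
    obtain ⟨h2, rfl⟩ := h2
    obtain ⟨h3, rfl⟩ := h3
    obtain ⟨a, b, hab, hN⟩ := hP.two_neighbors z3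
    have ha := (hN a).2 (Or.inl rfl)
    rcases hT.eq_of_three_blocked h1.2.1 h2.2.1 h3.2.1 (fun h => h12 (by rw [h]))
      (fun h => h13 (by rw [h])) (fun h => h23 (by rw [h])) (hT.le (Or.inl ha)) with h | h | h
    · exact h1.2.2.1 (h ▸ ha)
    · exact h2.2.2.1 (h ▸ ha)
    · exact h3.2.2.1 (h ▸ ha)

/-- An edge between matched vertices that can be flipped has a neighbouring face with all vertices
matched whose apex lies between its ends in the horizontal order. -/
lemma OptTriangulation.between_of_not_blocked (hP : PolygonMatching X Y P M)
    (hT : OptTriangulation X Y P M T) {z z' : V} (hz : Matched M z) (hz' : Matched M z')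
    (hzz : T.Adj z z') (hnP : ¬ P.Adj z z') (hnM : ¬ M.Adj z z') (hb : ¬ Bare X Y T z z')
    (hb' : ¬ Bare X Y T z' z) (hB : ¬ Blocked X Y T z z') (hB' : ¬ Blocked X Y T z' z) :
    (∃ a, IsFace X Y T z z' a ∧ Matched M a ∧ Between X a z z') ∨
      ∃ a, IsFace X Y T z' z a ∧ Matched M a ∧ Between X a z z' := by
  have hTT := hT.toIsTriangulation
  obtain ⟨b, fb⟩ := hTT.exists_face_of_not_bare hzz hb
  obtain ⟨a, fa⟩ := hTT.exists_face_of_not_bare hzz.symm hb'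
  have hab : a ≠ b := by
    rintro rfl
    have h1 := fa.pos
    have h2 := fb.pos
    rw [orient_swap'] at h1
    linarith
  have h1 : 0 < orient X Y z a b := by
    by_contra h
    have := lt_of_le_of_ne (not_lt.1 h) (hP.genPos z a b fa.adj_bc.ne hab fb.adj_ca.ne.symm)
    exact hB ⟨a, b, fa.rot, fb, by rw [orient_swap]; linarith⟩
  have h2 : 0 < orient X Y z' b a := by
    by_contra h
    have := lt_of_le_of_ne (not_lt.1 h) (hP.genPos z' b a fb.adj_bc.ne hab.symm fa.adj_ca.ne.symm)
    exact hB' ⟨b, a, fb.rot, fa, by rw [orient_swap]; linarith⟩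
  obtain ⟨hcr, honly⟩ := hTT.flip fb fa h1 h2
  obtain ⟨ha, hb, hle⟩ := hT.flip_opt z z' a b hz hz' hzz hnP hnM hcr honly
  rcases hcr.exists_between hP.injective hle with h | h
  · exact Or.inr ⟨a, fa, ha, h⟩
  · exact Or.inl ⟨b, fb, hb, h⟩

/-- The edges between matched vertices which have a face on their left. -/
lemma OptTriangulation.card_matched_le (hP : PolygonMatching X Y P M)
    (hT : OptTriangulation X Y P M T) :
    #(pairs fun a b => (T.Adj a b ∧ ¬ Bare X Y T a b) ∧ Matched M a ∧ Matched M b) ≤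
      #(univ.filter (Matched M)) + #(pairs fun a b => P.Adj a b ∧ Matched M a ∧ Matched M b) +
      #(pairs fun a b => Bare X Y T a b ∧ Matched M a ∧ Matched M b) +
      2 * #(pairs fun z x => (Matched M z ∧ Blocked X Y T z x ∧ ¬ P.Adj z x ∧ ¬ M.Adj z x) ∧
        Matched M x) +
      2 * #((midFaces X Y T).filter fun f => Matched M f.1 ∧ Matched M f.2.1 ∧ Matched M f.2.2) := by
  set rP := fun a b => P.Adj a b ∧ Matched M a ∧ Matched M b
  set rb := fun a b => Bare X Y T a b ∧ Matched M a ∧ Matched M b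
  set rB := fun z x => (Matched M z ∧ Blocked X Y T z x ∧ ¬ P.Adj z x ∧ ¬ M.Adj z x) ∧ Matched M x
  set rN := fun z z' => ∃ a, IsFace X Y T z z' a ∧ (Matched M z ∧ Matched M z' ∧ Matched M a) ∧
    Between X a z z'
  have hM : #(pairs M.Adj) ≤ #(univ.filter (Matched M)) :=
    card_pairs_le_of_unique (fun a b h => ⟨b, h⟩) hP.matching
  have hN : #(pairs rN) ≤
      #((midFaces X Y T).filter fun f => Matched M f.1 ∧ Matched M f.2.1 ∧ Matched M f.2.2) := by
    refine card_le_card_of_forall_subsingleton (fun p f => p = (f.2.1, f.2.2)) ?_ ?_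
    · rintro ⟨z, z'⟩ h
      obtain ⟨a, hf, hm, hb⟩ := mem_pairs.1 h
      exact ⟨(a, z, z'), mem_filter.2 ⟨mem_midFaces.2 ⟨hf.rot.rot, hb⟩, hm.2.2, hm.1, hm.2.1⟩, rfl⟩
    · rintro f - p ⟨-, hp⟩ q ⟨-, hq⟩
      exact hp.trans hq.symm
  have hsub := card_pairs_le (V := V)
    (r := fun a b => (T.Adj a b ∧ ¬ Bare X Y T a b) ∧ Matched M a ∧ Matched M b)
    (r' := fun a b => M.Adj a b ∨ rP a b ∨ rb b a ∨ rB a b ∨ rB b a ∨ rN a b ∨ rN b a) (by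
      rintro z z' ⟨⟨hadj, hb⟩, hz, hz'⟩
      by_contra hcon
      push Not at hcon
      obtain ⟨c1, c2, c3, c4, c5, c6, c7⟩ := hcon
      have hnP : ¬ P.Adj z z' := fun h => c2 ⟨h, hz, hz'⟩
      rcases hT.between_of_not_blocked hP hz hz' hadj hnP c1 hb (fun h => c3 ⟨h, hz', hz⟩)
        (fun h => c4 ⟨⟨hz, h, hnP, c1⟩, hz'⟩)
        (fun h => c5 ⟨⟨hz', h, fun h => hnP h.symm, fun h => c1 h.symm⟩, hz⟩)
        with ⟨a, f, ha, hab⟩ | ⟨a, f, ha, hab⟩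
      · exact c6 ⟨a, f, ⟨hz, hz', ha⟩, hab⟩
      · exact c7 ⟨a, f, ⟨hz', hz, ha⟩, hab.symm⟩)
  have u1 := card_pairs_or_le M.Adj
    (fun a b => rP a b ∨ rb b a ∨ rB a b ∨ rB b a ∨ rN a b ∨ rN b a)
  have u2 := card_pairs_or_le rP (fun a b => rb b a ∨ rB a b ∨ rB b a ∨ rN a b ∨ rN b a)
  have u3 := card_pairs_or_le (fun a b => rb b a) (fun a b => rB a b ∨ rB b a ∨ rN a b ∨ rN b a)
  have u4 := card_pairs_or_le rB (fun a b => rB b a ∨ rN a b ∨ rN b a)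
  have u5 := card_pairs_or_le (fun a b => rB b a) (fun a b => rN a b ∨ rN b a)
  have u6 := card_pairs_or_le rN (fun a b => rN b a)
  have s1 := card_pairs_swap rb
  have s2 := card_pairs_swap rB
  have s3 := card_pairs_swap rN
  omega

/-- At least two sevenths of the vertices are matched. -/
theorem PolygonMatching.two_mul_card_le [Nonempty V] (hP : PolygonMatching X Y P M) :
    2 * Fintype.card V ≤ 7 * #(univ.filter (Matched M)) := by
  obtain ⟨T, hT⟩ := hP.exists_optTriangulation
  have hTT := hT.toIsTriangulation
  have f3 := hT.card_matched_le hP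
  have u5 := hT.card_blocked_le hP
  set W := Matched M
  -- a matched vertex exists, even on the hull
  obtain ⟨w, hw⟩ : ∃ w, W w := by
    obtain ⟨u⟩ := ‹Nonempty V›
    by_contra h
    push Not at h
    obtain ⟨z, hz, -⟩ := hT.exists_blocked hP (h u) fun a _ => h a
    exact h z hz
  obtain ⟨z₀, c₀, hz₀, hzc₀⟩ := hT.exists_bare_matched hP hw
  set h := #(univ.filter fun z => W z ∧ ∃ c, Bare X Y T z c)
  have h_pos : 1 ≤ h := card_pos.2 ⟨z₀, by simpa using ⟨hz₀, c₀, hzc₀⟩⟩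
  have hWsplit : #(univ.filter W) = h + #(univ.filter fun z => W z ∧ ¬ ∃ c, Bare X Y T z c) := by
    rw [← card_filter_add_card_filter_not (s := univ.filter W) fun z => ∃ c, Bare X Y T z c,
      filter_filter, filter_filter]
  have hVsplit : Fintype.card V = #(univ.filter W) + #(univ.filter fun u => ¬ W u) := by
    rw [card_filter_add_card_filter_not, card_univ]
  -- faces and edges
  have f1 := hTT.card_midFaces_ge hP.injective
  have f2 := hTT.card_midFaces_le W
  have e1 : #(pairs fun a b => (T.Adj a b ∧ ¬ Bare X Y T a b) ∧ (W a ↔ W b)) ≤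
      #(pairs fun a b => (T.Adj a b ∧ ¬ Bare X Y T a b) ∧ W a ∧ W b) +
      #(pairs fun a b => (P.Adj a b ∧ ¬ W a ∧ ¬ W b) ∧ ¬ Bare X Y T a b) := by
    refine (card_pairs_le ?_).trans (card_pairs_or_le _ _)
    rintro a b ⟨⟨hadj, hb⟩, hW⟩
    by_cases ha : W a
    · exact Or.inl ⟨⟨hadj, hb⟩, ha, hW.1 ha⟩
    · have hb' : ¬ W b := fun h => ha (hW.2 h)
      exact Or.inr ⟨⟨hT.adj_of_unmatched hP hadj ha hb', ha, hb'⟩, hb⟩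
  have e2 := card_pairs_split (fun a b => P.Adj a b ∧ ¬ W a ∧ ¬ W b) (Bare X Y T)
  -- bare edges
  have b1 := card_pairs_split (Bare X Y T) fun a b => W a
  have b2 := card_pairs_split (fun a b => Bare X Y T a b ∧ ¬ W a) fun a b => W b
  have b3 := card_pairs_split (fun a b => Bare X Y T a b ∧ W b) fun a b => W a
  have b4 := hT.card_bare_head_le hP W
  have b5 : #(pairs fun a b => Bare X Y T a b ∧ W a) ≤ h :=
    card_pairs_le_of_unique (r := fun a b => Bare X Y T a b ∧ W a)
      (p := fun z => W z ∧ ∃ c, Bare X Y T z c)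
      (fun a b hb => ⟨hb.2, b, hb.1⟩) fun a b b' h h' => h.1.unique h'.1
  have b6 : #(pairs fun a b => (Bare X Y T a b ∧ ¬ W a) ∧ ¬ W b) ≤
      #(pairs fun a b => (P.Adj a b ∧ ¬ W a ∧ ¬ W b) ∧ Bare X Y T a b) :=
    card_pairs_le fun a b hb =>
      ⟨⟨hT.adj_of_unmatched hP hb.1.1.1 hb.1.2 hb.2, hb.1.2, hb.2⟩, hb.1.1⟩
  have b7 : #(pairs fun a b => (Bare X Y T a b ∧ ¬ W a) ∧ W b) =
      #(pairs fun a b => (Bare X Y T a b ∧ W b) ∧ ¬ W a) :=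
    congrArg card (by ext p; simp only [mem_pairs]; tauto)
  have b8 : #(pairs fun a b => (Bare X Y T a b ∧ W b) ∧ W a) =
      #(pairs fun a b => Bare X Y T a b ∧ W a ∧ W b) :=
    congrArg card (by ext p; simp only [mem_pairs]; tauto)
  -- polygon edges
  have p1 := hP.card_pairs_tail W
  have p2 := hP.card_pairs_tail fun v => ¬ W v
  have p3 := card_pairs_split (fun a b => P.Adj a b ∧ W a) fun a b => W b
  have p4 := card_pairs_split (fun a b => P.Adj a b ∧ ¬ W a) fun a b => W b
  have p5 : #(pairs fun a b => (P.Adj a b ∧ W a) ∧ ¬ W b) =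
      #(pairs fun a b => (P.Adj a b ∧ ¬ W a) ∧ W b) := by
    rw [← card_pairs_swap]
    exact congrArg card (by ext p; simp only [mem_pairs, P.adj_comm p.2]; tauto)
  have p6 : #(pairs fun a b => (P.Adj a b ∧ W a) ∧ W b) =
      #(pairs fun a b => P.Adj a b ∧ W a ∧ W b) :=
    congrArg card (by ext p; simp only [mem_pairs]; tauto)
  have p7 : #(pairs fun a b => (P.Adj a b ∧ ¬ W a) ∧ ¬ W b) =
      #(pairs fun a b => P.Adj a b ∧ ¬ W a ∧ ¬ W b) :=
    congrArg card (by ext p; simp only [mem_pairs]; tauto)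
  -- unmatched vertices
  have u1 : #(univ.filter fun u => ¬ W u) ≤
      #(univ.filter fun u => ¬ W u ∧ ∀ a, P.Adj u a → ¬ W a) +
      #(univ.filter fun u => ¬ W u ∧ ∃ a, P.Adj u a ∧ W a) := by
    refine (card_le_card fun u hu => ?_).trans (card_union_le _ _)
    simp only [mem_union, mem_filter, mem_univ, true_and] at hu ⊢
    by_cases h : ∃ a, P.Adj u a ∧ W a
    · exact Or.inr ⟨hu, h⟩
    · push Not at h
      exact Or.inl ⟨hu, h⟩
  have u2 : #(univ.filter fun u => ¬ W u ∧ ∃ a, P.Adj u a ∧ W a) ≤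
      #(pairs fun a b => (P.Adj a b ∧ ¬ W a) ∧ W b) :=
    card_pairs_ge_of_exists (r := fun a b => (P.Adj a b ∧ ¬ W a) ∧ W b)
      (p := fun u => ¬ W u ∧ ∃ a, P.Adj u a ∧ W a) fun u ⟨hu, a, ha, hW⟩ => ⟨a, ⟨ha, hu⟩, hW⟩
  have u3 : #(univ.filter fun u => ¬ W u ∧ ∀ a, P.Adj u a → ¬ W a) ≤
      #(pairs fun z x => (W z ∧ Blocked X Y T z x ∧ ¬ P.Adj z x ∧ ¬ M.Adj z x) ∧ ¬ W x) := by
    rw [← card_pairs_swap]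
    refine card_pairs_ge_of_exists fun u ⟨hu, hN⟩ => ?_
    obtain ⟨z, hz, hB⟩ := hT.exists_blocked hP hu hN
    exact ⟨z, ⟨hz, hB, fun h => hN z h.symm hz, fun h => hu ⟨z, h.symm⟩⟩, hu⟩
  have u4 := card_pairs_split (fun z x => W z ∧ Blocked X Y T z x ∧ ¬ P.Adj z x ∧ ¬ M.Adj z x)
    fun z x => W x
  omega

end LowerBound

section Bridge

variable {V : Type*}

/-- The horizontal coordinates of points in the plane. -/
def xs (pos : V → Plane) (v : V) : ℝ := pos v 0

/-- The vertical coordinates of points in the plane. -/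
def ys (pos : V → Plane) (v : V) : ℝ := pos v 1

lemma plane_ext {p q : Plane} (h0 : p 0 = q 0) (h1 : p 1 = q 1) : p = q := by
  ext i
  fin_cases i
  · exact h0
  · exact h1

variable {pos : V → Plane}

lemma collinear_iff_orient_eq_zero {a b c : V} :
    Collinear ℝ {pos a, pos b, pos c} ↔ orient (xs pos) (ys pos) a b c = 0 := by
  rw [collinear_iff_of_mem (p₀ := pos a) (by simp)]
  constructor
  · rintro ⟨v, hv⟩
    obtain ⟨r, hr⟩ := hv (pos b) (by simp)
    obtain ⟨s, hs⟩ := hv (pos c) (by simp)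
    simp only [orient, xs, ys, hr, hs, vadd_eq_add, PiLp.add_apply, PiLp.smul_apply, smul_eq_mul]
    ring
  · intro h
    simp only [orient, xs, ys] at h
    by_cases h0 : pos b 0 - pos a 0 = 0
    · by_cases h1 : pos b 1 - pos a 1 = 0
      · refine ⟨pos c - pos a, ?_⟩
        have hba : pos b = pos a := plane_ext (sub_eq_zero.1 h0) (sub_eq_zero.1 h1)
        simp only [Set.mem_insert_iff, Set.mem_singleton_iff, forall_eq_or_imp, forall_eq]
        exact ⟨⟨0, by simp⟩, ⟨0, by simp [hba]⟩, ⟨1, by simp⟩⟩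
      · refine ⟨pos b - pos a, ?_⟩
        simp only [Set.mem_insert_iff, Set.mem_singleton_iff, forall_eq_or_imp, forall_eq]
        refine ⟨⟨0, by simp⟩, ⟨1, by simp⟩, ⟨(pos c 1 - pos a 1) / (pos b 1 - pos a 1), ?_⟩⟩
        apply plane_ext <;>
          simp only [vadd_eq_add, PiLp.add_apply, PiLp.smul_apply, smul_eq_mul, PiLp.sub_apply]
        · have : (pos b 1 - pos a 1) * (pos c 0 - pos a 0) = 0 := by rw [h0] at h; linarith
          have := (mul_eq_zero.1 this).resolve_left h1
          rw [h0]; linarith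
        · field_simp; ring
    · refine ⟨pos b - pos a, ?_⟩
      simp only [Set.mem_insert_iff, Set.mem_singleton_iff, forall_eq_or_imp, forall_eq]
      refine ⟨⟨0, by simp⟩, ⟨1, by simp⟩, ⟨(pos c 0 - pos a 0) / (pos b 0 - pos a 0), ?_⟩⟩
      apply plane_ext <;>
        simp only [vadd_eq_add, PiLp.add_apply, PiLp.smul_apply, smul_eq_mul, PiLp.sub_apply]
      · field_simp; ring
      · field_simp; linarith

lemma mem_segment_iff_coord {p : Plane} {a b : V} : p ∈ segment ℝ (pos a) (pos b) ↔
    ∃ t : ℝ, 0 ≤ t ∧ t ≤ 1 ∧ (1 - t) * xs pos a + t * xs pos b = p 0 ∧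
      (1 - t) * ys pos a + t * ys pos b = p 1 := by
  rw [segment_eq_image]
  simp only [Set.mem_image, Set.mem_Icc, xs, ys]
  constructor
  · rintro ⟨t, ⟨h0, h1⟩, rfl⟩
    exact ⟨t, h0, h1, by simp, by simp⟩
  · rintro ⟨t, h0, h1, hx, hy⟩
    exact ⟨t, ⟨h0, h1⟩, plane_ext (by simpa using hx) (by simpa using hy)⟩

lemma IsNoncrossing.not_crosses {G : SimpleGraph V} (h : IsNoncrossing pos G) {a b c d : V}
    (hab : G.Adj a b) (hcd : G.Adj c d) : ¬ Crosses (xs pos) (ys pos) a b c d := by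
  intro hcr
  obtain ⟨n1, n2, n3, n4, n5, n6⟩ := hcr.ne
  obtain ⟨t, s, ht0, ht1, hs0, hs1, hX, hY⟩ := hcr.exists_coord
  let p : Plane := !₂[(1 - t) * xs pos a + t * xs pos b, (1 - t) * ys pos a + t * ys pos b]
  have hp : p ∈ segment ℝ (pos a) (pos b) :=
    mem_segment_iff_coord.2 ⟨t, ht0.le, ht1.le, by simp [p], by simp [p]⟩
  have hp' : p ∈ segment ℝ (pos c) (pos d) :=
    mem_segment_iff_coord.2 ⟨s, hs0.le, hs1.le, by simp [p, hX], by simp [p, hY]⟩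
  obtain ⟨v, ⟨hv, hv'⟩, -⟩ := h.2 a b c d hab hcd
    (by rw [Ne, Sym2.eq_iff]; tauto) ⟨hp, hp'⟩
  simp only [Set.mem_insert_iff, Set.mem_singleton_iff] at hv hv'
  rcases hv with rfl | rfl <;> rcases hv' with rfl | rfl <;> contradiction

lemma GenPos.eq_of_mem_segment (hg : GenPos (xs pos) (ys pos)) {a b v : V} (hab : a ≠ b)
    (h : pos v ∈ segment ℝ (pos a) (pos b)) : v = a ∨ v = b := by
  obtain ⟨t, -, -, hx, hy⟩ := mem_segment_iff_coord.1 h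
  by_contra hcon
  push Not at hcon
  refine hg a b v hab hcon.2.symm hcon.1.symm ?_
  have hx : (1 - t) * xs pos a + t * xs pos b = xs pos v := hx
  have hy : (1 - t) * ys pos a + t * ys pos b = ys pos v := hy
  simp only [orient, ← hx, ← hy]
  ring

lemma isNoncrossing_of_not_crosses (hg : GenPos (xs pos) (ys pos)) {G : SimpleGraph V}
    (h : ∀ a b c d, G.Adj a b → G.Adj c d → ¬ Crosses (xs pos) (ys pos) a b c d) :
    IsNoncrossing pos G := by
  refine ⟨fun a b v hab hv => hg.eq_of_mem_segment hab.ne hv, ?_⟩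
  rintro a b c d hab hcd hne p ⟨hp, hp'⟩
  have hv : ∀ v, p = pos v → p ∈ pos '' ({a, b} ∩ {c, d}) := by
    rintro v rfl
    refine ⟨v, ⟨?_, ?_⟩, rfl⟩
    · simpa using hg.eq_of_mem_segment hab.ne hp
    · simpa using hg.eq_of_mem_segment hcd.ne hp'
  obtain ⟨t, ht0, ht1, hx, hy⟩ := mem_segment_iff_coord.1 hp
  obtain ⟨s, hs0, hs1, hx', hy'⟩ := mem_segment_iff_coord.1 hp'
  rcases ht0.eq_or_lt with rfl | ht0
  · exact hv a (plane_ext (by simpa [xs] using hx.symm) (by simpa [ys] using hy.symm))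
  rcases ht1.eq_or_lt with rfl | ht1
  · exact hv b (plane_ext (by simpa [xs] using hx.symm) (by simpa [ys] using hy.symm))
  rcases hs0.eq_or_lt with rfl | hs0
  · exact hv c (plane_ext (by simpa [xs] using hx'.symm) (by simpa [ys] using hy'.symm))
  rcases hs1.eq_or_lt with rfl | hs1
  · exact hv d (plane_ext (by simpa [xs] using hx'.symm) (by simpa [ys] using hy'.symm))
  exact absurd (hg.eq_of_common_point hab.ne hcd.ne (h a b c d hab hcd) ht0 ht1 hs0 hs1
    (hx.trans hx'.symm) (hy.trans hy'.symm)) hne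

lemma GeometricGraph.InGeneralPosition.genPos {G : GeometricGraph V} (h : G.InGeneralPosition) :
    GenPos (xs G.pos) (ys G.pos) := fun a b c hab hbc hac h0 =>
  h a b c hab hbc hac (collinear_iff_orient_eq_zero.2 h0)

/-- The coordinates can be sheared so that no two points are on the same vertical line. -/
lemma exists_shear [Finite V] (hpos : Function.Injective pos) :
    ∃ ε : ℝ, Function.Injective fun v => xs pos v + ε * ys pos v := by
  have := Fintype.ofFinite V
  classical
  obtain ⟨ε, hε⟩ := Infinite.exists_notMem_finset (α := ℝ) (Finset.univ.image fun p : V × V =>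
    (xs pos p.2 - xs pos p.1) / (ys pos p.1 - ys pos p.2))
  refine ⟨ε, fun a b hab => ?_⟩
  simp only at hab
  by_cases hy : ys pos a - ys pos b = 0
  · have hy := sub_eq_zero.1 hy
    rw [hy] at hab
    exact hpos (plane_ext (by simpa [xs] using hab) hy)
  · refine absurd (Finset.mem_image.2 ⟨(a, b), Finset.mem_univ _, ?_⟩) hε
    simp only
    rw [div_eq_iff hy]
    linarith

lemma orient_shear (X Y : V → ℝ) (ε : ℝ) : orient (fun v => X v + ε * Y v) Y = orient X Y := by
  funext a b c
  simp only [orient]; ring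

/-- Adding an edge between unmatched vertices. -/
lemma GeometricGraph.IsMaximalCompatibleMatching.exists_crosses {G : GeometricGraph V}
    (hg : G.InGeneralPosition) {M : SimpleGraph V} (hM : G.IsMaximalCompatibleMatching M) {u v : V}
    (huv : u ≠ v) (hu : ∀ w, ¬ M.Adj u w) (hv : ∀ w, ¬ M.Adj v w) (hG : ¬ G.graph.Adj u v) :
    ∃ c d, (G.graph ⊔ M).Adj c d ∧ Crosses (xs G.pos) (ys G.pos) u v c d := by
  by_contra hcon
  push Not at hcon
  have hadj : ∀ a b, (M ⊔ SimpleGraph.edge u v).Adj a b →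
      M.Adj a b ∨ (a = u ∧ b = v) ∨ (a = v ∧ b = u) := by
    intro a b h
    rw [SimpleGraph.sup_adj, SimpleGraph.edge_adj] at h
    tauto
  have hu' : ∀ w, ¬ M.Adj w u := fun w h => hu w h.symm
  have hv' : ∀ w, ¬ M.Adj w v := fun w h => hv w h.symm
  have hcomp : G.IsCompatibleMatching (M ⊔ SimpleGraph.edge u v) := by
    refine ⟨?_, ?_, isNoncrossing_of_not_crosses hg.genPos ?_⟩
    · intro a b c hab hac
      rcases hadj a b hab with h | ⟨rfl, rfl⟩ | ⟨rfl, rfl⟩ <;>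
        rcases hadj a c hac with h' | ⟨h1, rfl⟩ | ⟨h1, rfl⟩
      · exact hM.prop.matching _ _ _ h h'
      · exact absurd h (h1 ▸ hu b)
      · exact absurd h (h1 ▸ hv b)
      · exact absurd h' (hu c)
      · rfl
      · exact absurd h1 huv
      · exact absurd h' (hv c)
      · exact absurd h1.symm huv
      · rfl
    · rw [SimpleGraph.disjoint_left]
      intro a b hab h
      rcases hadj a b h with h | ⟨rfl, rfl⟩ | ⟨rfl, rfl⟩
      · exact SimpleGraph.disjoint_left.1 hM.prop.disjoint a b hab h
      · exact hG hab
      · exact hG hab.symm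
    · have hadj' : ∀ a b, (G.graph ⊔ (M ⊔ SimpleGraph.edge u v)).Adj a b →
          (G.graph ⊔ M).Adj a b ∨ (a = u ∧ b = v) ∨ (a = v ∧ b = u) := by
        rintro a b (h | h)
        · exact Or.inl (Or.inl h)
        · exact (hadj a b h).imp_left Or.inr
      intro a b c d hab hcd hcr
      have hne := hcr.ne
      rcases hadj' a b hab with h | ⟨rfl, rfl⟩ | ⟨rfl, rfl⟩ <;>
        rcases hadj' c d hcd with h' | ⟨rfl, rfl⟩ | ⟨rfl, rfl⟩
      · exact hM.prop.noncrossing.not_crosses h h' hcr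
      · exact hcon _ _ h hcr.symm
      · exact hcon _ _ h hcr.symm.swap_left
      · exact hcon _ _ h' hcr
      · exact hne.2.2.1 rfl
      · exact hne.2.2.2.1 rfl
      · exact hcon _ _ h' hcr.swap_left
      · exact hne.2.2.2.1 rfl
      · exact hne.2.2.1 rfl
  have := hM.le_of_ge hcomp le_sup_left
  exact hu v (this (Or.inr (by rw [SimpleGraph.edge_adj]; exact ⟨Or.inl ⟨rfl, rfl⟩, huv⟩)))

open Classical in
lemma card_matched [Fintype V] {M : SimpleGraph V} (hM : ∀ u v w, M.Adj u v → M.Adj u w → v = w) :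
    (Finset.univ.filter (Matched M)).card = 2 * M.edgeSet.ncard := by
  have h := M.sum_degrees_eq_twice_card_edges
  rw [← Set.ncard_coe_finset, SimpleGraph.coe_edgeFinset] at h
  rw [← h, Finset.card_filter]
  refine Finset.sum_congr rfl fun v _ => ?_
  split_ifs with hv
  · obtain ⟨w, hw⟩ := hv
    refine (Finset.card_eq_one.2 ⟨w, ?_⟩).symm
    ext x
    simp only [SimpleGraph.mem_neighborFinset, Finset.mem_singleton]
    exact ⟨fun hx => hM _ _ _ hx hw, fun hx => hx ▸ hw⟩
  · refine (Finset.card_eq_zero.2 ?_).symm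
    ext x
    simp only [SimpleGraph.mem_neighborFinset, Finset.notMem_empty, iff_false]
    exact fun hx => hv ⟨x, hx⟩

section Cycle

lemma cycleGraph_adj_iff_val {n : ℕ} (hn : 3 ≤ n) {u v : Fin n} :
    (SimpleGraph.cycleGraph n).Adj u v ↔ u.val + 1 = v.val ∨ v.val + 1 = u.val ∨
      (u.val = 0 ∧ v.val + 1 = n) ∨ (v.val = 0 ∧ u.val + 1 = n) := by
  rw [SimpleGraph.cycleGraph_adj', Fin.val_sub, Fin.val_sub]
  obtain ⟨u, hu⟩ := u
  obtain ⟨v, hv⟩ := v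
  simp only
  rcases lt_trichotomy u v with h | rfl | h
  · rw [Nat.mod_eq_of_lt (show n - v + u < n by omega),
      show n - u + v = (v - u) + n by omega, Nat.add_mod_right, Nat.mod_eq_of_lt (by omega)]
    omega
  · rw [Nat.sub_add_cancel hu.le, Nat.mod_self]
    omega
  · rw [Nat.mod_eq_of_lt (show n - u + v < n by omega),
      show n - v + u = (u - v) + n by omega, Nat.add_mod_right, Nat.mod_eq_of_lt (by omega)]
    omega

lemma cycleGraph_two_neighbors {n : ℕ} (hn : 3 ≤ n) (v : Fin n) :
    ∃ a b, a ≠ b ∧ ∀ c, (SimpleGraph.cycleGraph n).Adj v c ↔ c = a ∨ c = b := by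
  refine ⟨⟨if v.val = 0 then n - 1 else v.val - 1, by split_ifs <;> omega⟩,
    ⟨if v.val + 1 = n then 0 else v.val + 1, by split_ifs <;> omega⟩, ?_, fun c => ?_⟩
  · simp only [ne_eq, Fin.mk.injEq]
    split_ifs <;> omega
  · rw [cycleGraph_adj_iff_val hn, Fin.ext_iff, Fin.ext_iff]
    simp only
    split_ifs <;> omega

lemma cycleGraph_connected {n : ℕ} (hn : 3 ≤ n) (S : Set (Fin n)) (hS : S.Nonempty)
    (h : ∀ v ∈ S, ∀ w, (SimpleGraph.cycleGraph n).Adj v w → w ∈ S) : S = Set.univ := by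
  obtain ⟨v, hv⟩ := hS
  have down : ∀ k, ∀ hk : k < n, (⟨k, hk⟩ : Fin n) ∈ S → (⟨0, by omega⟩ : Fin n) ∈ S := by
    intro k
    induction k with
    | zero => exact fun _ h => h
    | succ k ih =>
      exact fun hk hS => ih (by omega) (h _ hS _ ((cycleGraph_adj_iff_val hn).2 (by simp)))
  have up : ∀ k, ∀ hk : k < n, (⟨k, hk⟩ : Fin n) ∈ S := by
    intro k
    induction k with
    | zero => exact fun _ => down v.val v.isLt hv
    | succ k ih =>
      exact fun hk => h _ (ih (by omega)) _ ((cycleGraph_adj_iff_val hn).2 (by simp))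
  exact Set.eq_univ_of_forall fun w => up w.val w.isLt

lemma cycleGraph_triangle_free {n : ℕ} (hn : 4 ≤ n) (u a b : Fin n)
    (ha : (SimpleGraph.cycleGraph n).Adj u a) (hb : (SimpleGraph.cycleGraph n).Adj u b) :
    ¬ (SimpleGraph.cycleGraph n).Adj a b := by
  rw [cycleGraph_adj_iff_val (by omega)] at *
  omega

end Cycle

namespace GeometricGraph

lemma polygonMatching {n : ℕ} (hn : 4 ≤ n) {P : GeometricGraph (Fin n)} (hP : P ∈ polygons n)
    {M : SimpleGraph (Fin n)} (hM : P.IsMaximalCompatibleMatching M) :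
    ∃ X, PolygonMatching X (ys P.pos) P.graph M := by
  obtain ⟨hcyc, hg⟩ := hP
  obtain ⟨ε, hε⟩ := exists_shear P.pos_injective
  have hc : Crosses (fun v => xs P.pos v + ε * ys P.pos v) (ys P.pos)
      = Crosses (xs P.pos) (ys P.pos) := by
    funext a b c d
    simp only [Crosses, orient_shear]
  refine ⟨_, hε, ?_, fun a b c d h h' => ?_, hM.prop.matching,
    fun a b h h' => SimpleGraph.disjoint_left.1 hM.prop.disjoint a b h h', ?_, ?_, ?_, ?_⟩
  · have := hg.genPos
    simpa only [GenPos, orient_shear] using this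
  · rw [hc]; exact hM.prop.noncrossing.not_crosses h h'
  · rw [hcyc]; exact cycleGraph_two_neighbors (by omega)
  · rw [hcyc]; exact cycleGraph_connected (by omega)
  · rw [hcyc]; exact cycleGraph_triangle_free hn
  · rw [hc]
    intro u v huv hu hv hadj
    exact hM.exists_crosses hg huv hu hv hadj

/-- A maximal compatible matching of an `n`-vertex polygon has at least `n / 7` edges. -/
theorem card_le_seven_mul {n : ℕ} (hn : 4 ≤ n) {P : GeometricGraph (Fin n)} (hP : P ∈ polygons n)
    {M : SimpleGraph (Fin n)} (hM : P.IsMaximalCompatibleMatching M) :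
    n ≤ 7 * M.edgeSet.ncard := by
  obtain ⟨X, h⟩ := polygonMatching hn hP hM
  have : Nonempty (Fin n) := ⟨⟨0, by omega⟩⟩
  have h1 := h.two_mul_card_le
  rw [card_matched h.matching, Fintype.card_fin] at h1
  omega

lemma exists_isMaximalCompatibleMatching [Finite V] (G : GeometricGraph V) :
    ∃ M, G.IsMaximalCompatibleMatching M :=
  (Set.toFinite {M | G.IsCompatibleMatching M}).exists_maximal ⟨⊥, by simp, disjoint_bot_right, by
    simpa using G.noncrossing⟩

/-- The bound for all maximal compatible matchings gives the bound for the minimum over all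
polygons. -/
lemma le_seven_mul_mmFamily {n : ℕ} (hn : 4 ≤ n) (hne : (polygons n).Nonempty) :
    n ≤ 7 * mmFamily (polygons n) := by
  obtain ⟨P, hP, h⟩ := Nat.sInf_mem (hne.image mm)
  rw [mmFamily, ← h]
  obtain ⟨M₀, hM₀⟩ := P.exists_isMaximalCompatibleMatching
  obtain ⟨M, hM, h'⟩ := Nat.sInf_mem (s := {k : ℕ | ∃ M : SimpleGraph (Fin n),
    P.IsMaximalCompatibleMatching M ∧ M.edgeSet.ncard = k}) ⟨_, M₀, hM₀, rfl⟩
  rw [mm, ← h']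
  exact card_le_seven_mul hn hP hM

lemma mmFamily_le {n : ℕ} {P : GeometricGraph (Fin n)} (hP : P ∈ polygons n)
    {M : SimpleGraph (Fin n)} (hM : P.IsMaximalCompatibleMatching M) :
    mmFamily (polygons n) ≤ M.edgeSet.ncard :=
  (Nat.sInf_le (Set.mem_image_of_mem mm hP)).trans
    (Nat.sInf_le (show M.edgeSet.ncard ∈ {_k : ℕ | _} from ⟨M, hM, rfl⟩))

end GeometricGraph

end Bridge

section Parabola

namespace GeometricGraph

variable {V : Type*}

/-- Positions in the plane with given coordinates. -/
noncomputable def toPlane (X Y : V → ℝ) (v : V) : Plane := !₂[X v, Y v]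

lemma xs_toPlane (X Y : V → ℝ) : xs (toPlane X Y) = X := by
  funext v; simp [xs, toPlane]

lemma ys_toPlane (X Y : V → ℝ) : ys (toPlane X Y) = Y := by
  funext v; simp [ys, toPlane]

/-- The geometric graph with given coordinates. -/
noncomputable def ofCoords (X Y : V → ℝ) (G : SimpleGraph V) (hX : Function.Injective X)
    (hg : GenPos X Y) (hG : ∀ a b c d, G.Adj a b → G.Adj c d → ¬ Crosses X Y a b c d) :
    GeometricGraph V where
  pos := toPlane X Y
  graph := G
  pos_injective a b h := hX (by
    have := congrArg (fun p : Plane => p 0) h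
    simpa [toPlane] using this)
  noncrossing := isNoncrossing_of_not_crosses (by rwa [xs_toPlane, ys_toPlane])
    (by rwa [xs_toPlane, ys_toPlane])

lemma inGeneralPosition_ofCoords {X Y : V → ℝ} {G : SimpleGraph V} {hX : Function.Injective X}
    {hg : GenPos X Y} {hG : ∀ a b c d, G.Adj a b → G.Adj c d → ¬ Crosses X Y a b c d} :
    (ofCoords X Y G hX hg hG).InGeneralPosition := by
  intro a b c hab hbc hac h
  have : orient (xs (toPlane X Y)) (ys (toPlane X Y)) a b c = 0 := collinear_iff_orient_eq_zero.1 h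
  rw [xs_toPlane, ys_toPlane] at this
  exact hg a b c hab hbc hac this

/-- A criterion for maximality in terms of coordinates. -/
lemma isMaximalCompatibleMatching_ofCoords {X Y : V → ℝ} {G M : SimpleGraph V}
    {hX : Function.Injective X} {hg : GenPos X Y}
    {hG : ∀ a b c d, G.Adj a b → G.Adj c d → ¬ Crosses X Y a b c d}
    (hM : ∀ u v w, M.Adj u v → M.Adj u w → v = w) (hdisj : ∀ a b, G.Adj a b → ¬ M.Adj a b)
    (hGM : ∀ a b c d, (G ⊔ M).Adj a b → (G ⊔ M).Adj c d → ¬ Crosses X Y a b c d)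
    (hmax : ∀ u v, u ≠ v → (∀ w, ¬ M.Adj u w) → (∀ w, ¬ M.Adj v w) → ¬ G.Adj u v →
      ∃ c d, (G ⊔ M).Adj c d ∧ Crosses X Y u v c d) :
    (ofCoords X Y G hX hg hG).IsMaximalCompatibleMatching M := by
  refine ⟨⟨hM, SimpleGraph.disjoint_left.2 hdisj,
    isNoncrossing_of_not_crosses (by rwa [ofCoords, xs_toPlane, ys_toPlane])
      (by rwa [ofCoords, xs_toPlane, ys_toPlane])⟩, fun N hN hMN u v huv => ?_⟩
  by_cases hu : ∃ w, M.Adj u w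
  · obtain ⟨w, hw⟩ := hu
    rwa [← hN.matching u w v (hMN hw) huv]
  by_cases hv : ∃ w, M.Adj v w
  · obtain ⟨w, hw⟩ := hv
    have := hN.matching v w u (hMN hw) huv.symm
    exact this ▸ hw.symm
  push Not at hu hv
  obtain ⟨c, d, hcd, hcr⟩ := hmax u v huv.ne hu hv fun h =>
    SimpleGraph.disjoint_left.1 hN.disjoint u v h huv
  have hnc := hN.noncrossing.not_crosses (Or.inr huv) (sup_le_sup_left hMN _ hcd)
  rw [ofCoords, xs_toPlane, ys_toPlane] at hnc
  exact absurd hcr hnc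

lemma polygons_nonempty {n : ℕ} (hn : 3 ≤ n) : (polygons n).Nonempty := by
  have ho : ∀ a b c : Fin n, orient (fun i : Fin n => (i.val : ℝ)) (fun i => (i.val : ℝ) ^ 2) a b c
      = ((b.val : ℝ) - a.val) * (c.val - a.val) * (c.val - b.val) := fun a b c => by
    simp only [orient]; ring
  have hinj : Function.Injective fun i : Fin n => (i.val : ℝ) :=
    Nat.cast_injective.comp Fin.val_injective
  have hne : ∀ {a b : Fin n}, a ≠ b → (a.val : ℝ) - b.val ≠ 0 := fun h h' =>
    h (hinj (sub_eq_zero.1 h'))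
  have key : ∀ a b c d : Fin n, a.val + 1 = b.val →
      ¬ Crosses (fun i : Fin n => (i.val : ℝ)) (fun i => (i.val : ℝ) ^ 2) a b c d := by
    intro a b c d hab hcr
    have hnn : ∀ c : Fin n, 0 ≤ orient (fun i : Fin n => (i.val : ℝ)) (fun i => (i.val : ℝ) ^ 2)
        a b c := by
      intro c
      rw [ho, ← hab]
      push_cast
      rcases Nat.lt_or_ge a.val c.val with h | h
      · have h : (a.val : ℝ) + 1 ≤ c.val := by exact_mod_cast h
        exact mul_nonneg (mul_nonneg (by linarith) (by linarith)) (by linarith)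
      · have h : (c.val : ℝ) ≤ a.val := by exact_mod_cast h
        have := mul_nonneg (sub_nonneg.2 h) (show 0 ≤ (a.val : ℝ) + 1 - c.val by linarith)
        linarith
    exact absurd hcr.1 (not_lt.2 (mul_nonneg (hnn c) (hnn d)))
  refine ⟨ofCoords (fun i : Fin n => (i.val : ℝ)) (fun i => (i.val : ℝ) ^ 2)
    (SimpleGraph.cycleGraph n) hinj (fun a b c hab hbc hac => ?_) ?_, rfl,
    inGeneralPosition_ofCoords⟩
  · rw [ho]
    exact mul_ne_zero (mul_ne_zero (hne hab.symm) (hne hac.symm)) (hne hbc.symm)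
  · intro a b c d hab hcd hcr
    rw [cycleGraph_adj_iff_val hn] at hab hcd
    have hne := hcr.ne
    rcases hab with h | h | h
    · exact key _ _ _ _ h hcr
    · exact key _ _ _ _ h hcr.swap_left
    · rcases hcd with h' | h' | h'
      · exact key _ _ _ _ h' hcr.symm
      · exact key _ _ _ _ h' hcr.symm.swap_left
      · simp only [ne_eq, Fin.ext_iff] at hne
        omega

end GeometricGraph

end Parabola

/-! ### A polygon with a small maximal compatible matching

The vertices are points `(p, p ^ 2 + height p)` for integers `p > 0`, and one point far up on the
line `p = 0`; the vertices are identified with the numbers `p`. -/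

section Family

/-- The height over the parabola. -/
def height (p : ℤ) : ℤ := if p % 4 = 0 then 0 else if p % 2 = 0 then 8 else 24

/-- The vertical coordinates of the vertices. -/
def ordinate (t p : ℤ) : ℤ :=
  if p = 0 then (32 * t + 32) ^ 2 + 24 * (32 * t + 32) + 25 else p ^ 2 + height p

/-- The orientation of three vertices. -/
def det (t p q r : ℤ) : ℤ :=
  (q - p) * (ordinate t r - ordinate t p) - (ordinate t q - ordinate t p) * (r - p)

lemma height_cases (p : ℤ) : (p % 4 = 0 ∧ height p = 0) ∨ (p % 4 = 2 ∧ height p = 8) ∨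
    (p % 2 = 1 ∧ height p = 24) := by
  unfold height
  split_ifs <;> omega

lemma det_eq {t p q r : ℤ} (hp : p ≠ 0) (hq : q ≠ 0) (hr : r ≠ 0) :
    det t p q r = (q - p) * (r - p) * (r - q) + (q - p) * (height r - height p)
      - (height q - height p) * (r - p) := by
  simp only [det, ordinate, hp, hq, hr, if_false]
  ring

lemma det_rot (t p q r : ℤ) : det t q r p = det t p q r := by
  simp only [det]; ring

lemma det_swap (t p q r : ℤ) : det t q p r = -det t p q r := by
  simp only [det]; ring

lemma det_swap_right (t p q r : ℤ) : det t p r q = -det t p q r := by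
  simp only [det]; ring

/-- The vertex `0` lies above all lines spanned by other vertices. -/
lemma det_top_pos {t p q : ℤ} (hp : 0 < p) (hpq : p < q) (hq : q ≤ 32 * t + 32) :
    0 < det t p q 0 := by
  simp only [det, ordinate, hp.ne', (hp.trans hpq).ne', if_false, if_true]
  have h1 : p ^ 2 ≤ (32 * t + 32) ^ 2 := by nlinarith
  have h2 : -24 ≤ height q - height p := by
    rcases height_cases p with h | h | h <;> rcases height_cases q with h' | h' | h' <;> omega
  have h3 : height p ≤ 24 := by
    rcases height_cases p with h | h | h <;> omega
  have h4 : 0 < q ^ 2 - p ^ 2 := by nlinarith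
  have h5 : 1 ≤ q - p := by omega
  have h6 : 24 * p + 1 ≤ (32 * t + 32) ^ 2 + 24 * (32 * t + 32) + 25 - (p ^ 2 + height p) := by
    nlinarith
  have h7 : 24 * p + 1 ≤ (q - p) * ((32 * t + 32) ^ 2 + 24 * (32 * t + 32) + 25
    - (p ^ 2 + height p)) := by nlinarith
  have h8 : p * (q ^ 2 + height q - (p ^ 2 + height p)) ≥ p * (-24) :=
    mul_le_mul_of_nonneg_left (by linarith) hp.le
  linarith

/-- The kinds of vertices. -/
def IsVertex (t p : ℤ) : Prop :=
  p = 0 ∨ (p % 4 = 0 ∧ 4 ≤ p ∧ p ≤ 32 * t + 32) ∨ (p % 8 = 2 ∧ 10 ≤ p ∧ p ≤ 32 * t + 26) ∨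
    p = 21 ∨ p = 23 ∨ ((p % 32 = 13 ∨ p % 32 = 15) ∧ 45 ≤ p ∧ p ≤ 32 * t + 15)

lemma det_ne_zero {t p q r : ℤ} (hp : IsVertex t p) (hq : IsVertex t q) (hr : IsVertex t r)
    (ht : 0 ≤ t) (hpq : p ≠ q) (hqr : q ≠ r) (hpr : p ≠ r) : det t p q r ≠ 0 := by
  have bound : ∀ {p}, IsVertex t p → p ≠ 0 → 0 < p ∧ p ≤ 32 * t + 32 := by
    intro p hp h0; unfold IsVertex at hp; omega
  have top : ∀ {p q}, IsVertex t p → IsVertex t q → p ≠ q → p ≠ 0 → q ≠ 0 → det t p q 0 ≠ 0 := by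
    intro p q hp hq hpq hp0 hq0
    rcases lt_or_gt_of_ne hpq with h | h
    · exact (det_top_pos (bound hp hp0).1 h (bound hq hq0).2).ne'
    · rw [det_swap, neg_ne_zero]
      exact (det_top_pos (bound hq hq0).1 h (bound hp hp0).2).ne'
  by_cases hp0 : p = 0
  · subst hp0; rw [← det_rot]; exact top hq hr hqr hpq.symm hpr.symm
  by_cases hq0 : q = 0
  · subst hq0; rw [← det_rot, ← det_rot]; exact top hr hp hpr.symm hqr.symm hp0
  by_cases hr0 : r = 0
  · subst hr0; exact top hp hq hpq hp0 hq0
  -- two vertices of equal height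
  have pair : ∀ p q r : ℤ, p ≠ 0 → q ≠ 0 → r ≠ 0 → p ≠ q → q ≠ r → p ≠ r → height p = height q →
      det t p q r ≠ 0 := by
    intro p q r hp0 hq0 hr0 hpq hqr hpr h
    rw [det_eq hp0 hq0 hr0, h]
    have e : (q - p) * (r - p) * (r - q) + (q - p) * (height r - height q)
      - (height q - height q) * (r - p) = (q - p) * ((r - p) * (r - q) + (height r - height q)) := by
      ring
    rw [e]
    refine mul_ne_zero (sub_ne_zero.2 hpq.symm) ?_
    have even_even : ∀ a b : ℤ, p = r + 2 * (2 * a + 1) → q = r + 2 * (2 * b + 1) →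
        ∃ c, (r - p) * (r - q) = 4 * (2 * c + 1) := fun a b ha hb =>
      ⟨2 * a * b + a + b, by rw [ha, hb]; ring⟩
    have odd_odd : ∀ a b : ℤ, p = r + (2 * a + 1) → q = r + (2 * b + 1) →
        ∃ c, (r - p) * (r - q) = 2 * c + 1 := fun a b ha hb =>
      ⟨2 * a * b + a + b, by rw [ha, hb]; ring⟩
    have key : height r = height q ∨ (∃ c, (r - p) * (r - q) = 4 * (2 * c + 1)) ∧
        (height r = height q + 8 ∨ height r = height q - 8) ∨
        (∃ c, (r - p) * (r - q) = 2 * c + 1) ∧ ∃ c, height r - height q = 2 * c := by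
      rcases height_cases p with h1 | h1 | h1 <;> rcases height_cases q with h2 | h2 | h2 <;>
        rcases height_cases r with h3 | h3 | h3 <;>
        first
        | (exfalso; omega)
        | (left; omega)
        | (right; left
           exact ⟨even_even ((p - r) / 4) ((q - r) / 4) (by omega) (by omega), by omega⟩)
        | (right; right
           exact ⟨odd_odd ((p - r) / 2) ((q - r) / 2) (by omega) (by omega),
            (height r - height q) / 2, by omega⟩)
    rcases key with h3 | ⟨⟨c, hc⟩, h3⟩ | ⟨⟨c, hc⟩, d, hd⟩
    · rw [h3, sub_self, add_zero]
      exact mul_ne_zero (sub_ne_zero.2 hpr.symm) (sub_ne_zero.2 hqr.symm)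
    · omega
    · omega
  by_cases h1 : height p = height q
  · exact pair p q r hp0 hq0 hr0 hpq hqr hpr h1
  by_cases h2 : height q = height r
  · rw [← det_rot]; exact pair q r p hq0 hr0 hp0 hqr hpr.symm hpq.symm h2
  by_cases h3 : height r = height p
  · rw [← det_rot, ← det_rot]; exact pair r p q hr0 hp0 hq0 hpr.symm hpq hqr.symm h3
  -- three different heights
  have three : ∀ p q r : ℤ, p ≠ 0 → q ≠ 0 → r ≠ 0 → p % 4 = 0 → height p = 0 →
      q % 4 = 2 → height q = 8 → r % 2 = 1 → height r = 24 → det t p q r ≠ 0 := by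
    intro p q r hp0 hq0 hr0 hp hhp hq hhq hr hhr
    rw [det_eq hp0 hq0 hr0, hhp, hhq, hhr]
    obtain ⟨a, rfl⟩ : ∃ a, p = 4 * a := ⟨p / 4, by omega⟩
    obtain ⟨b, rfl⟩ : ∃ b, q = 4 * b + 2 := ⟨q / 4, by omega⟩
    obtain ⟨c, rfl⟩ : ∃ c, r = 2 * c + 1 := ⟨r / 2, by omega⟩
    have e : (4 * b + 2 - 4 * a) * (2 * c + 1 - 4 * a) * (2 * c + 1 - (4 * b + 2)) +
        (4 * b + 2 - 4 * a) * (24 - 0) - (8 - 0) * (2 * c + 1 - 4 * a)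
      = 4 * ((b - a) * (2 * c + 1 - 4 * a) * (2 * c + 1 - (4 * b + 2)) +
        (c - 2 * a) * (2 * c - 4 * b - 1) + (c - 2 * b - 1) + 6 * (4 * b + 2 - 4 * a)
          - 2 * (2 * c + 1 - 4 * a)) + 2 := by ring
    rw [e]
    omega
  rcases height_cases p with a | a | a <;> rcases height_cases q with b | b | b <;>
    rcases height_cases r with c | c | c <;> try (exfalso; omega)
  · exact three p q r hp0 hq0 hr0 a.1 a.2 b.1 b.2 c.1 c.2
  · rw [det_swap_right, neg_ne_zero]
    exact three p r q hp0 hr0 hq0 a.1 a.2 c.1 c.2 b.1 b.2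
  · rw [det_swap, neg_ne_zero]
    exact three q p r hq0 hp0 hr0 b.1 b.2 a.1 a.2 c.1 c.2
  · rw [← det_rot, ← det_rot]
    exact three r p q hr0 hp0 hq0 c.1 c.2 a.1 a.2 b.1 b.2
  · rw [← det_rot]
    exact three q r p hq0 hr0 hp0 b.1 b.2 c.1 c.2 a.1 a.2
  · rw [det_swap, neg_ne_zero, ← det_rot, ← det_rot]
    exact three r q p hr0 hq0 hp0 c.1 c.2 b.1 b.2 a.1 a.2

/-- The segments `pq` and `rs` cross. -/
def SegCross (t p q r s : ℤ) : Prop :=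
  det t p q r * det t p q s < 0 ∧ det t r s p * det t r s q < 0

/-- The number `g` starts a run `g`, `g + 3`, `g + 5`, `g + 8` of consecutive vertices of the
polygon, whose ends are matched with each other. -/
def IsBase (t g : ℤ) : Prop := g = 18 ∨ (g % 32 = 10 ∧ 42 ≤ g ∧ g ≤ 32 * t + 10)

/-- The edges of the polygon. -/
def PolyEdge (t p q : ℤ) : Prop :=
  (p % 4 = 0 ∧ 4 ≤ p ∧ q = p + 4 ∧ q ≤ 32 * t + 32) ∨
  (p % 8 = 2 ∧ 10 ≤ p ∧ q = p + 8 ∧ q ≤ 32 * t + 26 ∧ ¬ IsBase t p) ∨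
  (p = 4 ∧ q = 10) ∨ (p = 0 ∧ (q = 32 * t + 26 ∨ q = 32 * t + 32)) ∨
  (∃ g, IsBase t g ∧ ((p = g ∧ q = g + 3) ∨ (p = g + 3 ∧ q = g + 5) ∨ (p = g + 5 ∧ q = g + 8)))

/-- The edges of the matching. -/
def MatchEdge (t p q : ℤ) : Prop :=
  (p = 0 ∧ q = 10) ∨ (IsBase t p ∧ q = p + 8) ∨
    (p % 32 = 2 ∧ 34 ≤ p ∧ q = p + 24 ∧ q ≤ 32 * t + 26)

lemma low_det_nonneg {t p c : ℤ} (hp : p % 4 = 0) (hp4 : 4 ≤ p) (hpt : p + 4 ≤ 32 * t + 32)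
    (hc : IsVertex t c) : 0 ≤ det t p (p + 4) c := by
  by_cases hc0 : c = 0
  · rw [hc0]; exact (det_top_pos (by omega) (by omega) hpt).le
  rw [det_eq (by omega) (by omega) hc0]
  have h0 : height p = 0 := by rcases height_cases p with h | h | h <;> omega
  have h4 : height (p + 4) = 0 := by rcases height_cases (p + 4) with h | h | h <;> omega
  rw [h0, h4]
  obtain ⟨e, rfl⟩ : ∃ e, c = p + e := ⟨c - p, by ring⟩
  have key : 0 ≤ e * (e - 4) + height (p + e) := by
    rcases le_or_gt e 0 with h | h
    · rcases height_cases (p + e) with h' | h' | h' <;> nlinarith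
    rcases le_or_gt 4 e with h1 | h1
    · rcases height_cases (p + e) with h' | h' | h' <;> nlinarith
    have : e = 1 ∨ e = 2 ∨ e = 3 := by omega
    rcases this with rfl | rfl | rfl
    · rcases height_cases (p + 1) with h' | h' | h' <;> omega
    · rcases height_cases (p + 2) with h' | h' | h' <;> omega
    · rcases height_cases (p + 3) with h' | h' | h' <;> omega
  have e1 : (p + 4 - p) * (p + e - p) * (p + e - (p + 4)) + (p + 4 - p) * (height (p + e) - 0)
    - (0 - 0) * (p + e - p) = 4 * (e * (e - 4) + height (p + e)) := by ring
  rw [e1]; omega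

/-- The vertices other than those on the parabola, together with the extreme ones of these. -/
def IsUpper (t c : ℤ) : Prop := IsVertex t c ∧ (c % 4 = 0 → c = 0 ∨ c = 4 ∨ c = 32 * t + 32)

lemma middle_det_nonneg {t p c : ℤ} (hp : p % 8 = 2) (hp4 : 10 ≤ p) (hpt : p + 8 ≤ 32 * t + 26)
    (hc : IsUpper t c) : 0 ≤ det t p (p + 8) c := by
  by_cases hc0 : c = 0
  · rw [hc0]; exact (det_top_pos (by omega) (by omega) (by omega)).le
  rw [det_eq (by omega) (by omega) hc0]
  have h0 : height p = 8 := by rcases height_cases p with h | h | h <;> omega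
  have h4 : height (p + 8) = 8 := by rcases height_cases (p + 8) with h | h | h <;> omega
  rw [h0, h4]
  obtain ⟨e, rfl⟩ : ∃ e, c = p + e := ⟨c - p, by ring⟩
  have key : 0 ≤ e * (e - 8) + (height (p + e) - 8) := by
    obtain ⟨hv, hu⟩ := hc
    unfold IsVertex at hv
    rcases height_cases (p + e) with h' | h' | h'
    · have : e ≤ -2 ∨ 10 ≤ e := by omega
      rcases this with h | h <;> nlinarith
    · have : e ≤ 0 ∨ 8 ≤ e := by omega
      rcases this with h | h <;> nlinarith
    · nlinarith [sq_nonneg (e - 4)]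
  have e1 : (p + 8 - p) * (p + e - p) * (p + e - (p + 8)) + (p + 8 - p) * (height (p + e) - 8)
    - (8 - 8) * (p + e - p) = 8 * (e * (e - 8) + (height (p + e) - 8)) := by ring
  rw [e1]; omega

lemma left_det_nonneg {t c : ℤ} (ht : 0 ≤ t) (hc : IsUpper t c) : 0 ≤ det t 4 10 c := by
  by_cases hc0 : c = 0
  · rw [hc0]; exact (det_top_pos (by omega) (by omega) (by omega)).le
  rw [det_eq (by omega) (by omega) hc0]
  have h0 : height 4 = 0 := by decide
  have h4 : height 10 = 8 := by decide
  rw [h0, h4]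
  obtain ⟨hv, hu⟩ := hc
  unfold IsVertex at hv
  have : c = 4 ∨ c = 10 ∨ 12 ≤ c := by omega
  rcases this with rfl | rfl | h
  · norm_num [h0]
  · norm_num [h4]
  · rcases height_cases c with h' | h' | h' <;> nlinarith

lemma det_top_right {t p c : ℤ} (hp : 0 < p) (hpc : p ≤ c) (hc : c ≤ 32 * t + 32) :
    0 ≤ det t 0 p c := by
  rcases hpc.eq_or_lt with rfl | h
  · simp only [det]; ring_nf; rfl
  · rw [← det_rot]; exact (det_top_pos hp h hc).le

lemma det_top_left {t p c : ℤ} (hc : 0 < c) (hcp : c ≤ p) (hp : p ≤ 32 * t + 32) :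
    det t 0 p c ≤ 0 := by
  have := det_top_right hc hcp hp
  rw [det_swap_right]
  linarith

end Family

section FamilyNoncrossing

variable {t p q r s : ℤ}

lemma IsBase.height {g : ℤ} (h : IsBase t g) :
    g % 8 = 2 ∧ height g = 8 ∧ height (g + 3) = 24 ∧ height (g + 5) = 24 ∧ height (g + 8) = 8 := by
  unfold IsBase at h
  refine ⟨by omega, ?_, ?_, ?_, ?_⟩
  · rcases height_cases g with h' | h' | h' <;> omega
  · rcases height_cases (g + 3) with h' | h' | h' <;> omega
  · rcases height_cases (g + 5) with h' | h' | h' <;> omega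
  · rcases height_cases (g + 8) with h' | h' | h' <;> omega

/-- The edges over a matching edge. -/
def RunEdge (t p q : ℤ) : Prop :=
  ∃ g, IsBase t g ∧ ((p = g ∧ q = g + 3) ∨ (p = g + 3 ∧ q = g + 5) ∨ (p = g + 5 ∧ q = g + 8))

/-- The edges between distant vertices. -/
def ChordEdge (t p q : ℤ) : Prop := p % 32 = 2 ∧ 34 ≤ p ∧ q = p + 24 ∧ q ≤ 32 * t + 26

/-- All vertices of another run, and of all chords, lie above the edges of a run. -/
lemma run_det_nonneg {g e : ℤ} (hg : IsBase t g) (he : e ≤ -16 ∨ 24 ≤ e) (hc : g + e ≠ 0)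
    (h8 : 8 ≤ height (g + e)) : 0 ≤ det t g (g + 3) (g + e) ∧ 0 ≤ det t (g + 3) (g + 5) (g + e) ∧
      0 ≤ det t (g + 5) (g + 8) (g + e) := by
  obtain ⟨-, h0, h3, h5, h8'⟩ := hg.height
  have hg0 : 0 < g := by unfold IsBase at hg; omega
  rw [det_eq (by omega) (by omega) hc, det_eq (by omega) (by omega) hc,
    det_eq (by omega) (by omega) hc, h0, h3, h5, h8']
  refine ⟨?_, ?_, ?_⟩ <;> rcases he with h | h <;> nlinarith

lemma run_mul_nonneg (h : RunEdge t p q) (h' : RunEdge t r s) :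
    0 ≤ det t p q r * det t p q s := by
  obtain ⟨g, hg, h⟩ := h
  obtain ⟨g', hg', h'⟩ := h'
  have hh := hg.height
  have hh' := hg'.height
  have hg0 : 0 < g := by unfold IsBase at hg; omega
  by_cases hgg : g = g'
  · subst hgg
    rcases h with ⟨rfl, rfl⟩ | ⟨rfl, rfl⟩ | ⟨rfl, rfl⟩ <;>
      rcases h' with ⟨rfl, rfl⟩ | ⟨rfl, rfl⟩ | ⟨rfl, rfl⟩ <;>
      rw [det_eq (by omega) (by omega) (by omega), det_eq (by omega) (by omega) (by omega)] <;>
      simp only [hh.2.1, hh.2.2.1, hh.2.2.2.1, hh.2.2.2.2] <;> ring_nf <;> norm_num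
  · have hd : ∀ e, e = 0 ∨ e = 3 ∨ e = 5 ∨ e = 8 → g' - g + e ≤ -16 ∨ 24 ≤ g' - g + e := by
      unfold IsBase at hg hg'
      intro e he
      omega
    have key : ∀ e, e = 0 ∨ e = 3 ∨ e = 5 ∨ e = 8 → 0 ≤ det t p q (g' + e) := by
      intro e he
      have e1 : g' + e = g + (g' - g + e) := by ring
      have h8 : 8 ≤ height (g' + e) := by
        rcases he with rfl | rfl | rfl | rfl
        · rw [add_zero, hh'.2.1]
        · rw [hh'.2.2.1]; norm_num
        · rw [hh'.2.2.2.1]; norm_num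
        · rw [hh'.2.2.2.2]
      have h0 : g' + e ≠ 0 := by unfold IsBase at hg'; omega
      rw [e1] at h8 h0 ⊢
      have := run_det_nonneg hg (hd e he) h0 h8
      rcases h with ⟨rfl, rfl⟩ | ⟨rfl, rfl⟩ | ⟨rfl, rfl⟩
      · exact this.1
      · exact this.2.1
      · exact this.2.2
    have k0 := key 0 (by omega)
    rw [add_zero] at k0
    rcases h' with ⟨rfl, rfl⟩ | ⟨rfl, rfl⟩ | ⟨rfl, rfl⟩
    · exact mul_nonneg k0 (key 3 (by omega))
    · exact mul_nonneg (key 3 (by omega)) (key 5 (by omega))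
    · exact mul_nonneg (key 5 (by omega)) (key 8 (by omega))

lemma chord_det {e : ℤ} (h : ChordEdge t p q) (he : p + e ≠ 0) :
    det t p q (p + e) = 24 * (e * (e - 24) + (height (p + e) - 8)) := by
  obtain ⟨h1, h2, rfl, h3⟩ := h
  have h0 : height p = 8 := by rcases height_cases p with h | h | h <;> omega
  have h4 : height (p + 24) = 8 := by rcases height_cases (p + 24) with h | h | h <;> omega
  rw [det_eq (by omega) (by omega) he, h0, h4]
  ring

lemma chord_mul_nonneg (h : ChordEdge t p q) (h' : ChordEdge t r s ∨ RunEdge t r s) :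
    0 ≤ det t p q r * det t p q s := by
  have outer : ∀ c, c ≠ 0 → (c ≤ p ∨ p + 24 ≤ c) → 8 ≤ height c → 0 ≤ det t p q c := by
    intro c hc he h8
    obtain ⟨e, rfl⟩ : ∃ e, c = p + e := ⟨c - p, by ring⟩
    rw [chord_det h hc]
    have : e ≤ 0 ∨ 24 ≤ e := by omega
    rcases this with h | h <;> nlinarith
  have inner : ∀ c, (p + 8 ≤ c ∧ c ≤ p + 16) → det t p q c ≤ 0 := by
    intro c he
    have hp : 34 ≤ p := h.2.1
    obtain ⟨e, rfl⟩ : ∃ e, c = p + e := ⟨c - p, by ring⟩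
    rw [chord_det h (by omega)]
    have h24 : height (p + e) ≤ 24 := by
      rcases height_cases (p + e) with h | h | h <;> omega
    nlinarith [he.1, he.2]
  rcases h' with h' | ⟨g, hg, h'⟩
  · have hr8 : height r = 8 := by
      obtain ⟨h1, -⟩ := h'
      rcases height_cases r with h | h | h <;> omega
    have hs8 : height s = 8 := by
      obtain ⟨h1, -, h2, -⟩ := h'
      rcases height_cases s with h | h | h <;> omega
    have : (r ≤ p ∨ p + 24 ≤ r) ∧ (s ≤ p ∨ p + 24 ≤ s) := by
      unfold ChordEdge at h h'; omega
    have hr0 : r ≠ 0 ∧ s ≠ 0 := by unfold ChordEdge at h'; omega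
    exact mul_nonneg (outer r hr0.1 this.1 hr8.ge) (outer s hr0.2 this.2 hs8.ge)
  · have hh := hg.height
    have h8 : 8 ≤ height r ∧ 8 ≤ height s := by
      rcases h' with ⟨rfl, rfl⟩ | ⟨rfl, rfl⟩ | ⟨rfl, rfl⟩ <;> omega
    by_cases hgp : g = p + 8
    · exact mul_nonneg_of_nonpos_of_nonpos (inner r (by omega)) (inner s (by omega))
    · have : (r ≤ p ∨ p + 24 ≤ r) ∧ (s ≤ p ∨ p + 24 ≤ s) ∧ r ≠ 0 ∧ s ≠ 0 := by
        unfold ChordEdge at h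
        unfold IsBase at hg
        omega
      exact mul_nonneg (outer r this.2.2.1 this.1 h8.1) (outer s this.2.2.2 this.2.1 h8.2)

lemma isUpper_of_chord_or_run (ht : 0 ≤ t) (h : ChordEdge t p q ∨ RunEdge t p q) :
    (IsUpper t p ∧ 10 ≤ p ∧ p ≤ 32 * t + 26) ∧ (IsUpper t q ∧ 10 ≤ q ∧ q ≤ 32 * t + 26) := by
  rcases h with h | ⟨g, hg, h⟩
  · unfold ChordEdge at h
    simp only [IsUpper, IsVertex]
    omega
  · unfold IsBase at hg
    simp only [IsUpper, IsVertex]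
    omega

lemma top_mul_nonneg (hq : q = 10 ∨ q = 32 * t + 26 ∨ q = 32 * t + 32)
    (h : r = 0 ∨ ((10 ≤ r ∧ r ≤ 32 * t + 26) ∧ (10 ≤ s ∧ s ≤ 32 * t + 26))) :
    0 ≤ det t 0 q r * det t 0 q s := by
  rcases h with rfl | ⟨hr, hs⟩
  · have : det t 0 q 0 = 0 := by simp only [det]; ring
    rw [this, zero_mul]
  · by_cases h10 : q = 10
    · exact mul_nonneg (det_top_right (by omega) (by omega) (by omega))
        (det_top_right (by omega) (by omega) (by omega))
    · exact mul_nonneg_of_nonpos_of_nonpos (det_top_left (by omega) (by omega) (by omega))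
        (det_top_left (by omega) (by omega) (by omega))

/-- The edges of the polygon and of the matching do not cross. -/
lemma not_segCross (ht : 0 ≤ t) (h : PolyEdge t p q ∨ MatchEdge t p q)
    (h' : PolyEdge t r s ∨ MatchEdge t r s) : ¬ SegCross t p q r s := by
  have split : ∀ {p q}, PolyEdge t p q ∨ MatchEdge t p q →
      (p % 4 = 0 ∧ 4 ≤ p ∧ q = p + 4 ∧ q ≤ 32 * t + 32) ∨
      (p % 8 = 2 ∧ 10 ≤ p ∧ q = p + 8 ∧ q ≤ 32 * t + 26) ∨ (p = 4 ∧ q = 10) ∨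
      (p = 0 ∧ (q = 10 ∨ q = 32 * t + 26 ∨ q = 32 * t + 32)) ∨ (ChordEdge t p q ∨ RunEdge t p q) := by
    rintro p q ((h | h | h | h | h) | (h | h | h))
    · exact Or.inl h
    · exact Or.inr (Or.inl ⟨h.1, h.2.1, h.2.2.1, h.2.2.2.1⟩)
    · exact Or.inr (Or.inr (Or.inl h))
    · exact Or.inr (Or.inr (Or.inr (Or.inl ⟨h.1, Or.inr h.2⟩)))
    · exact Or.inr (Or.inr (Or.inr (Or.inr (Or.inr h))))
    · exact Or.inr (Or.inr (Or.inr (Or.inl ⟨h.1, Or.inl h.2⟩)))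
    · refine Or.inr (Or.inl ⟨h.1.height.1, ?_⟩)
      unfold IsBase at h; omega
    · exact Or.inr (Or.inr (Or.inr (Or.inr (Or.inl h))))
  -- the vertices of the later kinds of edges lie on one side of the earlier ones
  have key : ∀ {p q r s}, PolyEdge t p q ∨ MatchEdge t p q → PolyEdge t r s ∨ MatchEdge t r s →
      0 ≤ det t p q r * det t p q s ∨ 0 ≤ det t r s p * det t r s q := by
    intro p q r s h h'
    have vert : ∀ {p q}, PolyEdge t p q ∨ MatchEdge t p q → IsVertex t p ∧ IsVertex t q := by
      intro p q h
      rcases split h with h | h | h | h | h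
      · unfold IsVertex; omega
      · unfold IsVertex; omega
      · unfold IsVertex; omega
      · unfold IsVertex; omega
      · have := isUpper_of_chord_or_run ht h
        exact ⟨this.1.1.1, this.2.1.1⟩
    have upper : ∀ {p q}, (p % 8 = 2 ∧ 10 ≤ p ∧ q = p + 8 ∧ q ≤ 32 * t + 26) ∨ (p = 4 ∧ q = 10) ∨
      (p = 0 ∧ (q = 10 ∨ q = 32 * t + 26 ∨ q = 32 * t + 32)) ∨ (ChordEdge t p q ∨ RunEdge t p q) →
      IsUpper t p ∧ IsUpper t q := by
      intro p q h
      rcases h with h | h | h | h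
      · simp only [IsUpper, IsVertex]; omega
      · simp only [IsUpper, IsVertex]; omega
      · simp only [IsUpper, IsVertex]; omega
      · have := isUpper_of_chord_or_run ht h
        exact ⟨this.1.1, this.2.1⟩
    have v := vert h
    have v' := vert h'
    rcases split h with ⟨a1, a2, rfl, a4⟩ | h
    · exact Or.inl (mul_nonneg (low_det_nonneg a1 a2 a4 v'.1) (low_det_nonneg a1 a2 a4 v'.2))
    rcases split h' with ⟨a1, a2, rfl, a4⟩ | h'
    · exact Or.inr (mul_nonneg (low_det_nonneg a1 a2 a4 v.1) (low_det_nonneg a1 a2 a4 v.2))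
    have u := upper h
    have u' := upper h'
    rcases h with ⟨a1, a2, rfl, a4⟩ | h
    · exact Or.inl (mul_nonneg (middle_det_nonneg a1 a2 a4 u'.1) (middle_det_nonneg a1 a2 a4 u'.2))
    rcases h' with ⟨a1, a2, rfl, a4⟩ | h'
    · exact Or.inr (mul_nonneg (middle_det_nonneg a1 a2 a4 u.1) (middle_det_nonneg a1 a2 a4 u.2))
    rcases h with ⟨rfl, rfl⟩ | h
    · exact Or.inl (mul_nonneg (left_det_nonneg ht u'.1) (left_det_nonneg ht u'.2))
    rcases h' with ⟨rfl, rfl⟩ | h'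
    · exact Or.inr (mul_nonneg (left_det_nonneg ht u.1) (left_det_nonneg ht u.2))
    rcases h with ⟨rfl, hq⟩ | h
    · refine Or.inl (top_mul_nonneg hq ?_)
      rcases h' with h' | h'
      · exact Or.inl h'.1
      · have := isUpper_of_chord_or_run ht h'
        exact Or.inr ⟨this.1.2, this.2.2⟩
    rcases h' with ⟨rfl, hq⟩ | h'
    · refine Or.inr (top_mul_nonneg hq ?_)
      have := isUpper_of_chord_or_run ht h
      exact Or.inr ⟨this.1.2, this.2.2⟩
    rcases h with h | h
    · exact Or.inl (chord_mul_nonneg h h')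
    rcases h' with h' | h'
    · exact Or.inr (chord_mul_nonneg h' (Or.inr h))
    · exact Or.inl (run_mul_nonneg h h')
  rintro ⟨h1, h2⟩
  rcases key h h' with h3 | h3 <;> linarith

end FamilyNoncrossing

section FamilyMaximal

variable {t p q r s : ℤ}

/-- The unmatched vertices. -/
def IsFree (t p : ℤ) : Prop :=
  (p % 4 = 0 ∧ 4 ≤ p ∧ p ≤ 32 * t + 32) ∨
    p = 21 ∨ p = 23 ∨ ((p % 32 = 13 ∨ p % 32 = 15) ∧ 45 ≤ p ∧ p ≤ 32 * t + 15)

lemma height_of_mod_zero (h : p % 4 = 0) : height p = 0 := by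
  rcases height_cases p with h' | h' | h' <;> omega

lemma height_of_mod_two (h : p % 4 = 2) : height p = 8 := by
  rcases height_cases p with h' | h' | h' <;> omega

lemma height_of_odd (h : p % 2 = 1) : height p = 24 := by
  rcases height_cases p with h' | h' | h' <;> omega

lemma middle_edge (hr : r % 8 = 2) (h10 : 10 ≤ r) (hrt : r + 8 ≤ 32 * t + 26) :
    PolyEdge t r (r + 8) ∨ MatchEdge t r (r + 8) := by
  by_cases h : IsBase t r
  · exact Or.inr (Or.inr (Or.inl ⟨h, rfl⟩))
  · exact Or.inl (Or.inr (Or.inl ⟨hr, h10, rfl, hrt, h⟩))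

lemma middle_det {e : ℤ} (hr : r % 8 = 2) (h10 : 10 ≤ r) (he : r + e ≠ 0) :
    det t r (r + 8) (r + e) = 8 * (e * (e - 8) + (height (r + e) - 8)) := by
  rw [det_eq (by omega) (by omega) he, height_of_mod_two (by omega : r % 4 = 2),
    height_of_mod_two (by omega : (r + 8) % 4 = 2)]
  ring

lemma det_top_pos' (hp : 0 < p) (hpq : p < q) (hq : q ≤ 32 * t + 32) : 0 < det t 0 p q := by
  rw [← det_rot]; exact det_top_pos hp hpq hq

lemma det_top_neg (hp : 0 < p) (hpq : p < q) (hq : q ≤ 32 * t + 32) : det t 0 q p < 0 := by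
  rw [det_swap_right]
  have := det_top_pos' hp hpq hq
  linarith

/-- A segment whose right end is on the parabola crosses an edge around that end. -/
lemma exists_segCross_of_right_low (hp : IsFree t p) (hq : IsFree t q) (hq4 : q % 4 = 0)
    (hpq : p < q) (hadj : q ≠ p + 4) :
    ∃ r s, (PolyEdge t r s ∨ MatchEdge t r s) ∧ SegCross t p q r s := by
  unfold IsFree at hp hq
  obtain ⟨r, d, hr, hd, hrq⟩ : ∃ r d : ℤ, r % 8 = 2 ∧ (d = 2 ∨ d = 6) ∧ q = r + d := by
    rcases (by omega : q % 8 = 4 ∨ q % 8 = 0) with h | h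
    · exact ⟨q - 2, 2, by omega, by omega, by ring⟩
    · exact ⟨q - 6, 6, by omega, by omega, by ring⟩
  have hq0 := height_of_mod_zero hq4
  have hr8 := height_of_mod_two (by omega : r % 4 = 2)
  have h10 : 10 ≤ r := by omega
  -- the left end of the edge lies below the segment
  have hleft : det t p q r < 0 := by
    rw [det_eq (by omega) (by omega) (by omega), hq0, hr8]
    rcases (by omega : p % 4 = 0 ∨ p % 2 = 1) with h | h
    · rw [height_of_mod_zero h]
      obtain ⟨x, hx, rfl⟩ : ∃ x, (d = 2 ∧ 6 ≤ x ∨ d = 6 ∧ 2 ≤ x) ∧ p = r - x :=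
        ⟨r - p, by omega, by ring⟩
      subst hrq
      rcases hx with ⟨rfl, hx⟩ | ⟨rfl, hx⟩ <;> nlinarith
    · rw [height_of_odd h]
      rcases (by omega : p ≤ r - 3 ∨ (d = 6 ∧ p = r + 3) ∨ (d = 6 ∧ p = r + 5)) with h | h | h
      · obtain ⟨x, hx, rfl⟩ : ∃ x, 3 ≤ x ∧ p = r - x := ⟨r - p, by omega, by ring⟩
        subst hrq
        rcases hd with rfl | rfl <;> nlinarith
      · obtain ⟨rfl, rfl⟩ := h
        subst hrq; ring_nf; norm_num
      · obtain ⟨rfl, rfl⟩ := h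
        subst hrq; ring_nf; norm_num
  by_cases hlast : r + 8 ≤ 32 * t + 26
  · refine ⟨r, r + 8, middle_edge hr h10 hlast, mul_neg_of_neg_of_pos hleft ?_,
      mul_neg_of_pos_of_neg ?_ ?_⟩
    · rw [det_eq (by omega) (by omega) (by omega), hq0,
        height_of_mod_two (by omega : (r + 8) % 4 = 2)]
      obtain ⟨x, rfl⟩ : ∃ x, p = r - x := ⟨r - p, by ring⟩
      rcases (by omega : (r - x) % 4 = 0 ∨ (r - x) % 2 = 1) with h | h
      · rw [height_of_mod_zero h]
        subst hrq
        rcases hd with rfl | rfl <;> nlinarith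
      · rw [height_of_odd h]
        subst hrq
        have hx : -5 ≤ x := by omega
        rcases hd with rfl | rfl <;> nlinarith
    · obtain ⟨e, rfl⟩ : ∃ e, p = r + e := ⟨p - r, by ring⟩
      rw [middle_det hr h10 (by omega)]
      rcases (by omega : (r + e) % 4 = 0 ∨ (r + e) % 2 = 1) with h | h
      · rw [height_of_mod_zero h]
        have : e ≤ -2 := by omega
        nlinarith
      · rw [height_of_odd h]
        have : (e - 4) * (e - 4) ≠ 0 := mul_self_ne_zero.2 (by omega)
        have : 0 < (e - 4) * (e - 4) := lt_of_le_of_ne (mul_self_nonneg _) this.symm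
        linarith
    · subst hrq
      rw [middle_det hr h10 (by omega), hq0]
      rcases hd with rfl | rfl <;> norm_num
  · refine ⟨0, r, Or.inl (Or.inr (Or.inr (Or.inr (Or.inl ⟨rfl, by omega⟩)))),
      mul_neg_of_pos_of_neg (det_top_pos (by omega) hpq (by omega)) hleft,
      mul_neg_of_neg_of_pos (det_top_neg (by omega) (by omega) (by omega))
        (det_top_pos' (by omega) (by omega) (by omega))⟩

/-- A segment whose left end is on the parabola crosses an edge around that end. -/
lemma exists_segCross_of_left_low (hp : IsFree t p) (hq : IsFree t q) (hp4 : p % 4 = 0)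
    (hq2 : q % 2 = 1) (hpq : p < q) :
    ∃ r s, (PolyEdge t r s ∨ MatchEdge t r s) ∧ SegCross t p q r s := by
  unfold IsFree at hp hq
  obtain ⟨s, d, hs, hd, hsp⟩ : ∃ s d : ℤ, s % 8 = 2 ∧ (d = 2 ∨ d = 6) ∧ p = s - d := by
    rcases (by omega : p % 8 = 0 ∨ p % 8 = 4) with h | h
    · exact ⟨p + 2, 2, by omega, by omega, by ring⟩
    · exact ⟨p + 6, 6, by omega, by omega, by ring⟩
  have hp0 := height_of_mod_zero hp4
  have hs8 := height_of_mod_two (by omega : s % 4 = 2)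
  have hq24 := height_of_odd hq2
  have hright : det t p q s < 0 := by
    rw [det_eq (by omega) (by omega) (by omega), hp0, hs8, hq24]
    rcases (by omega : s + 3 ≤ q ∨ (d = 6 ∧ q = s - 5) ∨ (d = 6 ∧ q = s - 3)) with h | h | h
    · obtain ⟨y, hy, rfl⟩ : ∃ y, 3 ≤ y ∧ q = s + y := ⟨q - s, by omega, by ring⟩
      subst hsp
      rcases hd with rfl | rfl <;> nlinarith
    · obtain ⟨rfl, rfl⟩ := h
      subst hsp; ring_nf; norm_num
    · obtain ⟨rfl, rfl⟩ := h
      subst hsp; ring_nf; norm_num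
  by_cases hfirst : 18 ≤ s
  · obtain ⟨r, rfl⟩ : ∃ r, s = r + 8 := ⟨s - 8, by ring⟩
    have hr : r % 8 = 2 := by omega
    refine ⟨r, r + 8, middle_edge hr (by omega) (by omega), mul_neg_of_pos_of_neg ?_ hright,
      mul_neg_of_neg_of_pos ?_ ?_⟩
    · rw [det_eq (by omega) (by omega) (by omega), hp0, hq24,
        height_of_mod_two (by omega : r % 4 = 2)]
      obtain ⟨y, hy, rfl⟩ : ∃ y, 3 ≤ y ∧ q = r + y := ⟨q - r, by omega, by ring⟩
      subst hsp
      rcases hd with rfl | rfl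
      · have : 11 ≤ y := by omega
        nlinarith
      · nlinarith
    · have e : p = r + (8 - d) := by rw [hsp]; ring
      rw [e] at hp0 ⊢
      rw [middle_det hr (by omega) (by omega), hp0]
      rcases hd with rfl | rfl <;> norm_num
    · obtain ⟨e, rfl⟩ : ∃ e, q = r + e := ⟨q - r, by ring⟩
      rw [middle_det hr (by omega) (by omega), hq24]
      have : (e - 4) * (e - 4) ≠ 0 := mul_self_ne_zero.2 (by omega)
      have : 0 < (e - 4) * (e - 4) := lt_of_le_of_ne (mul_self_nonneg _) this.symm
      linarith
  · obtain rfl : s = 10 := by omega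
    exact ⟨0, 10, Or.inr (Or.inl ⟨rfl, rfl⟩),
      mul_neg_of_pos_of_neg (det_top_pos (by omega) hpq (by omega)) hright,
      mul_neg_of_neg_of_pos (det_top_neg (by omega) (by omega) (by omega))
        (det_top_pos' (by omega) (by omega) (by omega))⟩

/-- A segment between vertices of different runs crosses a chord. -/
lemma exists_segCross_of_odd (hp : IsFree t p) (hq : IsFree t q) (hp2 : p % 2 = 1)
    (hq2 : q % 2 = 1) (hpq : p < q) (hadj : q ≠ p + 2) :
    ∃ r s, (PolyEdge t r s ∨ MatchEdge t r s) ∧ SegCross t p q r s := by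
  unfold IsFree at hp hq
  have hp24 := height_of_odd hp2
  have hq24 := height_of_odd hq2
  obtain ⟨r, e, hr, he, rfl⟩ : ∃ r e : ℤ, r % 32 = 2 ∧ (e = 11 ∨ e = 13) ∧ q = r + e := by
    rcases (by omega : q % 32 = 13 ∨ q % 32 = 15) with h | h
    · exact ⟨q - 11, 11, by omega, by omega, by ring⟩
    · exact ⟨q - 13, 13, by omega, by omega, by ring⟩
  obtain ⟨x, hx, rfl⟩ : ∃ x, 11 ≤ x ∧ p = r - x := ⟨r - p, by omega, by ring⟩
  have hedge : ChordEdge t r (r + 24) := ⟨hr, by omega, rfl, by omega⟩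
  refine ⟨r, r + 24, Or.inr (Or.inr (Or.inr hedge)), mul_neg_of_neg_of_pos ?_ ?_,
    mul_neg_of_pos_of_neg ?_ ?_⟩
  · rw [det_eq (by omega) (by omega) (by omega), hp24, hq24,
      height_of_mod_two (by omega : r % 4 = 2)]
    rcases he with rfl | rfl <;> nlinarith
  · rw [det_eq (by omega) (by omega) (by omega), hp24, hq24,
      height_of_mod_two (by omega : (r + 24) % 4 = 2)]
    rcases he with rfl | rfl <;> nlinarith
  · have e1 : r - x = r + -x := by ring
    rw [e1] at hp24 ⊢
    rw [chord_det hedge (by omega), hp24]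
    nlinarith
  · rw [chord_det hedge (by omega), hq24]
    rcases he with rfl | rfl <;> norm_num

/-- Every segment between unmatched vertices that is not an edge of the polygon crosses an edge. -/
lemma exists_segCross (hp : IsFree t p) (hq : IsFree t q) (hpq : p < q)
    (hadj : ¬ PolyEdge t p q) : ∃ r s, (PolyEdge t r s ∨ MatchEdge t r s) ∧ SegCross t p q r s := by
  by_cases hq4 : q % 4 = 0
  · by_cases hp4 : q = p + 4
    · refine absurd (Or.inl ⟨?_, ?_, hp4, ?_⟩) hadj <;> unfold IsFree at hp hq <;> omega
    · exact exists_segCross_of_right_low hp hq hq4 hpq hp4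
  have hq2 : q % 2 = 1 := by unfold IsFree at hq; omega
  by_cases hp4 : p % 4 = 0
  · exact exists_segCross_of_left_low hp hq hp4 hq2 hpq
  have hp2 : p % 2 = 1 := by unfold IsFree at hp; omega
  refine exists_segCross_of_odd hp hq hp2 hq2 hpq fun h => hadj ?_
  refine Or.inr (Or.inr (Or.inr (Or.inr ⟨p - 3, ?_, Or.inr (Or.inl ⟨by ring, by omega⟩)⟩)))
  unfold IsFree at hp hq
  unfold IsBase
  omega

end FamilyMaximal

section FamilyPolygon

/-- The vertices of the polygon in cyclic order. -/
def abscissa (t i : ℕ) : ℤ :=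
  if i < 6 * t + 5 then
    if (i + 1) % 6 = 0 then 32 * ((i + 1) / 6 : ℕ) + 2
    else if (i + 1) % 6 = 1 then 32 * ((i + 1) / 6 : ℕ) + 10
    else if (i + 1) % 6 = 5 then 32 * ((i + 1) / 6 : ℕ) + 26
    else if i < 5 then if i = 1 then 18 else if i = 2 then 21 else 23
    else if (i + 1) % 6 = 2 then 32 * ((i + 1) / 6 : ℕ) + 13
    else if (i + 1) % 6 = 3 then 32 * ((i + 1) / 6 : ℕ) + 15
    else 32 * ((i + 1) / 6 : ℕ) + 18
  else if i = 6 * t + 5 then 0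
  else 4 * (14 * t + 14 - i)

/-- The relation between the indices and the vertices. -/
def IndexOf (t i p j : ℤ) : Prop :=
  (i = 0 ∧ p = 10) ∨ (i = 1 ∧ p = 18) ∨ (i = 2 ∧ p = 21) ∨ (i = 3 ∧ p = 23) ∨ (i = 4 ∧ p = 26) ∨
  (1 ≤ j ∧ j ≤ t ∧ i + 1 = 6 * j ∧ p = 32 * j + 2) ∨
  (1 ≤ j ∧ j ≤ t ∧ i + 1 = 6 * j + 1 ∧ p = 32 * j + 10) ∨
  (1 ≤ j ∧ j ≤ t ∧ i + 1 = 6 * j + 2 ∧ p = 32 * j + 13) ∨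
  (1 ≤ j ∧ j ≤ t ∧ i + 1 = 6 * j + 3 ∧ p = 32 * j + 15) ∨
  (1 ≤ j ∧ j ≤ t ∧ i + 1 = 6 * j + 4 ∧ p = 32 * j + 18) ∨
  (1 ≤ j ∧ j ≤ t ∧ i + 1 = 6 * j + 5 ∧ p = 32 * j + 26) ∨
  (i = 6 * t + 5 ∧ p = 0) ∨ (6 * t + 6 ≤ i ∧ i < 14 * t + 14 ∧ p = 4 * (14 * t + 14 - i))

lemma exists_indexOf {t i : ℕ} (hi : i < 14 * t + 14) : ∃ j, IndexOf t i (abscissa t i) j := by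
  refine ⟨((i + 1) / 6 : ℕ), ?_⟩
  unfold IndexOf
  rcases Nat.lt_or_ge i 5 with h5 | h5
  · interval_cases i <;> simp [abscissa]
  · unfold abscissa
    iterate 5 apply Or.inr
    split_ifs <;> (try (exfalso; omega)) <;>
      repeat (first | exact Or.inl (by omega) | apply Or.inr | omega)

lemma isVertex_abscissa {t i : ℕ} (hi : i < 14 * t + 14) : IsVertex t (abscissa t i) := by
  obtain ⟨j, h⟩ := exists_indexOf hi
  unfold IndexOf at h
  unfold IsVertex
  omega

lemma abscissa_injective {t i i' : ℕ} (hi : i < 14 * t + 14) (hi' : i' < 14 * t + 14)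
    (h : abscissa t i = abscissa t i') : i = i' := by
  obtain ⟨j, h1⟩ := exists_indexOf hi
  obtain ⟨j', h2⟩ := exists_indexOf hi'
  rw [← h] at h2
  unfold IndexOf at h1 h2
  rcases h1 with h1 | h1 | h1 | h1 | h1 | h1 | h1 | h1 | h1 | h1 | h1 | h1 | h1 <;> omega

lemma abscissa_surjective {t : ℕ} {p : ℤ} (hp : IsVertex t p) :
    ∃ i, i < 14 * t + 14 ∧ abscissa t i = p := by
  have key : ∀ i : ℕ, i < 14 * t + 14 → (∀ p', ∀ j, IndexOf t i p' j → p' = p) →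
      ∃ i, i < 14 * t + 14 ∧ abscissa t i = p := by
    intro i hi h
    obtain ⟨j, hj⟩ := exists_indexOf hi
    exact ⟨i, hi, h _ _ hj⟩
  unfold IsVertex at hp
  rcases hp with rfl | hp | hp | rfl | rfl | hp
  · refine key (6 * t + 5) (by omega) fun p' j h => ?_
    unfold IndexOf at h; push_cast at h; omega
  · refine key (14 * t + 14 - p / 4).toNat (by omega) fun p' j h => ?_
    unfold IndexOf at h; omega
  · by_cases h32 : p < 32
    · refine key (if p = 10 then 0 else if p = 18 then 1 else 4) (by split_ifs <;> omega)
        fun p' j h => ?_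
      unfold IndexOf at h; split_ifs at h <;> omega
    · have hmod : p % 32 = 2 ∨ p % 32 = 10 ∨ p % 32 = 18 ∨ p % 32 = 26 := by omega
      rcases hmod with hm | hm | hm | hm
      · refine key (6 * (p / 32) - 1).toNat (by omega) fun p' j h => ?_
        unfold IndexOf at h; omega
      · refine key (6 * (p / 32)).toNat (by omega) fun p' j h => ?_
        unfold IndexOf at h; omega
      · refine key (6 * (p / 32) + 3).toNat (by omega) fun p' j h => ?_
        unfold IndexOf at h; omega
      · refine key (6 * (p / 32) + 4).toNat (by omega) fun p' j h => ?_
        unfold IndexOf at h; omega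
  · refine key 2 (by omega) fun p' j h => ?_
    unfold IndexOf at h; omega
  · refine key 3 (by omega) fun p' j h => ?_
    unfold IndexOf at h; omega
  · rcases hp with ⟨hm | hm, hp⟩
    · refine key (6 * (p / 32) + 1).toNat (by omega) fun p' j h => ?_
      unfold IndexOf at h; omega
    · refine key (6 * (p / 32) + 2).toNat (by omega) fun p' j h => ?_
      unfold IndexOf at h; omega

/-- The edges of the polygon in terms of their first vertex. -/
lemma polyEdge_iff {t p q : ℤ} : PolyEdge t p q ↔
    (p % 4 = 0 ∧ 4 ≤ p ∧ q = p + 4 ∧ q ≤ 32 * t + 32) ∨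
    (p % 8 = 2 ∧ 10 ≤ p ∧ q = p + 8 ∧ q ≤ 32 * t + 26 ∧ p ≠ 18 ∧
      ¬ (p % 32 = 10 ∧ 42 ≤ p ∧ p ≤ 32 * t + 10)) ∨
    (p = 4 ∧ q = 10) ∨ (p = 0 ∧ (q = 32 * t + 26 ∨ q = 32 * t + 32)) ∨
    (p = 18 ∧ q = 21) ∨ (p = 21 ∧ q = 23) ∨ (p = 23 ∧ q = 26) ∨
    (p % 32 = 10 ∧ 42 ≤ p ∧ p ≤ 32 * t + 10 ∧ q = p + 3) ∨
    (p % 32 = 13 ∧ 45 ≤ p ∧ p ≤ 32 * t + 13 ∧ q = p + 2) ∨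
    (p % 32 = 15 ∧ 47 ≤ p ∧ p ≤ 32 * t + 15 ∧ q = p + 3) := by
  constructor
  · rintro (h | h | h | h | ⟨g, hg | hg, h | h | h⟩)
    · exact Or.inl h
    · unfold IsBase at h; exact Or.inr (Or.inl (by omega))
    · exact Or.inr (Or.inr (Or.inl h))
    · exact Or.inr (Or.inr (Or.inr (Or.inl h)))
    all_goals
      iterate 4 apply Or.inr
      repeat (first | exact Or.inl (by omega) | apply Or.inr | omega)
  · rintro (h | h | h | h | h | h | h | h | h | h)
    · exact Or.inl h
    · refine Or.inr (Or.inl ⟨h.1, h.2.1, h.2.2.1, h.2.2.2.1, ?_⟩)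
      unfold IsBase; omega
    · exact Or.inr (Or.inr (Or.inl h))
    · exact Or.inr (Or.inr (Or.inr (Or.inl h)))
    · exact Or.inr (Or.inr (Or.inr (Or.inr ⟨18, Or.inl rfl, by omega⟩)))
    · exact Or.inr (Or.inr (Or.inr (Or.inr ⟨18, Or.inl rfl, by omega⟩)))
    · exact Or.inr (Or.inr (Or.inr (Or.inr ⟨18, Or.inl rfl, by omega⟩)))
    · exact Or.inr (Or.inr (Or.inr (Or.inr ⟨p, Or.inr (by omega), by omega⟩)))
    · exact Or.inr (Or.inr (Or.inr (Or.inr ⟨p - 3, Or.inr (by omega), by omega⟩)))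
    · exact Or.inr (Or.inr (Or.inr (Or.inr ⟨p - 5, Or.inr (by omega), by omega⟩)))

/-- Consecutive vertices span the edges of the polygon. -/
lemma polyEdge_of_succ {t i i' : ℕ} (hi : i < 14 * t + 14) (hi' : i' < 14 * t + 14)
    (h : i + 1 = i' ∨ (i' = 0 ∧ i + 1 = 14 * t + 14)) :
    PolyEdge t (abscissa t i) (abscissa t i') ∨ PolyEdge t (abscissa t i') (abscissa t i) := by
  obtain ⟨j, h1⟩ := exists_indexOf hi
  obtain ⟨j', h2⟩ := exists_indexOf hi'
  rw [polyEdge_iff, polyEdge_iff]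
  generalize abscissa t i = p at *
  generalize abscissa t i' = q at *
  unfold IndexOf at h1 h2
  rcases h1 with h1 | h1 | h1 | h1 | h1 | h1 | h1 | h1 | h1 | h1 | h1 | h1 | h1 <;>
    rcases h2 with h2 | h2 | h2 | h2 | h2 | h2 | h2 | h2 | h2 | h2 | h2 | h2 | h2 <;>
    first
    | (exfalso; omega)
    | (refine Or.inl ?_
       repeat (first | exact Or.inl (by omega) | apply Or.inr | omega)
       done)
    | (refine Or.inr ?_
       repeat (first | exact Or.inl (by omega) | apply Or.inr | omega))

lemma succ_of_polyEdge {t i i' : ℕ} (hi : i < 14 * t + 14) (hi' : i' < 14 * t + 14)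
    (h : PolyEdge t (abscissa t i) (abscissa t i')) :
    i + 1 = i' ∨ i' + 1 = i ∨ (i = 0 ∧ i' + 1 = 14 * t + 14) ∨ (i' = 0 ∧ i + 1 = 14 * t + 14) := by
  obtain ⟨j, h1⟩ := exists_indexOf hi
  obtain ⟨j', h2⟩ := exists_indexOf hi'
  rw [polyEdge_iff] at h
  generalize abscissa t i = p at *
  generalize abscissa t i' = q at *
  unfold IndexOf at h1 h2
  rcases h with h | h | h | h | h | h | h | h | h | h <;>
  rcases h1 with h1 | h1 | h1 | h1 | h1 | h1 | h1 | h1 | h1 | h1 | h1 | h1 | h1 <;>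
    first
    | (exfalso; omega)
    | (rcases h2 with h2 | h2 | h2 | h2 | h2 | h2 | h2 | h2 | h2 | h2 | h2 | h2 | h2 <;> omega)

end FamilyPolygon

section FamilyTight

open GeometricGraph

/-- The horizontal coordinates of the vertices of the polygon. -/
def tightX (t : ℕ) (i : Fin (14 * t + 14)) : ℝ := (abscissa t i : ℝ)

/-- The vertical coordinates of the vertices of the polygon. -/
def tightY (t : ℕ) (i : Fin (14 * t + 14)) : ℝ := (ordinate t (abscissa t i) : ℝ)

lemma orient_tight (t : ℕ) (a b c : Fin (14 * t + 14)) : orient (tightX t) (tightY t) a b c =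
    (det t (abscissa t a) (abscissa t b) (abscissa t c) : ℝ) := by
  simp only [orient, tightX, tightY, det]
  push_cast
  ring

lemma crosses_tight {t : ℕ} {a b c d : Fin (14 * t + 14)} :
    Crosses (tightX t) (tightY t) a b c d ↔
      SegCross t (abscissa t a) (abscissa t b) (abscissa t c) (abscissa t d) := by
  simp only [Crosses, SegCross, orient_tight]
  norm_cast

lemma matchEdge_ne {t p q : ℤ} (h : MatchEdge t p q) : p < q := by
  rcases h with h | h | h <;> omega

/-- A maximal compatible matching of the polygon. -/
def tightMatching (t : ℕ) : SimpleGraph (Fin (14 * t + 14)) where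
  Adj i j := MatchEdge t (abscissa t i) (abscissa t j) ∨ MatchEdge t (abscissa t j) (abscissa t i)
  symm := ⟨fun _ _ h => h.symm⟩
  loopless := ⟨fun i h => by
    rcases h with h | h <;> exact lt_irrefl _ (matchEdge_ne h)⟩

lemma cycleGraph_adj_tight {t : ℕ} {i j : Fin (14 * t + 14)} :
    (SimpleGraph.cycleGraph (14 * t + 14)).Adj i j ↔
      PolyEdge t (abscissa t i) (abscissa t j) ∨ PolyEdge t (abscissa t j) (abscissa t i) := by
  rw [cycleGraph_adj_iff_val (by omega)]
  constructor
  · rintro (h | h | h | h)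
    · exact polyEdge_of_succ i.isLt j.isLt (Or.inl h)
    · exact (polyEdge_of_succ j.isLt i.isLt (Or.inl h)).symm
    · exact (polyEdge_of_succ j.isLt i.isLt (Or.inr h)).symm
    · exact polyEdge_of_succ i.isLt j.isLt (Or.inr h)
  · rintro (h | h)
    · exact succ_of_polyEdge i.isLt j.isLt h
    · have := succ_of_polyEdge j.isLt i.isLt h
      tauto

lemma edge_of_adj {t : ℕ} {i j : Fin (14 * t + 14)}
    (h : (SimpleGraph.cycleGraph (14 * t + 14) ⊔ tightMatching t).Adj i j) :
    (PolyEdge t (abscissa t i) (abscissa t j) ∨ MatchEdge t (abscissa t i) (abscissa t j)) ∨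
      (PolyEdge t (abscissa t j) (abscissa t i) ∨ MatchEdge t (abscissa t j) (abscissa t i)) := by
  rcases h with h | h
  · exact (cycleGraph_adj_tight.1 h).imp Or.inl Or.inl
  · exact Or.imp Or.inr Or.inr h

lemma noncrossing_tight {t : ℕ} (a b c d : Fin (14 * t + 14))
    (hab : (SimpleGraph.cycleGraph (14 * t + 14) ⊔ tightMatching t).Adj a b)
    (hcd : (SimpleGraph.cycleGraph (14 * t + 14) ⊔ tightMatching t).Adj c d) :
    ¬ Crosses (tightX t) (tightY t) a b c d := by
  intro h
  have ht : (0 : ℤ) ≤ t := Int.natCast_nonneg t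
  rcases edge_of_adj hab with h1 | h1 <;> rcases edge_of_adj hcd with h2 | h2
  · exact not_segCross ht h1 h2 (crosses_tight.1 h)
  · exact not_segCross ht h1 h2 (crosses_tight.1 h.swap_right)
  · exact not_segCross ht h1 h2 (crosses_tight.1 h.swap_left)
  · exact not_segCross ht h1 h2 (crosses_tight.1 h.swap_left.swap_right)

lemma tightX_injective (t : ℕ) : Function.Injective (tightX t) := fun a b h =>
  Fin.ext (abscissa_injective a.isLt b.isLt (by simpa [tightX] using h))

lemma genPos_tight (t : ℕ) : GenPos (tightX t) (tightY t) := by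
  intro a b c hab hbc hac
  have ne : ∀ {a b : Fin (14 * t + 14)}, a ≠ b → abscissa t a ≠ abscissa t b := fun h h' =>
    h (Fin.ext (abscissa_injective (Fin.isLt _) (Fin.isLt _) h'))
  rw [orient_tight]
  exact_mod_cast det_ne_zero (isVertex_abscissa a.isLt) (isVertex_abscissa b.isLt)
    (isVertex_abscissa c.isLt) (Int.natCast_nonneg t) (ne hab) (ne hbc) (ne hac)

/-- A polygon with `14 * t + 14` vertices. -/
noncomputable def tightPolygon (t : ℕ) : GeometricGraph (Fin (14 * t + 14)) :=
  ofCoords (tightX t) (tightY t) (SimpleGraph.cycleGraph (14 * t + 14)) (tightX_injective t)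
    (genPos_tight t) fun a b c d hab hcd => noncrossing_tight a b c d (Or.inl hab) (Or.inl hcd)

lemma tightPolygon_mem (t : ℕ) : tightPolygon t ∈ polygons (14 * t + 14) :=
  ⟨rfl, inGeneralPosition_ofCoords⟩

lemma tightMatching_unique {t : ℕ} (u v w : Fin (14 * t + 14)) (h : (tightMatching t).Adj u v)
    (h' : (tightMatching t).Adj u w) : v = w := by
  refine Fin.ext (abscissa_injective v.isLt w.isLt ?_)
  have h : MatchEdge _ _ _ ∨ MatchEdge _ _ _ := h
  have h' : MatchEdge _ _ _ ∨ MatchEdge _ _ _ := h'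
  unfold MatchEdge IsBase at h h'
  generalize abscissa t u = p at *
  generalize abscissa t v = q at *
  generalize abscissa t w = r at *
  rcases h with (h | h | h) | (h | h | h) <;> rcases h' with (h' | h' | h') | (h' | h' | h') <;> omega

lemma exists_abscissa {t : ℕ} {p : ℤ} (hp : IsVertex t p) :
    ∃ i : Fin (14 * t + 14), abscissa t i = p := by
  obtain ⟨i, hi, h⟩ := abscissa_surjective hp
  exact ⟨⟨i, hi⟩, h⟩

lemma isVertex_of_edge {t p q : ℤ} (ht : 0 ≤ t) (h : PolyEdge t p q ∨ MatchEdge t p q) :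
    IsVertex t p ∧ IsVertex t q := by
  rcases h with (h | h | h | h | h) | (h | h | h)
  · unfold IsVertex; omega
  · unfold IsVertex; omega
  · unfold IsVertex; omega
  · unfold IsVertex; omega
  · have := isUpper_of_chord_or_run ht (Or.inr h)
    exact ⟨this.1.1.1, this.2.1.1⟩
  · unfold IsVertex; omega
  · unfold IsBase at h; unfold IsVertex; omega
  · unfold IsVertex; omega

lemma isFree_of_unmatched {t : ℕ} {u : Fin (14 * t + 14)} (hu : ∀ w, ¬ (tightMatching t).Adj u w) :
    IsFree t (abscissa t u) := by
  have ht : (0 : ℤ) ≤ t := Int.natCast_nonneg t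
  have hv := isVertex_abscissa u.isLt
  by_contra hfree
  have key : ∀ q : ℤ, MatchEdge t (abscissa t u) q ∨ MatchEdge t q (abscissa t u) → False := by
    rintro q h
    have hq : IsVertex t q := by
      rcases h with h | h
      · exact (isVertex_of_edge ht (Or.inr h)).2
      · exact (isVertex_of_edge ht (Or.inr h)).1
    obtain ⟨w, rfl⟩ := exists_abscissa hq
    exact hu w h
  generalize abscissa t u = p at *
  have hz : p = 0 ∨ (p % 8 = 2 ∧ 10 ≤ p ∧ p ≤ 32 * t + 26) := by
    unfold IsVertex at hv; unfold IsFree at hfree; omega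
  unfold MatchEdge IsBase at key
  rcases hz with rfl | ⟨h8, h10, hle⟩
  · exact key 10 (Or.inl (Or.inl ⟨rfl, rfl⟩))
  rcases lt_or_ge p 32 with h32 | h32
  · rcases (by omega : p = 10 ∨ p = 18 ∨ p = 26) with rfl | rfl | rfl
    · exact key 0 (Or.inr (Or.inl ⟨rfl, rfl⟩))
    · exact key 26 (Or.inl (Or.inr (Or.inl ⟨Or.inl rfl, rfl⟩)))
    · exact key 18 (Or.inr (Or.inr (Or.inl ⟨Or.inl rfl, rfl⟩)))
  · rcases (by omega : p % 32 = 2 ∨ p % 32 = 10 ∨ p % 32 = 18 ∨ p % 32 = 26) with h | h | h | h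
    · exact key (p + 24) (Or.inl (Or.inr (Or.inr (by omega))))
    · exact key (p + 8) (Or.inl (Or.inr (Or.inl ⟨Or.inr (by omega), rfl⟩)))
    · exact key (p - 8) (Or.inr (Or.inr (Or.inl ⟨Or.inr (by omega), by ring⟩)))
    · exact key (p - 24) (Or.inr (Or.inr (Or.inr (by omega))))

lemma isMaximal_tightMatching (t : ℕ) :
    (tightPolygon t).IsMaximalCompatibleMatching (tightMatching t) := by
  have ht : (0 : ℤ) ≤ t := Int.natCast_nonneg t
  refine isMaximalCompatibleMatching_ofCoords tightMatching_unique (fun a b hP hM => ?_)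
    noncrossing_tight fun u v huv hu hv hadj => ?_
  · have hM : MatchEdge _ _ _ ∨ MatchEdge _ _ _ := hM
    have hP := cycleGraph_adj_tight.1 hP
    rw [polyEdge_iff, polyEdge_iff] at hP
    unfold MatchEdge IsBase at hM
    rcases hM with (h | h | h) | (h | h | h) <;> omega
  · have fu := isFree_of_unmatched hu
    have fv := isFree_of_unmatched hv
    rw [cycleGraph_adj_tight] at hadj
    push Not at hadj
    have main : ∀ u v : Fin (14 * t + 14), IsFree t (abscissa t u) → IsFree t (abscissa t v) →
        abscissa t u < abscissa t v → ¬ PolyEdge t (abscissa t u) (abscissa t v) →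
        ∃ c d, (SimpleGraph.cycleGraph (14 * t + 14) ⊔ tightMatching t).Adj c d ∧
          Crosses (tightX t) (tightY t) u v c d := by
      intro u v fu fv hlt hadj
      obtain ⟨r, s, hrs, hcr⟩ := exists_segCross fu fv hlt hadj
      have hvert := isVertex_of_edge ht hrs
      obtain ⟨c, rfl⟩ := exists_abscissa hvert.1
      obtain ⟨d, rfl⟩ := exists_abscissa hvert.2
      refine ⟨c, d, ?_, crosses_tight.2 hcr⟩
      rcases hrs with h | h
      · exact Or.inl (cycleGraph_adj_tight.2 (Or.inl h))
      · exact Or.inr (Or.inl h)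
    have hne : abscissa t u ≠ abscissa t v := fun h =>
      huv (Fin.ext (abscissa_injective u.isLt v.isLt h))
    rcases lt_or_gt_of_ne hne with h | h
    · exact main u v fu fv h hadj.1
    · obtain ⟨c, d, hcd, hcr⟩ := main v u fv fu h hadj.2
      exact ⟨c, d, hcd, hcr.swap_left⟩

open Classical in
lemma ncard_tightMatching (t : ℕ) : (tightMatching t).edgeSet.ncard = 2 * t + 2 := by
  have h1 := card_le_seven_mul (by omega) (tightPolygon_mem t) (isMaximal_tightMatching t)
  have h2 := card_matched (M := tightMatching t) tightMatching_unique
  have h3 : (Finset.univ.filter (Matched (tightMatching t))).card ≤ (Finset.range (4 * t + 4)).card := by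
    have hz : ∀ i : Fin (14 * t + 14), Matched (tightMatching t) i →
        abscissa t i = 0 ∨ (abscissa t i % 8 = 2 ∧ 10 ≤ abscissa t i ∧ abscissa t i ≤ 32 * t + 26) := by
      rintro i ⟨j, h⟩
      have h : MatchEdge _ _ _ ∨ MatchEdge _ _ _ := h
      unfold MatchEdge IsBase at h
      rcases h with (h | h | h) | (h | h | h) <;> omega
    refine Finset.card_le_card_of_injOn (fun i => (abscissa t i / 8).toNat) (fun i hi => ?_)
      fun i hi j hj hij => ?_
    · have := hz i (by simpa using hi)
      simp only [Finset.coe_range, Set.mem_Iio]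
      omega
    · have h1 := hz i (by simpa using hi)
      have h2 := hz j (by simpa using hj)
      simp only at hij
      exact Fin.ext (abscissa_injective i.isLt j.isLt (by omega))
  rw [h2, Finset.card_range] at h3
  omega

end FamilyTight

theorem theorem3 :
    (∀ n : ℕ, 4 ≤ n →
      (∀ P ∈ GeometricGraph.polygons n, ∀ M : SimpleGraph (Fin n),
        P.IsMaximalCompatibleMatching M → (n : ℝ) / 7 ≤ (M.edgeSet.ncard : ℝ)) ∧
      (n : ℝ) / 7 ≤ (GeometricGraph.mmFamily (GeometricGraph.polygons n) : ℝ)) ∧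
    {n : ℕ | 4 ≤ n ∧
      (GeometricGraph.mmFamily (GeometricGraph.polygons n) : ℝ) = (n : ℝ) / 7 ∧
      ∃ P ∈ GeometricGraph.polygons n, ∃ M : SimpleGraph (Fin n),
        P.IsMaximalCompatibleMatching M ∧ (M.edgeSet.ncard : ℝ) = (n : ℝ) / 7}.Infinite := by
  have cast_le : ∀ n k : ℕ, n ≤ 7 * k → (n : ℝ) / 7 ≤ k := fun n k h => by
    rw [div_le_iff₀ (by norm_num), mul_comm]
    exact_mod_cast h
  refine ⟨fun n hn => ⟨fun P hP M hM => cast_le _ _ (GeometricGraph.card_le_seven_mul hn hP hM),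
    cast_le _ _ (GeometricGraph.le_seven_mul_mmFamily hn
      (GeometricGraph.polygons_nonempty (by omega)))⟩, ?_⟩
  refine Set.infinite_of_injective_forall_mem (f := fun t : ℕ => 14 * t + 14)
    (fun a b h => by simpa using h) fun t => ?_
  have hcard := ncard_tightMatching t
  have hle := GeometricGraph.mmFamily_le (tightPolygon_mem t) (isMaximal_tightMatching t)
  have hge := GeometricGraph.le_seven_mul_mmFamily (n := 14 * t + 14) (by omega)
    ⟨_, tightPolygon_mem t⟩
  have heq : GeometricGraph.mmFamily (GeometricGraph.polygons (14 * t + 14)) = 2 * t + 2 := by omega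
  refine ⟨by omega, ?_, _, tightPolygon_mem t, _, isMaximal_tightMatching t, ?_⟩
  · rw [heq]; push_cast; ring
  · rw [hcard]; push_cast; ring
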